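/- **Setting.** Let $\pi\colon E\to B$ be a fibered manifold (a smooth surjective submersion) with $\dim E=n+1$, $\dim B=1$, $E$ and $B$ connected and paracompact, let $\varpi$ be a volume form on $B$, and let $J^1E$ be its first jet bundle, with projection $\pi^1\colon J^1E\to E$ and $\eta=(\pi\circ\pi^1)^*\varpi$. Let $\mathcal L=\pounds\,\eta$, $\pounds\in C^\infty(J^1E)$, be a Lagrangian density, $\Theta_{\mathcal L}=i(\mathcal V)\mathcal L+\mathcal L$ ($\mathcal V$ the vertical endomorphism) and $\Omega_{\mathcal L}=-d\Theta_{\mathcal L}$ its Poincaré–Cartan forms. Let $\widetilde{FL}\colon J^1E\to T^*E$ be the extended Legendre map, $[\widetilde{FL}(y)](\pi^1_*Z)=\Theta_{\mathcal L}(Z)$ for $Z\in T_yJ^1E$; let $\mu\colon T^*E\to J^{1*}E=T^*E/\Lambda^1_0T^*E$ be the quotient by the $\pi$-semibasic covectors, and $FL=\mu\circ\widetilde{FL}$. The Lagrangian is assumed *almost regular*: $\tilde{\mathcal P}=\widetilde{FL}(J^1E)$ is a regular submanifold of $T^*E$, $\widetilde{FL}$ is a submersion onto $\tilde{\mathcal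 P}$ with connected fibres, and the fibres of $FL$ are connected submanifolds of $J^1E$. Put $\mathcal P=FL(J^1E)$. Then $\mu$ restricts to a bijection $\mu_0\colon\tilde{\mathcal P}\to\mathcal P$, and $\mathcal P$ is given the manifold structure for which $\mu_0$ is a diffeomorphism. Let $h_0=\mu_0^{-1}$, let $\Omega_{h_0}$ be the pullback by $h_0$ of the canonical symplectic form of $T^*E$, let $\eta^0$ be the pullback of $\varpi$ to $\mathcal P$, and let $FL_0\colon J^1E\to\mathcal P$ be the map induced by $FL$. For a manifold $F$ with a 1-form $\eta$ and a 2-form $\Omega$, the constraint algorithm is $C_0=F$, $C_{i}=\{x\in C_{i-1}\mid\exists X\in T_xC_{i-1}:\ i(X)\Omega_x=0,\ i(X)\eta_x=1\}$. Let $M_i$ be the sets obtained from $(J^1E,\Omega_{\mathcal L},\eta)$ and $P_i$ those obtained from $(\mathcal P,\Omega_{h_0},\eta^0)$. Given a vector field $Y$ on $F$ with $i(Y)\eta=1$ (a connection), put $\gamma=i(Y)\Omega$, $\omega=\Omega-\eta\wedge\gamma$ and $T_x^\perp C=\{Z\in T_xF\mid (i(Z)\omega-(i(Z)\eta)\eta)|_{T_xC}=0\}$.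 The *$i$-th generation constraints* are the functions $i(Z)(\eta-\gamma)\in C^\infty(F)$, where $Z$ is a vector field on $F$ with values in $T^\perp C_{i-1}$ along $C_{i-1}$. **Theorem.** Let $i\ge1$ and suppose that $M_j$ and $P_j$ are regular submanifolds of $J^1E$ and $\mathcal P$ for all $j\le i$. Let $FL_{i-1}\colon M_{i-1}\to P_{i-1}$ be the map induced by $FL$. Then: 1. $FL_{i-1}^{-1}(P_i)=M_i$ and $FL_{i-1}(M_i)=P_i$. 2. The induced map $FL_i\colon M_i\to P_i$ is a submersion. 3. For every $y\in M_i$, $FL_i^{-1}(FL_i(y))=FL_0^{-1}(FL_0(y))$ and $\ker (FL_{i*})_y=\ker (FL_{0*})_y=\{X\in T_yJ^1E\mid \pi^1_*X=0,\ i(X)\Omega_{\mathcal L}=0\}$. 4. (a) Let $Y$ on $J^1E$ and $\tilde Y$ on $\mathcal P$ be $FL_0$-related connections, and let $T^\perp M_{i-1}$ have constant rank. Then every $p\in P_i$ has an open neighbourhood $U$ in $\mathcal P$ and functions $\xi_1,\dots,\xi_r\in C^\infty(\mathcal P)$ such that $\{\xi_j\}$ is, on $U$, a basis of the $i$-th generation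 Hamiltonian constraints, and $\{\zeta_j=FL_0^*\xi_j\}\subset C^\infty(J^1E)$ is, on $FL_0^{-1}(U)$, a basis of the $i$-th generation Lagrangian constraints. Here "basis" (on $U$ and at $p$; on $FL_0^{-1}(U)$ and at each point of $FL_0^{-1}(p)$) means: the functions are $i$-th generation constraints; on $P_{i-1}\cap U$ (resp. $M_{i-1}\cap FL_0^{-1}(U)$) every $i$-th generation constraint is a combination of them with smooth coefficients; near the point none of them is such a combination of the others; and $P_i\cap U$ (resp. $M_i\cap FL_0^{-1}(U)$) is their set of common zeros there. (b) Likewise every $p\in P_i$ has an open neighbourhood $U$ and functions $\xi_1,\dots,\xi_r\in C^\infty(\mathcal P)$ such that $\{\xi_j\}$ are independent functions defining $P_i\cap U$ in $P_{i-1}\cap U$ (it is their set of common zeros, and at its points their differentials are linearly independent on the tangent space of $P_{i-1}$), and $\{\zeta_j=FL_0^*\xi_j\}$ are independent functions defining $M_i\cap FL_0^{-1}(U)$ in $M_{i-1}\cap FL_0^{-1}(U)$. 5. At each $y\in M_i$ the codimension of $M_i$ in $J^1E$ equals the codimension of $P_i$ in $\mathcal P$ at $FL_0(y)$. -/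

import Mathlib

open Set Function Filter Topology Bundle
open scoped Manifold ContDiff

noncomputable section
namespace NonAutMech

/-! ### Calculus on subsets of a manifold -/

section Submanifolds

variable {V H N : Type*} [NormedAddCommGroup V] [NormedSpace ℝ V] [TopologicalSpace H]
  (I : ModelWithCorners ℝ V H) [TopologicalSpace N] [ChartedSpace H N]

/-- `S` is a regular (embedded) submanifold of `N`: locally it is the zero set of a submersion
to some `ℝᶜ`. -/
def IsRegularSubmanifold (S : Set N) : Prop :=
  ∀ x ∈ S, ∃ (c : ℕ) (U : Set N) (g : N → (Fin c → ℝ)), IsOpen U ∧ x ∈ U ∧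
    ContMDiffOn I 𝓘(ℝ, Fin c → ℝ) ∞ g U ∧
    (∀ z ∈ U, Surjective (mfderiv I 𝓘(ℝ, Fin c → ℝ) g z)) ∧
    S ∩ U = {z ∈ U | g z = 0}

/-- The differential of a real function, as a covector. -/
def dAt (f : N → ℝ) (x : N) : TangentSpace I x →L[ℝ] ℝ := mfderiv I 𝓘(ℝ, ℝ) f x

/-- The tangent space `T_x S ⊆ T_x N` of a subset `S`: the vectors annihilated by the differentials
at `x` of all functions, smooth at `x`, that vanish on `S` near `x`. For a regular submanifold this
is its tangent space. -/
def tangentTo (S : Set N) (x : N) : Submodule ℝ (TangentSpace I x) where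
  carrier := {X | ∀ f : N → ℝ, ContMDiffAt I 𝓘(ℝ, ℝ) ∞ f x → (∀ᶠ z in 𝓝[S] x, f z = 0) →
    dAt I f x X = 0}
  zero_mem' := fun f _ _ => map_zero _
  add_mem' := fun hX hY f hf h0 => by rw [map_add, hX f hf h0, hY f hf h0, add_zero]
  smul_mem' := fun c X hX f hf h0 => by rw [map_smul, hX f hf h0, smul_zero]

/-- The codimension at `x` of `C ⊆ F`, for submanifolds `C ⊆ F` of `N`. -/
def codimAt (F C : Set N) (x : N) : ℕ :=
  Module.finrank ℝ (tangentTo I F x) - Module.finrank ℝ (tangentTo I C x)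

/-- `f` restricts to a smooth submersion from the submanifold `S` to the submanifold `T`. -/
def IsSubmersionBetween {V' H' N' : Type*} [NormedAddCommGroup V'] [NormedSpace ℝ V']
    [TopologicalSpace H'] (I' : ModelWithCorners ℝ V' H')
    [TopologicalSpace N'] [ChartedSpace H' N'] (f : N → N') (S : Set N) (T : Set N') : Prop :=
  MapsTo f S T ∧ (∀ x ∈ S, ContMDiffAt I I' ∞ f x) ∧
    ∀ x ∈ S, (tangentTo I S x).map (mfderiv I I' f x).toLinearMap = tangentTo I' T (f x)

/-- The exterior derivative of a 1-form on a manifold without boundary, computed in the preferred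
chart `φ` at `x` (in which `T_x N` is the model space):
`dθ (X, Y) = D_X (φ_* θ) (Y) - D_Y (φ_* θ) (X)`. -/
def extDer (θ : ∀ x : N, TangentSpace I x →L[ℝ] ℝ) (x : N) :
    TangentSpace I x →L[ℝ] TangentSpace I x →L[ℝ] ℝ :=
  let θ' : V → (V →L[ℝ] ℝ) := fun v =>
    (θ ((extChartAt I x).symm v)).comp (mfderiv 𝓘(ℝ, V) I (extChartAt I x).symm v)
  let D : V →L[ℝ] V →L[ℝ] ℝ := fderiv ℝ θ' (extChartAt I x x)
  D - D.flip

/-! ### The constraint algorithm on a submanifold `F` of `N`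

`η` and `Ω` are forms on `N`, of which only the restrictions to `F` are used. -/

variable (F : Set N) (η : ∀ x : N, TangentSpace I x →L[ℝ] ℝ)
  (Ω : ∀ x : N, TangentSpace I x →L[ℝ] TangentSpace I x →L[ℝ] ℝ)

/-- The constraint algorithm: `C₀ = F` and `C_{i+1}` is the set of points `x` of `C_i` at which some
`X` tangent to `C_i` satisfies `i(X) Ω_x = 0` (as a covector on `T_x F`) and `i(X) η_x = 1`. -/
def constraintSet : ℕ → Set N
  | 0 => F
  | i + 1 => {x | x ∈ constraintSet i ∧ ∃ X ∈ tangentTo I (constraintSet i) x,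
      (∀ Y ∈ tangentTo I F x, Ω x X Y = 0) ∧ η x X = 1}

variable (Y : ∀ x : N, TangentSpace I x)

/-- The orthogonal space `T_x^⊥ C` of all `Z ∈ T_x F` such that `i(Z) ω - (i(Z) η) η` vanishes on
`T_x C`, where `γ = i(Y) Ω` and `ω = Ω - η ∧ γ`. -/
def orthTo (C : Set N) (x : N) : Submodule ℝ (TangentSpace I x) where
  carrier := {Z | Z ∈ tangentTo I F x ∧ ∀ X ∈ tangentTo I C x,
    (Ω x Z X - (η x Z * Ω x (Y x) X - η x X * Ω x (Y x) Z)) - η x Z * η x X = 0}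
  zero_mem' := ⟨zero_mem _, fun X _ => by simp⟩
  add_mem' := fun {Z W} hZ hW => ⟨add_mem hZ.1 hW.1, fun X hX => by
    have h1 := hZ.2 X hX
    have h2 := hW.2 X hX
    simp only [map_add, add_apply]
    linear_combination h1 + h2⟩
  smul_mem' := fun c Z hZ => ⟨Submodule.smul_mem _ c hZ.1, fun X hX => by
    have h1 := hZ.2 X hX
    simp only [map_smul, smul_apply, smul_eq_mul]
    linear_combination c * h1⟩

/-- `χ₁, …, χ_r` are smooth functions on `F` which are, on the open set `W`, independent functions
defining `C'` in `C`: in `C ∩ W` the set `C'` is their zero set, and at each of its points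
their differentials are linearly independent on the tangent space of `C`.
(Differentials are those of extensions `g_j` to `W`.) -/
def IsIndependentBasis (C C' : Set N) (W : Set N) {r : ℕ} (χ : Fin r → N → ℝ) : Prop :=
  (∀ j, ContMDiffOn I 𝓘(ℝ, ℝ) ∞ (χ j) F) ∧
  C' ∩ W = {z ∈ C ∩ W | ∀ j, χ j z = 0} ∧
  ∃ g : Fin r → N → ℝ, (∀ j, ContMDiffOn I 𝓘(ℝ, ℝ) ∞ (g j) W) ∧
    (∀ j, EqOn (g j) (χ j) (F ∩ W)) ∧
    ∀ z ∈ C' ∩ W, LinearIndependent ℝ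
      (fun j => (dAt I (g j) z).toLinearMap.comp (tangentTo I C z).subtype)

variable [IsManifold I ∞ N]

/-- `Z` is a smooth vector field on the submanifold `F`. -/
def IsVectorFieldOn (Z : ∀ x : N, TangentSpace I x) : Prop :=
  ContMDiffOn I I.tangent ∞ (fun x => (⟨x, Z x⟩ : TangentBundle I N)) F ∧
    ∀ x ∈ F, Z x ∈ tangentTo I F x

/-- A connection, given by a smooth vector field `Y` on `F` with `i(Y) η = 1`. -/
def IsConnectionField (Y : ∀ x : N, TangentSpace I x) : Prop :=
  IsVectorFieldOn I F Y ∧ ∀ x ∈ F, η x (Y x) = 1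

/-- `χ` is one of the constraint functions `i(Z) (η - γ)` on `F`, where `Z` is a vector field on `F`
with values in `T^⊥ C` along `C`, and `γ = i(Y) Ω`. For `C = C_i` these are the constraints of
generation `i + 1`. -/
def IsConstraint (C : Set N) (χ : N → ℝ) : Prop :=
  ∃ Z : ∀ x : N, TangentSpace I x, IsVectorFieldOn I F Z ∧ (∀ x ∈ C, Z x ∈ orthTo I F η Ω Y C x) ∧
    ∀ x ∈ F, χ x = η x (Z x) - Ω x (Y x) (Z x)

/-- `χ₁, …, χ_r` is a basis, near `x` and on the open set `W`, of the set of constraints attached to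
the pair `C' = C_{i+1} ⊆ C = C_i`: the `χ_j` are constraints, they generate all constraints
(with smooth coefficients, as functions on `C ∩ W`), none of them is near `x` a combination of the
other ones, and `C'` is their zero set in `C`. -/
def IsConstraintBasis (C C' : Set N) (x : N) (W : Set N) {r : ℕ} (χ : Fin r → N → ℝ) : Prop :=
  (∀ j, IsConstraint I F η Ω Y C (χ j)) ∧
  (∀ ψ : N → ℝ, IsConstraint I F η Ω Y C ψ → ∃ a : Fin r → N → ℝ,
    (∀ j, ContMDiffOn I 𝓘(ℝ, ℝ) ∞ (a j) (C ∩ W)) ∧ ∀ z ∈ C ∩ W, ψ z = ∑ j, a j z * χ j z) ∧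
  (∀ j, ¬ ∃ (W' : Set N) (a : Fin r → N → ℝ), IsOpen W' ∧ x ∈ W' ∧
    (∀ k, ContMDiffOn I 𝓘(ℝ, ℝ) ∞ (a k) (C ∩ W')) ∧
    ∀ z ∈ C ∩ W', χ j z = ∑ k ∈ Finset.univ.erase j, a k z * χ k z) ∧
  C' ∩ W = {z ∈ C ∩ W | ∀ j, χ j z = 0}

end Submanifolds


/-- A fibered manifold `π : E → B` over a 1-dimensional manifold `B`, with `dim E = n + 1`
(a smooth surjective submersion), together with a volume form `ϖ` on `B`. -/
structure FiberedManifold (n : ℕ) (E B : Type*)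
    [TopologicalSpace E] [ChartedSpace (EuclideanSpace ℝ (Fin (n + 1))) E]
    [IsManifold (𝓡 (n + 1)) ∞ E]
    [TopologicalSpace B] [ChartedSpace ℝ B] [IsManifold 𝓘(ℝ, ℝ) ∞ B] where
  /-- the projection `π` -/
  proj : E → B
  contMDiff_proj : ContMDiff (𝓡 (n + 1)) 𝓘(ℝ, ℝ) ∞ proj
  surjective_proj : Surjective proj
  surjective_mfderiv_proj : ∀ e, Surjective (mfderiv (𝓡 (n + 1)) 𝓘(ℝ, ℝ) proj e)
  /-- the volume form `ϖ` -/
  vol : ∀ b : B, TangentSpace 𝓘(ℝ, ℝ) b →L[ℝ] ℝ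
  contMDiff_vol : ContMDiff 𝓘(ℝ, ℝ) (𝓘(ℝ, ℝ).prod 𝓘(ℝ, ℝ →L[ℝ] ℝ)) ∞
    (fun b => TotalSpace.mk' (ℝ →L[ℝ] ℝ) (E := fun b : B => TangentSpace 𝓘(ℝ, ℝ) b →L[ℝ] ℝ) b (vol b))
  vol_ne_zero : ∀ b, vol b ≠ 0

namespace FiberedManifold
variable {n : ℕ} {E B : Type*}
    [TopologicalSpace E] [ChartedSpace (EuclideanSpace ℝ (Fin (n + 1))) E]
    [IsManifold (𝓡 (n + 1)) ∞ E]
    [TopologicalSpace B] [ChartedSpace ℝ B] [IsManifold 𝓘(ℝ, ℝ) ∞ B]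
    (Φ : FiberedManifold n E B)

/-- The form `π^* ϖ` on `E`. -/
def baseForm (e : E) : TangentSpace (𝓡 (n + 1)) e →L[ℝ] ℝ :=
  (Φ.vol (Φ.proj e)).comp (mfderiv (𝓡 (n + 1)) 𝓘(ℝ, ℝ) Φ.proj e)

lemma baseForm_ne_zero (e : E) : Φ.baseForm e ≠ 0 := by
  intro h
  apply Φ.vol_ne_zero (Φ.proj e)
  ext
  obtain ⟨v, hv⟩ := Φ.surjective_mfderiv_proj e (1 : ℝ)
  have := congrArg (fun f => f v) h
  simp only [baseForm] at this
  have h2 : Φ.vol (Φ.proj e) (mfderiv (𝓡 (n + 1)) 𝓘(ℝ, ℝ) Φ.proj e v) = 0 := this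
  rw [hv] at h2
  exact h2

lemma contMDiff_baseForm :
    ContMDiff (𝓡 (n + 1)).tangent 𝓘(ℝ, ℝ) ∞
      (fun v : TangentBundle (𝓡 (n + 1)) E => Φ.baseForm v.proj v.2) := by
  have h1 : ContMDiff 𝓘(ℝ, ℝ).tangent 𝓘(ℝ, ℝ) ∞
      (fun v : TangentBundle 𝓘(ℝ, ℝ) B => Φ.vol v.proj v.2) := by
    have hs : ContMDiff 𝓘(ℝ, ℝ).tangent (𝓘(ℝ, ℝ).prod 𝓘(ℝ, ℝ →L[ℝ] ℝ)) ∞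
      (fun v : TangentBundle 𝓘(ℝ, ℝ) B => TotalSpace.mk' (ℝ →L[ℝ] ℝ)
        (E := fun b : B => TangentSpace 𝓘(ℝ, ℝ) b →L[ℝ] (Bundle.Trivial B ℝ b)) v.proj (Φ.vol v.proj)) :=
      Φ.contMDiff_vol.comp (Bundle.contMDiff_proj _)
    have hv : ContMDiff 𝓘(ℝ, ℝ).tangent (𝓘(ℝ, ℝ).prod 𝓘(ℝ, ℝ)) ∞
      (fun v : TangentBundle 𝓘(ℝ, ℝ) B => TotalSpace.mk' ℝ
        (E := fun b : B => TangentSpace 𝓘(ℝ, ℝ) b) v.proj v.2) := contMDiff_id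
    have := ContMDiff.clm_bundle_apply (F₁ := ℝ) (F₂ := ℝ)
      (E₁ := fun b : B => TangentSpace 𝓘(ℝ, ℝ) b) (E₂ := fun b : B => Bundle.Trivial B ℝ b)
      (ϕ := fun v : TangentBundle 𝓘(ℝ, ℝ) B => Φ.vol v.proj) hs hv
    intro x
    exact ((contMDiffAt_totalSpace.1 (this x)).2)
  have h2 := Φ.contMDiff_proj.contMDiff_tangentMap (m := ∞) (by simp)
  exact h1.comp h2

/-- The jet bundle `J¹E`: the jet at `t` of a local section `φ` of `π` is identified with the vector
`φ_* (V_ϖ(t))`, where `ϖ(V_ϖ) = 1`, so that `J¹E` is the subset of `TE` of all tangent vectors `v`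
with `(π^* ϖ)(v) = 1`. -/
@[ext]
structure J1 where
  /-- the embedding `ι : J¹E → TE` -/
  toTangent : TangentBundle (𝓡 (n + 1)) E
  baseForm_eq_one : Φ.baseForm toTangent.proj toTangent.2 = 1

instance : TopologicalSpace Φ.J1 := TopologicalSpace.induced J1.toTangent inferInstance

lemma continuous_toTangent : Continuous (J1.toTangent : Φ.J1 → TangentBundle (𝓡 (n + 1)) E) :=
  continuous_induced_dom

/-! #### The manifold structure of `J¹E`

The chart around `e₀` is `(e, v) ↦ (x(e), u)` with `x` a chart of `E` at `e₀` and `u` the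
component of `v` (trivialized over that chart) in the kernel of the form `(π^* ϖ)_{e₀}`. -/

lemma exists_splitting (ℓ : EuclideanSpace ℝ (Fin (n + 1)) →L[ℝ] ℝ) (h : ℓ ≠ 0) :
    ∃ A : EuclideanSpace ℝ (Fin (n + 1)) ≃L[ℝ] ℝ × EuclideanSpace ℝ (Fin n),
      ∀ w, (A w).1 = ℓ w := by
  obtain ⟨b, hb⟩ : ∃ b, ℓ b = 1 := by
    obtain ⟨w, hw⟩ : ∃ w, ℓ w ≠ 0 := by
      by_contra! hc
      exact h (by ext w; simpa using hc w)
    exact ⟨(ℓ w)⁻¹ • w, by simp [hw]⟩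
  have hs : Surjective (ℓ : EuclideanSpace ℝ (Fin (n + 1)) →ₗ[ℝ] ℝ) := fun r => ⟨r • b, by simp [hb]⟩
  have hk : Module.finrank ℝ (LinearMap.ker (ℓ : EuclideanSpace ℝ (Fin (n + 1)) →ₗ[ℝ] ℝ)) = n := by
    have := LinearMap.finrank_range_add_finrank_ker (ℓ : EuclideanSpace ℝ (Fin (n + 1)) →ₗ[ℝ] ℝ)
    rw [LinearMap.range_eq_top.2 hs, finrank_top] at this
    simp at this
    omega
  let κ : LinearMap.ker (ℓ : EuclideanSpace ℝ (Fin (n + 1)) →ₗ[ℝ] ℝ) ≃ₗ[ℝ]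
      EuclideanSpace ℝ (Fin n) := LinearEquiv.ofFinrankEq _ _ (by rw [hk]; simp)
  let A : EuclideanSpace ℝ (Fin (n + 1)) ≃ₗ[ℝ] ℝ × EuclideanSpace ℝ (Fin n) :=
    { toFun := fun w => (ℓ w, κ ⟨w - ℓ w • b, by simp [hb]⟩)
      map_add' := fun w w' => by
        ext1
        · simp
        · simp only [Prod.snd_add]
          rw [← map_add]
          congr 1
          ext1
          simp only [map_add, Submodule.coe_add]
          module
      map_smul' := fun r w => by
        ext1
        · simp
        · simp only [Prod.smul_snd, RingHom.id_apply]
          refine Eq.trans ?_ (map_smul κ r _)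
          congr 1
          ext1
          simp only [map_smul, Submodule.coe_smul, smul_eq_mul]
          module
      invFun := fun p => (κ.symm p.2 : EuclideanSpace ℝ (Fin (n + 1))) + p.1 • b
      left_inv := fun w => by simp
      right_inv := fun p => by
        have h0 : ℓ (κ.symm p.2 : EuclideanSpace ℝ (Fin (n + 1))) = 0 := (κ.symm p.2).2
        ext1
        · simp [hb, h0]
        · simp [hb, h0] }
  exact ⟨A.toContinuousLinearEquiv, fun w => rfl⟩

/-- The trivialization of `TE` around `e₀`. -/
abbrev triv (_ : FiberedManifold n E B) (e₀ : E) :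
    Trivialization (EuclideanSpace ℝ (Fin (n + 1)))
      (π (EuclideanSpace ℝ (Fin (n + 1))) (TangentSpace (𝓡 (n + 1)) : E → Type _)) :=
  trivializationAt (EuclideanSpace ℝ (Fin (n + 1))) (TangentSpace (𝓡 (n + 1)) : E → Type _) e₀

lemma mem_base (e₀ : E) : e₀ ∈ (Φ.triv e₀).baseSet :=
  FiberBundle.mem_baseSet_trivializationAt' e₀

/-- The form `π^* ϖ` in the trivialization of `TE` around `e₀`. -/
def localForm (e₀ e : E) : EuclideanSpace ℝ (Fin (n + 1)) →L[ℝ] ℝ :=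
  (Φ.baseForm e).comp ((Φ.triv e₀).symmL ℝ e)

lemma localForm_ne_zero (e₀ : E) : Φ.localForm e₀ e₀ ≠ 0 := by
  intro h
  apply Φ.baseForm_ne_zero e₀
  ext w
  have := congrArg (fun f => f ((Φ.triv e₀).continuousLinearMapAt ℝ e₀ w)) h
  simp only [localForm, ContinuousLinearMap.comp_apply,
    (Φ.triv e₀).symmL_continuousLinearMapAt (Φ.mem_base e₀)] at this
  exact this

/-- A linear splitting of the model space along the form at `e₀`. -/
def splitting (e₀ : E) : EuclideanSpace ℝ (Fin (n + 1)) ≃L[ℝ] ℝ × EuclideanSpace ℝ (Fin n) :=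
  (exists_splitting _ (Φ.localForm_ne_zero e₀)).choose

lemma splitting_fst (e₀ : E) (w) : (Φ.splitting e₀ w).1 = Φ.localForm e₀ e₀ w :=
  (exists_splitting _ (Φ.localForm_ne_zero e₀)).choose_spec w

lemma nonempty_fiber (e : E) :
    Nonempty {w : TangentSpace (𝓡 (n + 1)) e // Φ.baseForm e w = 1} := by
  obtain ⟨w, hw⟩ : ∃ w, Φ.baseForm e w ≠ 0 := by
    by_contra! hc
    exact Φ.baseForm_ne_zero e (by ext w; simpa using hc w)
  exact ⟨⟨(Φ.baseForm e w)⁻¹ • w, by simp [hw]⟩⟩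

/-- Points of `E` over which the chart around `e₀` is defined -/
def chartBase (e₀ : E) : Set E :=
  {e | e ∈ (chartAt (EuclideanSpace ℝ (Fin (n + 1))) e₀).source ∧
    Φ.localForm e₀ e ((Φ.splitting e₀).symm (1, 0)) ≠ 0}

/-- The smooth map whose corestriction to `J¹E` is the inverse chart -/
def chartInv (e₀ : E) (p : EuclideanSpace ℝ (Fin (n + 1)) × EuclideanSpace ℝ (Fin n)) :
    TangentBundle (𝓡 (n + 1)) E :=
  let e := (chartAt (EuclideanSpace ℝ (Fin (n + 1))) e₀).symm p.1
  let A := Φ.splitting e₀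
  ⟨e, (Φ.triv e₀).symmL ℝ e (A.symm ((1 - Φ.localForm e₀ e (A.symm (0, p.2))) /
    Φ.localForm e₀ e (A.symm (1, 0)), p.2))⟩


lemma localForm_chartInv (e₀ : E) {p} (hp : (chartAt (EuclideanSpace ℝ (Fin (n + 1))) e₀).symm p.1 ∈ Φ.chartBase e₀) :
    Φ.baseForm (Φ.chartInv e₀ p).proj (Φ.chartInv e₀ p).2 = 1 := by
  set e := (chartAt (EuclideanSpace ℝ (Fin (n + 1))) e₀).symm p.1 with he
  set A := Φ.splitting e₀ with hA
  have hb : Φ.localForm e₀ e (A.symm (1, 0)) ≠ 0 := hp.2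
  have key : ∀ c : ℝ, A.symm (c, p.2) = A.symm (0, p.2) + c • A.symm (1, 0) := by
    intro c
    rw [← map_smul, ← map_add]
    simp
  change Φ.localForm e₀ e (A.symm (_, p.2)) = 1
  rw [key, map_add, map_smul, smul_eq_mul, div_mul_cancel₀ _ hb]
  ring

lemma contMDiff_local (e₀ : E) :
    ContMDiffOn ((𝓡 (n + 1)).prod 𝓘(ℝ, EuclideanSpace ℝ (Fin (n + 1)))) (𝓡 (n + 1)).tangent ∞
      (fun q : E × EuclideanSpace ℝ (Fin (n + 1)) =>
        (⟨q.1, (Φ.triv e₀).symmL ℝ q.1 q.2⟩ : TangentBundle (𝓡 (n + 1)) E))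
      ((Φ.triv e₀).baseSet ×ˢ univ) := by
  have := (Φ.triv e₀).contMDiffOn_symm (n := ∞) (IB := 𝓡 (n + 1))
  rw [(Φ.triv e₀).target_eq] at this
  refine this.congr ?_
  rintro ⟨e, w⟩ ⟨he, -⟩
  exact (congrArg (TotalSpace.mk e) ((Φ.triv e₀).symmL_apply (R := ℝ) he w)).trans
    ((Φ.triv e₀).mk_symm he w)

lemma contMDiff_localForm (e₀ : E) :
    ContMDiffOn ((𝓡 (n + 1)).prod 𝓘(ℝ, EuclideanSpace ℝ (Fin (n + 1)))) 𝓘(ℝ, ℝ) ∞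
      (fun q : E × EuclideanSpace ℝ (Fin (n + 1)) => Φ.localForm e₀ q.1 q.2)
      ((Φ.triv e₀).baseSet ×ˢ univ) :=
  Φ.contMDiff_baseForm.comp_contMDiffOn (Φ.contMDiff_local e₀)

lemma isOpen_chartBase (e₀ : E) : IsOpen (Φ.chartBase e₀) := by
  have h : ContinuousOn (fun e : E => Φ.localForm e₀ e ((Φ.splitting e₀).symm (1, 0)))
      (chartAt (EuclideanSpace ℝ (Fin (n + 1))) e₀).source :=
    (Φ.contMDiff_localForm e₀).continuousOn.comp (f := fun e : E => (e, (Φ.splitting e₀).symm (1, 0)))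
      (by fun_prop) (fun e he => ⟨he, mem_univ _⟩)
  exact h.isOpen_inter_preimage (chartAt _ e₀).open_source isOpen_ne

lemma mem_chartBase (e₀ : E) : e₀ ∈ Φ.chartBase e₀ :=
  ⟨mem_chart_source _ e₀, by rw [← Φ.splitting_fst]; simp⟩

/-- Domain of the inverse chart -/
def chartTarget (e₀ : E) : Set (EuclideanSpace ℝ (Fin (n + 1)) × EuclideanSpace ℝ (Fin n)) :=
  ((chartAt (EuclideanSpace ℝ (Fin (n + 1))) e₀).target ∩
    (chartAt (EuclideanSpace ℝ (Fin (n + 1))) e₀).symm ⁻¹' Φ.chartBase e₀) ×ˢ univ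

lemma isOpen_chartTarget (e₀ : E) : IsOpen (Φ.chartTarget e₀) :=
  ((chartAt (EuclideanSpace ℝ (Fin (n + 1))) e₀).isOpen_inter_preimage_symm
    (Φ.isOpen_chartBase e₀)).prod isOpen_univ

lemma contMDiffOn_chartInv (e₀ : E) :
    ContMDiffOn 𝓘(ℝ, EuclideanSpace ℝ (Fin (n + 1)) × EuclideanSpace ℝ (Fin n))
      (𝓡 (n + 1)).tangent ∞ (Φ.chartInv e₀) (Φ.chartTarget e₀) := by
  have hbase : ContMDiffOn 𝓘(ℝ, EuclideanSpace ℝ (Fin (n + 1)) × EuclideanSpace ℝ (Fin n))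
      (𝓡 (n + 1)) ∞ (fun p : EuclideanSpace ℝ (Fin (n + 1)) × EuclideanSpace ℝ (Fin n) =>
        (chartAt (EuclideanSpace ℝ (Fin (n + 1))) e₀).symm p.1) (Φ.chartTarget e₀) := by
    refine (contMDiffOn_chart_symm (I := 𝓡 (n + 1)) (n := ∞) (x := e₀)).comp
      (contDiff_fst.contMDiff.contMDiffOn) ?_
    rintro p ⟨hp, -⟩
    exact hp.1
  have hf : ∀ g : EuclideanSpace ℝ (Fin (n + 1)) × EuclideanSpace ℝ (Fin n) →
      EuclideanSpace ℝ (Fin (n + 1)), ContDiff ℝ ∞ g →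
      ContMDiffOn 𝓘(ℝ, EuclideanSpace ℝ (Fin (n + 1)) × EuclideanSpace ℝ (Fin n)) 𝓘(ℝ, ℝ) ∞
      (fun p => Φ.localForm e₀ ((chartAt (EuclideanSpace ℝ (Fin (n + 1))) e₀).symm p.1) (g p))
      (Φ.chartTarget e₀) := by
    intro g hg
    refine (Φ.contMDiff_localForm e₀).comp (hbase.prodMk hg.contMDiff.contMDiffOn) ?_
    rintro p ⟨hp, -⟩
    exact ⟨hp.2.1, mem_univ _⟩
  have h1 := hf (fun p => (Φ.splitting e₀).symm (0, p.2)) (by fun_prop)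
  have h2 := hf (fun _ => (Φ.splitting e₀).symm (1, 0)) (by fun_prop)
  rw [contMDiffOn_iff_contDiffOn] at h1 h2
  have h3 : ContDiffOn ℝ ∞ (fun p : EuclideanSpace ℝ (Fin (n + 1)) × EuclideanSpace ℝ (Fin n) =>
      (Φ.splitting e₀).symm ((1 - Φ.localForm e₀ ((chartAt (EuclideanSpace ℝ (Fin (n + 1))) e₀).symm p.1)
        ((Φ.splitting e₀).symm (0, p.2))) /
      Φ.localForm e₀ ((chartAt (EuclideanSpace ℝ (Fin (n + 1))) e₀).symm p.1)
        ((Φ.splitting e₀).symm (1, 0)), p.2)) (Φ.chartTarget e₀) := by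
    refine (Φ.splitting e₀).symm.contDiff.comp_contDiffOn ?_
    refine ContDiffOn.prodMk ?_ contDiff_snd.contDiffOn
    exact (contDiffOn_const.sub h1).div h2 (fun p hp => hp.1.2.2)
  refine (Φ.contMDiff_local e₀).comp (hbase.prodMk h3.contMDiffOn) ?_
  rintro p ⟨hp, -⟩
  exact ⟨hp.2.1, mem_univ _⟩

/-- The chart map, defined on all of `TE` -/
def chartFun (e₀ : E) (v : TangentBundle (𝓡 (n + 1)) E) :
    EuclideanSpace ℝ (Fin (n + 1)) × EuclideanSpace ℝ (Fin n) :=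
  (chartAt (EuclideanSpace ℝ (Fin (n + 1))) e₀ v.proj, (Φ.splitting e₀ (Φ.triv e₀ v).2).2)

lemma contMDiffOn_chartFun (e₀ : E) :
    ContMDiffOn (𝓡 (n + 1)).tangent
      𝓘(ℝ, EuclideanSpace ℝ (Fin (n + 1)) × EuclideanSpace ℝ (Fin n)) ∞ (Φ.chartFun e₀)
      (TotalSpace.proj ⁻¹' (chartAt (EuclideanSpace ℝ (Fin (n + 1))) e₀).source) := by
  have h1 : ContMDiffOn (𝓡 (n + 1)).tangent 𝓘(ℝ, EuclideanSpace ℝ (Fin (n + 1))) ∞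
      (fun v : TangentBundle (𝓡 (n + 1)) E =>
        chartAt (EuclideanSpace ℝ (Fin (n + 1))) e₀ v.proj)
      (TotalSpace.proj ⁻¹' (chartAt (EuclideanSpace ℝ (Fin (n + 1))) e₀).source) :=
    (contMDiffOn_chart (I := 𝓡 (n + 1)) (n := ∞) (x := e₀)).comp
      (Bundle.contMDiff_proj _).contMDiffOn (fun v hv => hv)
  have h2 := (Φ.triv e₀).contMDiffOn (n := ∞) (IB := 𝓡 (n + 1))
  rw [(Φ.triv e₀).source_eq] at h2
  have h3 : ContMDiffOn (𝓡 (n + 1)).tangent 𝓘(ℝ, EuclideanSpace ℝ (Fin n)) ∞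
      (fun v : TangentBundle (𝓡 (n + 1)) E => (Φ.splitting e₀ (Φ.triv e₀ v).2).2)
      (TotalSpace.proj ⁻¹' (chartAt (EuclideanSpace ℝ (Fin (n + 1))) e₀).source) := by
    have hc : ContDiff ℝ ∞ (fun w => (Φ.splitting e₀ w).2) :=
      contDiff_snd.comp (Φ.splitting e₀).contDiff
    exact hc.contMDiff.comp_contMDiffOn (contMDiff_snd.comp_contMDiffOn h2)
  exact h1.prodMk_space h3

lemma chartInv_chartFun (e₀ : E) {v : TangentBundle (𝓡 (n + 1)) E} (hv : v.proj ∈ Φ.chartBase e₀)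
    (h1 : Φ.baseForm v.proj v.2 = 1) : Φ.chartInv e₀ (Φ.chartFun e₀ v) = v := by
  obtain ⟨e, w⟩ := v
  have he : (chartAt (EuclideanSpace ℝ (Fin (n + 1))) e₀).symm
      (chartAt (EuclideanSpace ℝ (Fin (n + 1))) e₀ e) = e :=
    (chartAt _ e₀).left_inv hv.1
  have heb : e ∈ (Φ.triv e₀).baseSet := hv.1
  set A := Φ.splitting e₀ with hA
  set x := (Φ.triv e₀ ⟨e, w⟩).2 with hx
  have hxw : (Φ.triv e₀).symmL ℝ e x = w := by
    have := (Φ.triv e₀).symmL_continuousLinearMapAt (R := ℝ) heb w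
    rwa [Trivialization.continuousLinearMapAt_apply, (Φ.triv e₀).coe_linearMapAt_of_mem heb] at this
  have hb : Φ.localForm e₀ e (A.symm (1, 0)) ≠ 0 := hv.2
  have hw : Φ.localForm e₀ e x = 1 := by
    simp only [localForm, ContinuousLinearMap.comp_apply, hxw]
    exact h1
  have hsplit : x = A.symm (0, (A x).2) + (A x).1 • A.symm (1, 0) := by
    rw [← map_smul, ← map_add]
    simp
  have hc : (1 - Φ.localForm e₀ e (A.symm (0, (A x).2))) / Φ.localForm e₀ e (A.symm (1, 0))
      = (A x).1 := by
    have h2 := hw.symm.trans (congrArg (Φ.localForm e₀ e) hsplit)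
    rw [map_add, map_smul, smul_eq_mul] at h2
    rw [div_eq_iff hb]
    linarith
  simp only [chartInv, chartFun]
  rw [← hA, ← hx, he, hc]
  simp only [Prod.mk.eta, ContinuousLinearEquiv.symm_apply_apply]
  exact congrArg (TotalSpace.mk e) hxw

lemma chartFun_chartInv (e₀ : E) {p} (hp : p ∈ Φ.chartTarget e₀) :
    Φ.chartFun e₀ (Φ.chartInv e₀ p) = p := by
  have he := (chartAt (EuclideanSpace ℝ (Fin (n + 1))) e₀).right_inv hp.1.1
  have heb : (chartAt (EuclideanSpace ℝ (Fin (n + 1))) e₀).symm p.1 ∈ (Φ.triv e₀).baseSet :=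
    hp.1.2.1
  ext1
  · exact he
  · simp only [chartInv, chartFun]
    set c := (1 - Φ.localForm e₀ ((chartAt (EuclideanSpace ℝ (Fin (n + 1))) e₀).symm p.1)
      ((Φ.splitting e₀).symm (0, p.2))) / _
    have := (Φ.triv e₀).continuousLinearMapAt_symmL (R := ℝ) heb ((Φ.splitting e₀).symm (c, p.2))
    rw [Trivialization.continuousLinearMapAt_apply, (Φ.triv e₀).coe_linearMapAt_of_mem heb] at this
    refine (congrArg (fun w => (Φ.splitting e₀ w).2) this).trans ?_
    simp

open Classical in
/-- The chart of `J¹E` around the fibre over `e₀` -/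
def chart (e₀ : E) : OpenPartialHomeomorph Φ.J1
    (EuclideanSpace ℝ (Fin (n + 1)) × EuclideanSpace ℝ (Fin n)) where
  toFun y := Φ.chartFun e₀ y.toTangent
  invFun p := if h : Φ.baseForm (Φ.chartInv e₀ p).proj (Φ.chartInv e₀ p).2 = 1 then
    ⟨Φ.chartInv e₀ p, h⟩ else ⟨⟨e₀, (Classical.choice (Φ.nonempty_fiber e₀)).1⟩,
      (Classical.choice (Φ.nonempty_fiber e₀)).2⟩
  source := {y | y.toTangent.proj ∈ Φ.chartBase e₀}
  target := Φ.chartTarget e₀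
  map_source' y hy := by
    have := (chartAt (EuclideanSpace ℝ (Fin (n + 1))) e₀).left_inv hy.1
    refine ⟨⟨(chartAt _ e₀).map_source hy.1, ?_⟩, mem_univ _⟩
    simp only [chartFun, mem_preimage, this]
    exact hy
  map_target' p hp := by
    rw [dif_pos (Φ.localForm_chartInv e₀ hp.1.2)]
    exact hp.1.2
  left_inv' y hy := by
    have h := Φ.chartInv_chartFun e₀ hy y.baseForm_eq_one
    rw [dif_pos (by rw [h]; exact y.baseForm_eq_one)]
    exact J1.ext h
  right_inv' p hp := by
    rw [dif_pos (Φ.localForm_chartInv e₀ hp.1.2)]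
    exact Φ.chartFun_chartInv e₀ hp
  open_source := (Φ.isOpen_chartBase e₀).preimage
    ((FiberBundle.continuous_proj _ _).comp Φ.continuous_toTangent)
  open_target := Φ.isOpen_chartTarget e₀
  continuousOn_toFun := (Φ.contMDiffOn_chartFun e₀).continuousOn.comp
    Φ.continuous_toTangent.continuousOn (fun y hy => hy.1)
  continuousOn_invFun := by
    rw [(Topology.IsInducing.mk rfl : Topology.IsInducing (J1.toTangent (Φ := Φ))).continuousOn_iff]
    refine (Φ.contMDiffOn_chartInv e₀).continuousOn.congr (fun p hp => ?_)
    simp only [comp_apply]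
    rw [dif_pos (Φ.localForm_chartInv e₀ hp.1.2)]

instance : ChartedSpace (EuclideanSpace ℝ (Fin (n + 1)) × EuclideanSpace ℝ (Fin n)) Φ.J1 where
  atlas := range Φ.chart
  chartAt y := Φ.chart y.toTangent.proj
  mem_chart_source _ := Φ.mem_chartBase _
  chart_mem_atlas _ := mem_range_self _

instance : IsManifold 𝓘(ℝ, EuclideanSpace ℝ (Fin (n + 1)) × EuclideanSpace ℝ (Fin n)) ∞ Φ.J1 := by
  apply isManifold_of_contDiffOn
  rintro _ _ ⟨e₀, rfl⟩ ⟨e₁, rfl⟩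
  simp only [modelWithCornersSelf_coe, modelWithCornersSelf_coe_symm, comp_id, id_comp, range_id,
    preimage_id, inter_univ]
  rw [← contMDiffOn_iff_contDiffOn]
  have hinv : ∀ p ∈ Φ.chartTarget e₀, ((Φ.chart e₀).symm p).toTangent = Φ.chartInv e₀ p := fun p hp => by
    change (dite _ _ _ : Φ.J1).toTangent = _
    rw [dif_pos (Φ.localForm_chartInv e₀ hp.1.2)]
  have hsub : ((Φ.chart e₀).symm ≫ₕ Φ.chart e₁).source ⊆ Φ.chartTarget e₀ := fun p hp => hp.1
  refine ((Φ.contMDiffOn_chartFun e₁).comp ((Φ.contMDiffOn_chartInv e₀).mono hsub) ?_).congr ?_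
  · intro p hp
    have h2 : ((Φ.chart e₀).symm p).toTangent.proj ∈ Φ.chartBase e₁ := hp.2
    rw [hinv p hp.1] at h2
    exact h2.1
  · intro p hp
    change Φ.chartFun e₁ ((Φ.chart e₀).symm p).toTangent = _
    rw [hinv p hp.1]
    rfl

/-! ### Lagrangian formalism -/

/-- The model space of `J¹E`. -/
abbrev J1Model (n : ℕ) : Type := EuclideanSpace ℝ (Fin (n + 1)) × EuclideanSpace ℝ (Fin n)

variable {Φ}

/-- The projection `π¹ : J¹E → E`. -/
def J1.base (y : Φ.J1) : E := y.toTangent.proj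

/-- The vector `ι(y) ∈ T_{π¹(y)} E` representing the jet `y`. -/
def J1.velocity (y : Φ.J1) : TangentSpace (𝓡 (n + 1)) y.base := y.toTangent.2

/-- The jet `y + (w - η(w) y)` over the same point, for `w` tangent to `E` there. -/
def J1.shift (y : Φ.J1) (w : TangentSpace (𝓡 (n + 1)) y.base) : Φ.J1 where
  toTangent := ⟨y.base, y.velocity + (w - Φ.baseForm y.base w • y.velocity)⟩
  baseForm_eq_one := by
    have h : Φ.baseForm y.base y.velocity = 1 := y.baseForm_eq_one
    simp [h]

/-- The linear map `T_{π¹(y)} E → T_y J¹E` sending `w` to the vertical lift at `y` of the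
`π`-vertical vector `w - η(w) y`, i.e. to the velocity at `s = 0` of `s ↦ y + s (w - η(w) y)`.
In coordinates, `w ↦ (dq^ρ - v^ρ dt)(w) ∂/∂v^ρ`. -/
def vertLift (y : Φ.J1) : TangentSpace (𝓡 (n + 1)) y.base →L[ℝ] TangentSpace 𝓘(ℝ, J1Model n) y :=
  mfderiv 𝓘(ℝ, EuclideanSpace ℝ (Fin (n + 1))) 𝓘(ℝ, J1Model n)
    (fun w : EuclideanSpace ℝ (Fin (n + 1)) => y.shift w) 0

/-- The tangent map of `π¹ : J¹E → E`. -/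
def dBase (y : Φ.J1) : TangentSpace 𝓘(ℝ, J1Model n) y →L[ℝ] TangentSpace (𝓡 (n + 1)) y.base :=
  mfderiv 𝓘(ℝ, J1Model n) (𝓡 (n + 1)) (J1.base (Φ := Φ)) y

/-- The canonical endomorphism `𝒥 = (dq^ρ - v^ρ dt) ⊗ ∂/∂v^ρ` of `J¹E`. -/
def canonEndo (y : Φ.J1) : TangentSpace 𝓘(ℝ, J1Model n) y →L[ℝ] TangentSpace 𝓘(ℝ, J1Model n) y :=
  (vertLift y).comp (dBase y)

variable (Φ) in
/-- The form `η = (π ∘ π¹)^* ϖ` on `J¹E`. -/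
def etaL (y : Φ.J1) : TangentSpace 𝓘(ℝ, J1Model n) y →L[ℝ] ℝ :=
  (Φ.baseForm y.base).comp (dBase y)

/-- The Poincaré–Cartan 1-form `Θ_ℒ = i(𝒱)ℒ + ℒ = dℓ ∘ 𝒥 + ℓ η` of the Lagrangian
density `ℒ = ℓ η`. -/
def thetaL (ℓ : Φ.J1 → ℝ) (y : Φ.J1) : TangentSpace 𝓘(ℝ, J1Model n) y →L[ℝ] ℝ :=
  (dAt 𝓘(ℝ, J1Model n) ℓ y).comp (canonEndo y) + ℓ y • Φ.etaL y

/-- The Poincaré–Cartan 2-form `Ω_ℒ = -dΘ_ℒ`. -/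
def omegaL (ℓ : Φ.J1 → ℝ) (y : Φ.J1) :
    TangentSpace 𝓘(ℝ, J1Model n) y →L[ℝ] TangentSpace 𝓘(ℝ, J1Model n) y →L[ℝ] ℝ :=
  -extDer 𝓘(ℝ, J1Model n) (thetaL ℓ) y

/-! ### The momentum bundles and the Legendre maps -/

variable (Φ)

/-- The extended momentum bundle `T^*E`. -/
abbrev Cotangent (_ : FiberedManifold n E B) : Type _ :=
  TotalSpace (EuclideanSpace ℝ (Fin (n + 1)) →L[ℝ] ℝ)
    (fun e : E => TangentSpace (𝓡 (n + 1)) e →L[ℝ] ℝ)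

/-- The model with corners of `T^*E`. -/
abbrev cotModel (n : ℕ) := (𝓡 (n + 1)).prod 𝓘(ℝ, EuclideanSpace ℝ (Fin (n + 1)) →L[ℝ] ℝ)

instance : IsManifold (cotModel n) ∞ Φ.Cotangent :=
  Bundle.TotalSpace.isManifold (n := ∞) (EuclideanSpace ℝ (Fin (n + 1)) →L[ℝ] ℝ)
    (fun e : E => TangentSpace (𝓡 (n + 1)) e →L[ℝ] Bundle.Trivial E ℝ e)

/-- The tangent map of the projection `σ¹ : T^*E → E`. -/
def dCotProj (p : Φ.Cotangent) :
    TangentSpace (cotModel n) p →L[ℝ] TangentSpace (𝓡 (n + 1)) p.proj :=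
  mfderiv (cotModel n) (𝓡 (n + 1)) (fun q : Φ.Cotangent => q.proj) p

/-- The pullback of `ϖ` to `T^*E`. -/
def etaH (p : Φ.Cotangent) : TangentSpace (cotModel n) p →L[ℝ] ℝ :=
  (Φ.baseForm p.proj).comp (Φ.dCotProj p)

/-- The Liouville 1-form `Θ` of `T^*E`. -/
def liouville (p : Φ.Cotangent) : TangentSpace (cotModel n) p →L[ℝ] ℝ :=
  p.2.comp (Φ.dCotProj p)

/-- The canonical symplectic form `Ω = -dΘ` of `T^*E`. -/
def omegaH (p : Φ.Cotangent) :
    TangentSpace (cotModel n) p →L[ℝ] TangentSpace (cotModel n) p →L[ℝ] ℝ :=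
  -extDer (cotModel n) Φ.liouville p

/-- The `π`-semibasic covectors at `e`, i.e. those that vanish on `π`-vertical vectors. -/
def semibasic (e : E) : Submodule ℝ (TangentSpace (𝓡 (n + 1)) e →L[ℝ] ℝ) where
  carrier := {p | ∀ w, mfderiv (𝓡 (n + 1)) 𝓘(ℝ, ℝ) Φ.proj e w = 0 → p w = 0}
  zero_mem' := fun _ _ => rfl
  add_mem' := fun hp hq w hw => by simp [hp w hw, hq w hw]
  smul_mem' := fun c p hp w hw => by simp [hp w hw]

/-- (The points of) the restricted momentum bundle `J^{1*}E = T^*E / Λ¹₀ T^*E`. -/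
def J1Dual : Type _ := Σ e : E, (TangentSpace (𝓡 (n + 1)) e →L[ℝ] ℝ) ⧸ Φ.semibasic e

/-- The canonical projection `μ : T^*E → J^{1*}E`. -/
def mu (p : Φ.Cotangent) : Φ.J1Dual := ⟨p.proj, Submodule.Quotient.mk p.2⟩

variable {Φ}

/-- The extended Legendre map `J¹E → T^*E`; see `extLegendre_apply`. -/
def extLegendre (ℓ : Φ.J1 → ℝ) (y : Φ.J1) : Φ.Cotangent :=
  ⟨y.base, (dAt 𝓘(ℝ, J1Model n) ℓ y).comp (vertLift y) + ℓ y • Φ.baseForm y.base⟩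

/-- The extended Legendre map satisfies `[FL(y)](π¹_* Z) = Θ_ℒ(Z)` for all `Z ∈ T_y J¹E`. -/
lemma extLegendre_apply (ℓ : Φ.J1 → ℝ) (y : Φ.J1) (Z : TangentSpace 𝓘(ℝ, J1Model n) y) :
    (extLegendre ℓ y).2 (dBase y Z) = thetaL ℓ y Z := rfl

/-- The restricted Legendre map `FL = μ ∘ F̃L : J¹E → J^{1*}E`. -/
def legendre (ℓ : Φ.J1 → ℝ) (y : Φ.J1) : Φ.J1Dual := Φ.mu (extLegendre ℓ y)

/-- The tangent map of the extended Legendre map. -/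
def dExtLegendre (ℓ : Φ.J1 → ℝ) (y : Φ.J1) :
    TangentSpace 𝓘(ℝ, J1Model n) y →L[ℝ] TangentSpace (cotModel n) (extLegendre ℓ y) :=
  mfderiv 𝓘(ℝ, J1Model n) (cotModel n) (extLegendre ℓ) y

/-- Almost regular Lagrangians. -/
structure IsAlmostRegular (ℓ : Φ.J1 → ℝ) : Prop where
  regular_range : IsRegularSubmanifold (cotModel n) (range (extLegendre ℓ))
  submersion : IsSubmersionBetween 𝓘(ℝ, J1Model n) (cotModel n) (extLegendre ℓ) univ
    (range (extLegendre ℓ))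
  connected_ext_fiber : ∀ y, IsConnected (extLegendre ℓ ⁻¹' {extLegendre ℓ y})
  regular_fiber : ∀ y, IsRegularSubmanifold 𝓘(ℝ, J1Model n) (legendre ℓ ⁻¹' {legendre ℓ y})
  connected_fiber : ∀ y, IsConnected (legendre ℓ ⁻¹' {legendre ℓ y})

/-! ### The two constraint algorithms

`𝒫̃ = F̃L(J¹E) ⊆ T^*E` and `𝒫 = FL(J¹E) = μ(𝒫̃) ⊆ J^{1*}E`. The manifold structure of `𝒫` is the one
for which `μ₀ = μ|𝒫̃ : 𝒫̃ → 𝒫` is a diffeomorphism, with inverse `h₀`, and the forms `Ω_{h₀}`, `η⁰`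
of `𝒫` correspond under `μ₀` to the restrictions of `Ω`, `η` to `𝒫̃`. So submanifolds, tangent
spaces, smooth functions and vector fields of `𝒫` are expressed through their images in `𝒫̃`. -/

/-- `M_i ⊆ J¹E`. -/
def lagSet (ℓ : Φ.J1 → ℝ) (i : ℕ) : Set Φ.J1 :=
  constraintSet 𝓘(ℝ, J1Model n) univ Φ.etaL (omegaL ℓ) i

/-- `h₀(P_i) ⊆ 𝒫̃ ⊆ T^*E`. -/
def hamSetExt (ℓ : Φ.J1 → ℝ) (i : ℕ) : Set Φ.Cotangent :=
  constraintSet (cotModel n) (range (extLegendre ℓ)) Φ.etaH Φ.omegaH i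

/-- `P_i ⊆ 𝒫 ⊆ J^{1*}E`. -/
def hamSet (ℓ : Φ.J1 → ℝ) (i : ℕ) : Set Φ.J1Dual := Φ.mu '' hamSetExt ℓ i

end FiberedManifold
end NonAutMech

end

open NonAutMech NonAutMech.FiberedManifold

/-! Write f for the extended Legendre map `extLegendre` and 𝒫̃ for its image. By construction Θ_ℒ is
the pullback by f of the Liouville form, so Ω_ℒ and η are the pullbacks of the corresponding forms
of T^*E (`omegaL_eq`, `etaL_eq`), and f is a submersion onto 𝒫̃. Most of the theorem is therefore a
statement about a submersion onto a submanifold that intertwines the forms.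

For a submanifold Q of 𝒫̃, a vector X is tangent to f⁻¹(Q) exactly when f_*X is tangent to Q
(`mem_tangentTo_preimage_iff`), and f_* reaches the whole tangent space of 𝒫̃. So X solves the
equations of the algorithm at y exactly when f_*X solves them at f(y), and by induction M_i is the
preimage of P_i (`constraintSet_eq_preimage`). Submersivity and equality of codimensions follow by
linear algebra.

Two points belong to mechanics. The kernel of f_* is found from the coordinate form of the
symplectic structure (`dExtLegendre_eq_zero_iff`). For the injectivity of μ on 𝒫̃
(`extLegendre_eq_of_legendre_eq`), the covectors f(z), for z in a fibre of FL through y, agree on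
π-vertical vectors, and f(z) takes the value ℓ(z) on the velocity of z. The function z ↦ ℓ(z) -
f(y)(velocity of z) has zero differential along the fibre, which is connected, and it vanishes at y;
so f(z) = f(y).

As to the constraints, by the Fredholm alternative the algorithm can be continued at a point exactly
when i(Z)(η - γ) vanishes there for all Z in the orthogonal space (`mem_constraintSet_succ_iff`).
Orthogonal spaces are preimages too, so constant rank in J¹E gives locally constant rank in 𝒫̃, and
there finitely many vector fields span them (`exists_orthTo_generators`). A minimal subfamily of
their constraints is a basis. Its pullback is again a basis (`exists_constraintBasis`): vector
fields on 𝒫̃ lift (`exists_lift`), vectors of J¹E push forward pointwise with smooth coefficients,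
and a local section of f (`exists_local_section`) carries a redundancy in J¹E to one in 𝒫̃. -/

noncomputable section
namespace NonAutMech

set_option linter.unusedSectionVars false

/-! ### Local inverses, smooth on their whole domain. -/

section VectorCalculus

variable {V W : Type*} [NormedAddCommGroup V] [NormedSpace ℝ V] [CompleteSpace V]
  [NormedAddCommGroup W] [NormedSpace ℝ W]

/-- The smooth inverse function theorem. -/
lemma exists_smooth_openPartialHomeomorph {Φ : V → W} {O : Set V} (hO : IsOpen O) {a : V}
    (ha : a ∈ O) (hΦ : ContDiffOn ℝ ∞ Φ O) (A : V ≃L[ℝ] W)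
    (hA : HasFDerivAt Φ (A : V →L[ℝ] W) a) :
    ∃ e : OpenPartialHomeomorph V W, a ∈ e.source ∧ e.source ⊆ O ∧ (∀ v, e v = Φ v) ∧
      ContDiffOn ℝ ∞ e e.source ∧ ContDiffOn ℝ ∞ e.symm e.target := by
  have hat : ContDiffAt ℝ ∞ Φ a := hΦ.contDiffAt (hO.mem_nhds ha)
  set e₀ := hat.toOpenPartialHomeomorph Φ hA (by simp) with he₀
  have hcoe : ∀ v, e₀ v = Φ v := fun v => rfl
  have hsm : ContinuousOn (fderiv ℝ Φ) O := hΦ.continuousOn_fderiv_of_isOpen hO (by simp)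
  -- Restricting to the points with invertible derivative makes the inverse smooth on all of its
  -- domain, not only at the image of `a`.
  set O' : Set V := O ∩ fderiv ℝ Φ ⁻¹' (range ((↑) : (V ≃L[ℝ] W) → V →L[ℝ] W)) with hO'
  have hO'o : IsOpen O' := hsm.isOpen_inter_preimage hO ContinuousLinearEquiv.isOpen
  have haO' : a ∈ O' := ⟨ha, A, hA.fderiv.symm⟩
  set e := e₀.restrOpen O' hO'o with he
  have hsrc : e.source = e₀.source ∩ O' := e₀.restrOpen_source _ _
  refine ⟨e, ?_, ?_, fun v => rfl, ?_, ?_⟩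
  · rw [hsrc]
    exact ⟨hat.mem_toOpenPartialHomeomorph_source hA (by simp), haO'⟩
  · rw [hsrc]; exact fun v hv => hv.2.1
  · refine hΦ.mono ?_
    rw [hsrc]; exact fun v hv => hv.2.1
  · intro w hw
    have h1 : e.symm w ∈ e.source := e.map_target hw
    rw [hsrc] at h1
    obtain ⟨B, hB⟩ := h1.2.2
    have hd : HasFDerivAt Φ (B : V →L[ℝ] W) (e.symm w) := by
      have := ((hΦ.contDiffAt (hO.mem_nhds h1.2.1)).differentiableAt (by simp)).hasFDerivAt
      rwa [← hB] at this
    exact (e.contDiffAt_symm hw hd (hΦ.contDiffAt (hO.mem_nhds h1.2.1))).contDiffWithinAt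

end VectorCalculus

/-! ### Straightening of submersions and tangent spaces of zero sets. -/

section Straightening

variable {V H N : Type*} [NormedAddCommGroup V] [NormedSpace ℝ V] [FiniteDimensional ℝ V]
  [TopologicalSpace H]
  (I : ModelWithCorners ℝ V H) [I.Boundaryless] [TopologicalSpace N] [ChartedSpace H N]

/-- The extended chart of a boundaryless manifold, as a partial homeomorphism. -/
def extHomeo (x : N) : OpenPartialHomeomorph N V :=
  (chartAt H x).trans I.toHomeomorph.toOpenPartialHomeomorph

@[simp] lemma extHomeo_coe (x : N) : ⇑(extHomeo I x) = extChartAt I x := rfl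
@[simp] lemma extHomeo_symm_coe (x : N) : ⇑(extHomeo I x).symm = (extChartAt I x).symm := rfl
@[simp] lemma extHomeo_source (x : N) : (extHomeo I x).source = (extChartAt I x).source := by
  simp [extHomeo]
@[simp] lemma extHomeo_target (x : N) : (extHomeo I x).target = (extChartAt I x).target := by
  ext v
  have : v ∈ range I := by simp [I.range_eq_univ]
  simpa [extHomeo] using fun _ => this

variable [IsManifold I ∞ N]
variable {F : Type*} [NormedAddCommGroup F] [NormedSpace ℝ F] [FiniteDimensional ℝ F]

/-- A smooth map with surjective differential at `x` is, near `x`, the first component of a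
diffeomorphism onto an open subset of a product. -/
lemma exists_straightening {φ : N → F} {U : Set N} (hU : IsOpen U)
    (hφ : ContMDiffOn I 𝓘(ℝ, F) ∞ φ U) {x : N} (hx : x ∈ U)
    (hs : Surjective (mfderiv I 𝓘(ℝ, F) φ x)) :
    ∃ (K : Submodule ℝ V) (Ψ : OpenPartialHomeomorph N (F × K)), x ∈ Ψ.source ∧ Ψ.source ⊆ U ∧
      ContMDiffOn I 𝓘(ℝ, F × K) ∞ Ψ Ψ.source ∧ ContMDiffOn 𝓘(ℝ, F × K) I ∞ Ψ.symm Ψ.target ∧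
      ∀ z ∈ Ψ.source, (Ψ z).1 = φ z := by
  set c := extHomeo I x with hc
  set O : Set V := c.target ∩ c.symm ⁻¹' U with hO
  have hOo : IsOpen O := c.isOpen_inter_preimage_symm hU
  have hxs : x ∈ c.source := by simp [hc]
  have hcx : c.symm (c x) = x := c.left_inv hxs
  have ha : c x ∈ O := ⟨c.map_source hxs, by simpa [hcx] using hx⟩
  have hcs : ContMDiffOn 𝓘(ℝ, V) I ∞ c.symm c.target := by
    simpa [hc] using contMDiffOn_extChartAt_symm (I := I) (n := ∞) x
  have hcc : ContMDiffOn I 𝓘(ℝ, V) ∞ c c.source := by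
    simpa [hc] using contMDiffOn_extChartAt (I := I) (n := ∞) (x := x)
  have hφc : ContDiffOn ℝ ∞ (φ ∘ c.symm) O := by
    rw [← contMDiffOn_iff_contDiffOn]
    exact hφ.comp (hcs.mono inter_subset_left) (fun v hv => hv.2)
  set D : V →L[ℝ] F := fderiv ℝ (φ ∘ c.symm) (c x) with hD
  have hDd : HasFDerivAt (φ ∘ c.symm) D (c x) :=
    ((hφc.contDiffAt (hOo.mem_nhds ha)).differentiableAt (by simp)).hasFDerivAt
  have hDs : Surjective D := by
    have h1 : mfderiv I 𝓘(ℝ, F) φ x = D.comp (mfderiv I 𝓘(ℝ, V) c x) := by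
      have e1 : φ =ᶠ[𝓝 x] (φ ∘ c.symm) ∘ c := by
        filter_upwards [c.open_source.mem_nhds hxs] with z hz
        simp [-extHomeo_coe, -extHomeo_symm_coe, c.left_inv hz]
      rw [e1.mfderiv_eq]
      have h2 : MDifferentiableAt I 𝓘(ℝ, V) c x :=
        (hcc.contMDiffAt (c.open_source.mem_nhds hxs)).mdifferentiableAt (by simp)
      exact (HasMFDerivAt.comp x hDd.hasMFDerivAt h2.hasMFDerivAt).mfderiv
    rw [h1] at hs
    exact fun w => let ⟨v, hv⟩ := hs w; ⟨_, hv⟩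
  -- A linear projection `P` onto the kernel of `D` completes `D` to an isomorphism, so `φ` together
  -- with `P` is a local diffeomorphism.
  set K : Submodule ℝ V := LinearMap.ker (D : V →ₗ[ℝ] F) with hK
  obtain ⟨P, hP⟩ := LinearMap.exists_leftInverse_of_injective K.subtype (by simp)
  have hPk : ∀ k : K, P k = k := fun k => congrArg (fun f => f k) hP
  set P' : V →L[ℝ] K := LinearMap.toContinuousLinearMap P with hP'
  have hbij : Bijective ((D : V →ₗ[ℝ] F).prod P) := by
    constructor
    · rw [injective_iff_map_eq_zero]
      intro v hv
      have h1 : D v = 0 := congrArg Prod.fst hv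
      have h2 : P v = 0 := congrArg Prod.snd hv
      have := hPk ⟨v, h1⟩
      rw [h2] at this
      exact (congrArg Subtype.val this).symm
    · rintro ⟨w, k⟩
      obtain ⟨v, rfl⟩ := hDs w
      refine ⟨v + (k - P v : K), ?_⟩
      have h1 : D ((k - P v : K) : V) = 0 := (k - P v : K).2
      ext1
      · change D (v + (k - P v : K)) = D v
        rw [map_add, h1, add_zero]
      · change P (v + (k - P v : K)) = k
        rw [map_add, hPk]; simp
  set A : V ≃L[ℝ] F × K := (LinearEquiv.ofBijective _ hbij).toContinuousLinearEquiv with hA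
  have hAc : (A : V →L[ℝ] F × K) = D.prod P' := by ext v <;> rfl
  have hΦ : HasFDerivAt (fun v => ((φ ∘ c.symm) v, P' v)) (A : V →L[ℝ] F × K) (c x) := by
    rw [hAc]
    exact hDd.prodMk P'.hasFDerivAt
  obtain ⟨e, he1, he2, he3, he4, he5⟩ := exists_smooth_openPartialHomeomorph hOo ha
    (hφc.prodMk P'.contDiff.contDiffOn) A hΦ
  refine ⟨K, c.trans e, ?_, ?_, ?_, ?_, ?_⟩
  · simp only [OpenPartialHomeomorph.trans_source]
    exact ⟨hxs, he1⟩
  · intro z hz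
    simp only [OpenPartialHomeomorph.trans_source] at hz
    have := (he2 hz.2).2
    rwa [mem_preimage, c.left_inv hz.1] at this
  · refine he4.contMDiffOn.comp (hcc.mono ?_) ?_
    · exact fun z hz => hz.1
    · exact fun z hz => hz.2
  · refine hcs.comp (he5.contMDiffOn.mono ?_) ?_
    · exact fun z hz => hz.1
    · exact fun z hz => hz.2
  · intro z hz
    simp only [OpenPartialHomeomorph.trans_source] at hz
    change (e (c z)).1 = _
    rw [he3]
    simp [-extHomeo_coe, -extHomeo_symm_coe, c.left_inv hz.1]

lemma tangentTo_of_mem_nhds {S : Set N} {x : N} (h : S ∈ 𝓝 x) : tangentTo I S x = ⊤ := by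
  rw [eq_top_iff]
  intro X _ f hf h0
  rw [nhdsWithin_eq_nhds.2 h] at h0
  have : f =ᶠ[𝓝 x] fun _ => 0 := h0
  rw [dAt, this.mfderiv_eq, mfderiv_const]
  rfl

/-- Vectors annihilated by the differential of the defining map of a submanifold are velocities of
curves in the submanifold. -/
lemma exists_curve {φ : N → F} {U : Set N} (hU : IsOpen U)
    (hφ : ContMDiffOn I 𝓘(ℝ, F) ∞ φ U) {x : N} (hx : x ∈ U)
    (hs : Surjective (mfderiv I 𝓘(ℝ, F) φ x)) {X : TangentSpace I x}
    (hX : mfderiv I 𝓘(ℝ, F) φ x X = 0) :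
    ∃ c : ℝ → N, c 0 = x ∧ ContMDiffAt 𝓘(ℝ, ℝ) I ∞ c 0 ∧ (∀ᶠ t in 𝓝 0, c t ∈ U ∧ φ (c t) = φ x) ∧
      ∀ f : N → ℝ, MDifferentiableAt I 𝓘(ℝ, ℝ) f x → HasDerivAt (f ∘ c) (dAt I f x X) 0 := by
  obtain ⟨K, Ψ, h1, h2, h3, h4, h5⟩ := exists_straightening I hU hφ hx hs
  have hΨx := h3.contMDiffAt (Ψ.open_source.mem_nhds h1)
  have hΨd : MDifferentiableAt I 𝓘(ℝ, F × K) Ψ x := hΨx.mdifferentiableAt (by simp)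
  set T : F × K := mfderiv I 𝓘(ℝ, F × K) Ψ x X with hT
  have hT1 : T.1 = 0 := by
    have e1 : φ =ᶠ[𝓝 x] fun z => ContinuousLinearMap.fst ℝ F K (Ψ z) := by
      filter_upwards [Ψ.open_source.mem_nhds h1] with z hz
      exact (h5 z hz).symm
    rw [e1.mfderiv_eq] at hX
    have := (ContinuousLinearMap.fst ℝ F K).hasMFDerivAt (x := Ψ x) |>.comp x hΨd.hasMFDerivAt
    have h6 := this.mfderiv
    change mfderiv I 𝓘(ℝ, F) (fun z => ContinuousLinearMap.fst ℝ F K (Ψ z)) x = _ at h6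
    rw [h6] at hX
    exact hX
  -- In the straightened coordinates the curve is a line; its direction has first component zero, so
  -- `φ` is constant along it.
  set d : ℝ → F × K := fun t => Ψ x + t • T with hd
  have hd0 : d 0 = Ψ x := by simp [hd]
  have hdc : ContDiff ℝ ∞ d := by fun_prop
  have hdd : HasDerivAt d T 0 := by
    have := ((hasDerivAt_id (0 : ℝ)).smul_const T).const_add (Ψ x)
    rwa [one_smul] at this
  have htgt : ∀ᶠ t in 𝓝 0, d t ∈ Ψ.target :=
    hdc.continuous.continuousAt.eventually_mem (by
      rw [hd0]; exact Ψ.open_target.mem_nhds (Ψ.map_source h1))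
  refine ⟨fun t => Ψ.symm (d t), ?_, ?_, ?_, ?_⟩
  · simp only [hd0]; exact Ψ.left_inv h1
  · have : ContMDiffAt 𝓘(ℝ, F × K) I ∞ Ψ.symm (d 0) := by
      rw [hd0]; exact h4.contMDiffAt (Ψ.open_target.mem_nhds (Ψ.map_source h1))
    exact this.comp 0 hdc.contMDiff.contMDiffAt
  · filter_upwards [htgt] with t ht
    refine ⟨h2 (Ψ.map_target ht), ?_⟩
    rw [← h5 _ (Ψ.map_target ht), Ψ.right_inv ht, ← h5 x h1]
    simp [hd, hT1]
  · intro f hf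
    have e1 : f =ᶠ[𝓝 x] (f ∘ Ψ.symm) ∘ Ψ := by
      filter_upwards [Ψ.open_source.mem_nhds h1] with z hz
      simp [Ψ.left_inv hz]
    have hxx : Ψ.symm (Ψ x) = x := Ψ.left_inv h1
    have hsd : MDifferentiableAt 𝓘(ℝ, F × K) I Ψ.symm (Ψ x) :=
      (h4.contMDiffAt (Ψ.open_target.mem_nhds (Ψ.map_source h1))).mdifferentiableAt (by simp)
    have hfΨ : MDifferentiableAt 𝓘(ℝ, F × K) 𝓘(ℝ, ℝ) (f ∘ Ψ.symm) (Ψ x) := by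
      refine MDifferentiableAt.comp _ ?_ hsd
      rwa [hxx]
    have h6 : dAt I f x X = mfderiv 𝓘(ℝ, F × K) 𝓘(ℝ, ℝ) (f ∘ Ψ.symm) (Ψ x) T := by
      rw [dAt, e1.mfderiv_eq, mfderiv_comp x hfΨ hΨd]
      rfl
    rw [h6, mfderiv_eq_fderiv]
    have h7 : HasFDerivAt (f ∘ Ψ.symm) (fderiv ℝ (f ∘ Ψ.symm) (Ψ x)) (d 0) := by
      rw [hd0]; exact hfΨ.differentiableAt.hasFDerivAt
    exact h7.comp_hasDerivAt 0 hdd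

/-- A function vanishing on `S` vanishes along the curve, and `dAt I f x X` is its derivative along
the curve. -/
lemma mem_tangentTo_of_curve {S : Set N} {x : N} {X : TangentSpace I x} {c : ℝ → N} (h0 : c 0 = x)
    (hc : ContinuousAt c 0) (hS : ∀ᶠ t in 𝓝 0, c t ∈ S)
    (hX : ∀ f : N → ℝ, MDifferentiableAt I 𝓘(ℝ, ℝ) f x → HasDerivAt (f ∘ c) (dAt I f x X) 0) :
    X ∈ tangentTo I S x := by
  intro f hf hfS
  have ht : Tendsto c (𝓝 0) (𝓝[S] x) := by
    refine tendsto_nhdsWithin_iff.2 ⟨?_, hS⟩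
    rw [← h0]; exact hc
  have h1 : f ∘ c =ᶠ[𝓝 0] fun _ => (0 : ℝ) := ht.eventually hfS
  exact (hX f (hf.mdifferentiableAt (by simp))).unique
    ((hasDerivAt_const (0 : ℝ) (0 : ℝ)).congr_of_eventuallyEq h1)

/-- `tangentTo` tests only against real functions; a linear functional that does not kill the value
of the differential reduces the vector-valued case to these. -/
lemma mfderiv_eq_zero_of_mem_tangentTo {S : Set N} {φ : N → F} {x : N}
    (hφ : ContMDiffAt I 𝓘(ℝ, F) ∞ φ x) (h0 : ∀ᶠ z in 𝓝[S] x, φ z = 0) {X : TangentSpace I x}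
    (hX : X ∈ tangentTo I S x) : mfderiv I 𝓘(ℝ, F) φ x X = 0 := by
  by_contra hne
  set w : F := mfderiv I 𝓘(ℝ, F) φ x X with hw
  have hne' : w ≠ 0 := hne
  obtain ⟨l, hl⟩ := SeparatingDual.exists_ne_zero (R := ℝ) hne'
  have h1 : ContMDiffAt I 𝓘(ℝ, ℝ) ∞ (fun z => l (φ z)) x :=
    l.contMDiff.contMDiffAt.comp x hφ
  have h2 := hX _ h1 (h0.mono fun z hz => by rw [hz, map_zero])
  have h3 := l.hasMFDerivAt (x := φ x) |>.comp x (hφ.mdifferentiableAt (by simp)).hasMFDerivAt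
  have h4 := h3.mfderiv
  change mfderiv I 𝓘(ℝ, ℝ) (fun z => l (φ z)) x = _ at h4
  rw [dAt, h4] at h2
  exact hl h2

/-- The tangent space of the zero set of a submersion is the kernel of its differential. -/
lemma mem_tangentTo_iff_mfderiv_eq_zero {S : Set N} {φ : N → F} {U : Set N} (hU : IsOpen U)
    (hφ : ContMDiffOn I 𝓘(ℝ, F) ∞ φ U) {x : N} (hx : x ∈ U) (hxS : x ∈ S)
    (hs : Surjective (mfderiv I 𝓘(ℝ, F) φ x)) (hSU : S ∩ U = {z ∈ U | φ z = 0})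
    (X : TangentSpace I x) : X ∈ tangentTo I S x ↔ mfderiv I 𝓘(ℝ, F) φ x X = 0 := by
  have h0 : φ x = 0 := (hSU.subset ⟨hxS, hx⟩).2
  have hφx := hφ.contMDiffAt (hU.mem_nhds hx)
  constructor
  · intro hX
    refine mfderiv_eq_zero_of_mem_tangentTo I hφx ?_ hX
    filter_upwards [self_mem_nhdsWithin, nhdsWithin_le_nhds (hU.mem_nhds hx)] with z hz hzU
    exact (hSU.subset ⟨hz, hzU⟩).2
  · intro hX
    obtain ⟨c, hc0, hc1, hc2, hc3⟩ := exists_curve I hU hφ hx hs hX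
    refine mem_tangentTo_of_curve I hc0 hc1.continuousAt ?_ hc3
    filter_upwards [hc2] with t ht
    exact (hSU.symm.subset ⟨ht.1, by rw [ht.2, h0]⟩).1

end Straightening

/-! ### Functoriality of the tangent spaces of subsets. -/

section MapTangent

variable {V H N : Type*} [NormedAddCommGroup V] [NormedSpace ℝ V]
  [TopologicalSpace H]
  (I : ModelWithCorners ℝ V H) [TopologicalSpace N] [ChartedSpace H N]
  {V' H' N' : Type*} [NormedAddCommGroup V'] [NormedSpace ℝ V']
  [TopologicalSpace H']
  (I' : ModelWithCorners ℝ V' H') [TopologicalSpace N'] [ChartedSpace H' N']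

/-- A smooth map sends tangent vectors of `S` to tangent vectors of a set into which it maps `S`. -/
lemma mfderiv_mem_tangentTo {f : N → N'} {S : Set N} {T : Set N'} {x : N}
    (hf : ContMDiffAt I I' ∞ f x) (hST : ∀ᶠ z in 𝓝[S] x, f z ∈ T) {X : TangentSpace I x}
    (hX : X ∈ tangentTo I S x) : mfderiv I I' f x X ∈ tangentTo I' T (f x) := by
  intro h hh h0
  have h1 := hX (h ∘ f) (hh.comp x hf) (by
    have ht : Tendsto f (𝓝[S] x) (𝓝[T] (f x)) :=
      tendsto_nhdsWithin_iff.2 ⟨hf.continuousAt.mono_left nhdsWithin_le_nhds, hST⟩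
    exact ht.eventually h0)
  rw [dAt, mfderiv_comp x (hh.mdifferentiableAt (by simp)) (hf.mdifferentiableAt (by simp))] at h1
  exact h1

lemma tangentTo_mono {S T : Set N} {x : N} (h : ∀ᶠ z in 𝓝[S] x, z ∈ T) :
    tangentTo I S x ≤ tangentTo I T x := by
  intro X hX f hf h0
  refine hX f hf ?_
  have : 𝓝[S] x ≤ 𝓝[T] x := le_inf nhdsWithin_le_nhds (le_principal_iff.2 h)
  exact this h0

end MapTangent

/-! ### Submanifolds inside submanifolds, and functions on connected submanifolds. -/

section ZeroSets

variable {V H N : Type*} [NormedAddCommGroup V] [NormedSpace ℝ V] [FiniteDimensional ℝ V]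
  [TopologicalSpace H]
  (I : ModelWithCorners ℝ V H) [I.Boundaryless] [TopologicalSpace N] [ChartedSpace H N]
  [IsManifold I ∞ N]
  {F : Type*} [NormedAddCommGroup F] [NormedSpace ℝ F] [FiniteDimensional ℝ F]
  {F' : Type*} [NormedAddCommGroup F'] [NormedSpace ℝ F'] [FiniteDimensional ℝ F']

omit [FiniteDimensional ℝ V] [I.Boundaryless] [IsManifold I ∞ N] [FiniteDimensional ℝ F] in
lemma mdifferentiable_of_contMDiffOn {Ψ : OpenPartialHomeomorph N F}
    (h3 : ContMDiffOn I 𝓘(ℝ, F) ∞ Ψ Ψ.source) (h4 : ContMDiffOn 𝓘(ℝ, F) I ∞ Ψ.symm Ψ.target) :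
    Ψ.MDifferentiable I 𝓘(ℝ, F) :=
  ⟨h3.mdifferentiableOn (by simp), h4.mdifferentiableOn (by simp)⟩

omit [FiniteDimensional ℝ V] [I.Boundaryless] [IsManifold I ∞ N] [FiniteDimensional ℝ F]
  [FiniteDimensional ℝ F'] in
lemma mfderiv_clm_comp {φ : N → F} {x : N} (hφ : MDifferentiableAt I 𝓘(ℝ, F) φ x) (L : F →L[ℝ] F')
    (X : TangentSpace I x) :
    mfderiv I 𝓘(ℝ, F') (fun z => L (φ z)) x X = L (mfderiv I 𝓘(ℝ, F) φ x X) := by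
  have h := (L.hasMFDerivAt (x := φ x)).comp x hφ.hasMFDerivAt
  have h' := h.mfderiv
  change mfderiv I 𝓘(ℝ, F') (fun z => L (φ z)) x = _ at h'
  rw [h']; rfl

omit [FiniteDimensional ℝ V] [I.Boundaryless] [IsManifold I ∞ N] [FiniteDimensional ℝ F] in
lemma mfderiv_fst_straightening {K : Type*} [NormedAddCommGroup K] [NormedSpace ℝ K]
    {φ : N → F} {Ψ : OpenPartialHomeomorph N (F × K)}
    (h3 : ContMDiffOn I 𝓘(ℝ, F × K) ∞ Ψ Ψ.source) (h5 : ∀ z ∈ Ψ.source, (Ψ z).1 = φ z) {z : N}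
    (hz : z ∈ Ψ.source) (X : TangentSpace I z) :
    mfderiv I 𝓘(ℝ, F) φ z X = (show F × K from mfderiv I 𝓘(ℝ, F × K) Ψ z X).1 := by
  have e1 : φ =ᶠ[𝓝 z] fun z => ContinuousLinearMap.fst ℝ F K (Ψ z) := by
    filter_upwards [Ψ.open_source.mem_nhds hz] with z hz
    exact (h5 z hz).symm
  rw [e1.mfderiv_eq]
  exact mfderiv_clm_comp I ((h3.contMDiffAt (Ψ.open_source.mem_nhds hz)).mdifferentiableAt
    (by simp)) (ContinuousLinearMap.fst ℝ F K) X

/-- Surjectivity of the differential is an open condition. -/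
lemma exists_isOpen_surjective_mfderiv {φ : N → F} {U : Set N} (hU : IsOpen U)
    (hφ : ContMDiffOn I 𝓘(ℝ, F) ∞ φ U) {x : N} (hx : x ∈ U)
    (hs : Surjective (mfderiv I 𝓘(ℝ, F) φ x)) :
    ∃ O : Set N, IsOpen O ∧ x ∈ O ∧ O ⊆ U ∧ ∀ z ∈ O, Surjective (mfderiv I 𝓘(ℝ, F) φ z) := by
  obtain ⟨K, Ψ, h1, h2, h3, h4, h5⟩ := exists_straightening I hU hφ hx hs
  refine ⟨Ψ.source, Ψ.open_source, h1, h2, fun z hz w => ?_⟩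
  obtain ⟨X, hX⟩ := (mdifferentiable_of_contMDiffOn I h3 h4).mfderiv_surjective hz (w, 0)
  refine ⟨X, ?_⟩
  rw [mfderiv_fst_straightening I h3 h5 hz, hX]

/-- If a submanifold `S` is contained in the zero set of a submersion `G` and its tangent space at
`x` contains the kernel of `dG`, then it is that zero set near `x`. -/
lemma eventually_mem_of_ker_le_tangentTo {S : Set N} {φ : N → F} {U : Set N} (hU : IsOpen U)
    (hφ : ContMDiffOn I 𝓘(ℝ, F) ∞ φ U) {x : N} (hx : x ∈ U) (hxS : x ∈ S)
    (hs : Surjective (mfderiv I 𝓘(ℝ, F) φ x)) (hSU : S ∩ U = {z ∈ U | φ z = 0})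
    {G : N → F'} (hG : ContMDiffOn I 𝓘(ℝ, F') ∞ G U)
    (hGs : Surjective (mfderiv I 𝓘(ℝ, F') G x)) (hSG : ∀ z ∈ S ∩ U, G z = 0)
    (hker : ∀ X : TangentSpace I x, mfderiv I 𝓘(ℝ, F') G x X = 0 → X ∈ tangentTo I S x) :
    ∀ᶠ z in 𝓝 x, G z = 0 → z ∈ S := by
  obtain ⟨K, Ψ, h1, h2, h3, h4, h5⟩ := exists_straightening I hU hG hx hGs
  obtain ⟨K', Ψ', h1', h2', h3', h4', h5'⟩ := exists_straightening I hU hφ hx hs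
  have hx0 : φ x = 0 := (hSU.subset ⟨hxS, hx⟩).2
  have hd := mdifferentiable_of_contMDiffOn I h3 h4
  have hd' := mdifferentiable_of_contMDiffOn I h3' h4'
  set k₀ : K' := (Ψ' x).2 with hk₀
  have hk : ((0 : F), k₀) = Ψ' x := Prod.ext (by rw [h5' x h1', hx0]) rfl
  have hkt : ((0 : F), k₀) ∈ Ψ'.target := by rw [hk]; exact Ψ'.map_source h1'
  set τ : F × K' → F' × K := fun p => Ψ (Ψ'.symm p) with hτ
  have hΨx : ContMDiffAt I 𝓘(ℝ, F' × K) ∞ Ψ (Ψ'.symm (Ψ' x)) := by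
    rw [Ψ'.left_inv h1']; exact h3.contMDiffAt (Ψ.open_source.mem_nhds h1)
  have hΨ's : ContMDiffAt 𝓘(ℝ, F × K') I ∞ Ψ'.symm (Ψ' x) :=
    h4'.contMDiffAt (Ψ'.open_target.mem_nhds (Ψ'.map_source h1'))
  have hτc : ContDiffAt ℝ ∞ τ (Ψ' x) := (hΨx.comp (Ψ' x) hΨ's).contDiffAt
  -- `k ↦ Ψ'.symm (0, k)` parametrizes `S` near `x`, and `m` reads off the second `Ψ`-coordinate.
  -- Once `m` is open at `k₀`, every value near `(Ψ x).2` is attained on `S`.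
  set m : K' → K := fun k => (τ (0, k)).2 with hm
  have hmc : ContDiffAt ℝ ∞ m k₀ := by
    have h6 : ContDiffAt ℝ ∞ (fun k : K' => τ (0, k)) k₀ := by
      refine ContDiffAt.comp k₀ (g := τ) (f := fun k => ((0 : F), k)) ?_ (by fun_prop)
      rw [hk]; exact hτc
    exact contDiffAt_snd.comp k₀ h6
  have hmd : HasFDerivAt m ((ContinuousLinearMap.snd ℝ F' K).comp ((fderiv ℝ τ (Ψ' x)).comp
      (ContinuousLinearMap.inr ℝ F K'))) k₀ := by
    have h6 : HasFDerivAt (fun k : K' => τ (0, k)) ((fderiv ℝ τ (Ψ' x)).comp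
      (ContinuousLinearMap.inr ℝ F K')) k₀ := by
      refine HasFDerivAt.comp k₀ (g := τ) (f := fun k => ((0 : F), k)) ?_ ?_
      · rw [hk]; exact (hτc.differentiableAt (by simp)).hasFDerivAt
      · exact (ContinuousLinearMap.inr ℝ F K').hasFDerivAt
    exact (ContinuousLinearMap.snd ℝ F' K).hasFDerivAt.comp k₀ h6
  have hms : HasStrictFDerivAt m _ k₀ := hmc.hasStrictFDerivAt' hmd (by simp)
  have hsurj : LinearMap.range ((ContinuousLinearMap.snd ℝ F' K).comp ((fderiv ℝ τ (Ψ' x)).comp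
      (ContinuousLinearMap.inr ℝ F K'))).toLinearMap = ⊤ := by
    rw [LinearMap.range_eq_top]
    intro k
    -- A vector with `Ψ`-components `(0, k)` lies in the kernel of `dG`, hence is tangent to `S`,
    -- hence has `Ψ'`-components of the form `(0, T.2)`.
    obtain ⟨X, hX⟩ := hd.mfderiv_surjective h1 ((0 : F'), k)
    have hXS : X ∈ tangentTo I S x := hker X (by rw [mfderiv_fst_straightening I h3 h5 h1, hX]; rfl)
    have hX' := (mem_tangentTo_iff_mfderiv_eq_zero I hU hφ hx hxS hs hSU X).1 hXS
    rw [mfderiv_fst_straightening I h3' h5' h1'] at hX'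
    set T : F × K' := mfderiv I 𝓘(ℝ, F × K') Ψ' x X with hT
    refine ⟨T.2, ?_⟩
    have hT2 : ((0 : F), T.2) = T := Prod.ext hX'.symm rfl
    change (fderiv ℝ τ (Ψ' x) (0, T.2)).2 = k
    rw [hT2]
    have e1 : Ψ =ᶠ[𝓝 x] τ ∘ Ψ' := by
      filter_upwards [Ψ'.open_source.mem_nhds h1'] with z hz
      simp [hτ, Ψ'.left_inv hz]
    have h7 := (hτc.differentiableAt (by simp)).hasFDerivAt.hasMFDerivAt.comp x
      (hd'.mdifferentiableAt h1').hasMFDerivAt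
    rw [e1.mfderiv_eq, h7.mfderiv] at hX
    exact congrArg Prod.snd hX
  have hopen := hms.map_nhds_eq_of_surj hsurj
  have hmk : m k₀ = (Ψ x).2 := by
    simp only [hm, hτ, hk, Ψ'.left_inv h1']
  have hU' : ∀ᶠ k in 𝓝 k₀, ((0 : F), k) ∈ Ψ'.target ∧ Ψ'.symm (0, k) ∈ Ψ.source := by
    have hc1 : ContinuousAt (fun k : K' => ((0 : F), k)) k₀ := by fun_prop
    refine (hc1.eventually_mem (Ψ'.open_target.mem_nhds hkt)).and ?_
    have hc2 : ContinuousAt (fun k : K' => Ψ'.symm ((0 : F), k)) k₀ :=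
      ContinuousAt.comp (g := Ψ'.symm) (Ψ'.continuousAt_symm hkt) hc1
    refine hc2.eventually_mem (Ψ.open_source.mem_nhds ?_)
    rw [hk, Ψ'.left_inv h1']; exact h1
  have himg := image_mem_map (m := m) hU'
  rw [hopen, hmk] at himg
  have hc3 : ContinuousAt (fun z => (Ψ z).2) x :=
    continuous_snd.continuousAt.comp (Ψ.continuousAt h1)
  filter_upwards [hc3 himg, Ψ.open_source.mem_nhds h1] with z ⟨k, ⟨hk1, hk2⟩, hk3⟩ hz hGz
  -- This point of `S` has the same second `Ψ`-coordinate as `z`, and `G` vanishes at both; so the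
  -- two points coincide.
  set z' := Ψ'.symm (0, k) with hz'
  have hz's : z' ∈ Ψ'.source := Ψ'.map_target hk1
  have hz'S : z' ∈ S := (hSU.symm.subset ⟨h2' hz's, by
    rw [← h5' z' hz's, hz', Ψ'.right_inv hk1]⟩).1
  have : Ψ z' = Ψ z := by
    refine Prod.ext ?_ hk3
    rw [h5 z' hk2, h5 z hz, hGz]
    exact hSG z' ⟨hz'S, h2' hz's⟩
  rwa [← Ψ.injOn hk2 hz this]

/-- A submanifold `S'` of a submanifold `S` is locally defined in `S` by independent functions. -/
lemma exists_independent_functions {S S' : Set N} (hS : IsRegularSubmanifold I S)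
    (hS' : IsRegularSubmanifold I S') (hsub : S' ⊆ S) {x : N} (hx : x ∈ S') :
    ∃ (r : ℕ) (U : Set N) (h : N → (Fin r → ℝ)), IsOpen U ∧ x ∈ U ∧
      ContMDiffOn I 𝓘(ℝ, Fin r → ℝ) ∞ h U ∧ S' ∩ U = {z ∈ S ∩ U | h z = 0} ∧
      (∀ z ∈ S ∩ U, ∀ w, ∃ X ∈ tangentTo I S z, mfderiv I 𝓘(ℝ, Fin r → ℝ) h z X = w) ∧
      ∀ z ∈ S' ∩ U, ∀ X ∈ tangentTo I S z, mfderiv I 𝓘(ℝ, Fin r → ℝ) h z X = 0 →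
        X ∈ tangentTo I S' z := by
  obtain ⟨c₁, U₁, g₁, hU₁, hx₁, hg₁, hs₁, hz₁⟩ := hS x (hsub hx)
  obtain ⟨c₂, U₂, g₂, hU₂, hx₂, hg₂, hs₂, hz₂⟩ := hS' x hx
  set D₁ : V →L[ℝ] (Fin c₁ → ℝ) := mfderiv I 𝓘(ℝ, Fin c₁ → ℝ) g₁ x with hD₁
  set D₂ : V →L[ℝ] (Fin c₂ → ℝ) := mfderiv I 𝓘(ℝ, Fin c₂ → ℝ) g₂ x with hD₂
  -- The image of the tangent space of `S` under `dg₂`. Projecting `g₂` to it keeps as many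
  -- components as are independent on `S` at `x`.
  set R : Submodule ℝ (Fin c₂ → ℝ) := (LinearMap.ker D₁.toLinearMap).map D₂.toLinearMap with hR
  obtain ⟨P, hP⟩ := LinearMap.exists_leftInverse_of_injective R.subtype (by simp)
  have hPk : ∀ k : R, P k = k := fun k => congrArg (fun f => f k) hP
  set r := Module.finrank ℝ R with hr
  set e : R ≃ₗ[ℝ] (Fin r → ℝ) := LinearEquiv.ofFinrankEq _ _ (by simp [hr]) with he
  set L : (Fin c₂ → ℝ) →L[ℝ] (Fin r → ℝ) := LinearMap.toContinuousLinearMap (e.toLinearMap ∘ₗ P)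
    with hL
  have hLa : ∀ w, L w = e (P w) := fun w => rfl
  set h : N → (Fin r → ℝ) := fun z => L (g₂ z) with hh
  set U₀ := U₁ ∩ U₂ with hU₀
  have hU₀o : IsOpen U₀ := hU₁.inter hU₂
  have hhU : ContMDiffOn I 𝓘(ℝ, Fin r → ℝ) ∞ h U₀ :=
    L.contMDiff.comp_contMDiffOn (hg₂.mono inter_subset_right)
  set G : N → (Fin c₁ → ℝ) × (Fin r → ℝ) := fun z => (g₁ z, h z) with hG
  have hGU : ContMDiffOn I 𝓘(ℝ, (Fin c₁ → ℝ) × (Fin r → ℝ)) ∞ G U₀ :=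
    (hg₁.mono inter_subset_left).prodMk_space hhU
  have hGd : ∀ z ∈ U₀, ∀ X : TangentSpace I z,
      mfderiv I 𝓘(ℝ, (Fin c₁ → ℝ) × (Fin r → ℝ)) G z X =
        ((show Fin c₁ → ℝ from mfderiv I 𝓘(ℝ, Fin c₁ → ℝ) g₁ z X),
          (show Fin r → ℝ from mfderiv I 𝓘(ℝ, Fin r → ℝ) h z X)) := by
    intro z hz X
    have hd := (hGU.contMDiffAt (hU₀o.mem_nhds hz)).mdifferentiableAt (by simp)
    exact Prod.ext (mfderiv_clm_comp I hd (ContinuousLinearMap.fst ℝ _ _) X).symm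
      (mfderiv_clm_comp I hd (ContinuousLinearMap.snd ℝ _ _) X).symm
  have hhd : ∀ z ∈ U₀, ∀ X : TangentSpace I z, mfderiv I 𝓘(ℝ, Fin r → ℝ) h z X =
      L (mfderiv I 𝓘(ℝ, Fin c₂ → ℝ) g₂ z X) := fun z hz X => mfderiv_clm_comp I
      ((hg₂.contMDiffAt (hU₂.mem_nhds hz.2)).mdifferentiableAt (by simp)) L X
  have hxU₀ : x ∈ U₀ := ⟨hx₁, hx₂⟩
  have hGs : Surjective (mfderiv I 𝓘(ℝ, (Fin c₁ → ℝ) × (Fin r → ℝ)) G x) := by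
    rintro ⟨a, b⟩
    obtain ⟨X₁, hX₁⟩ : ∃ X₁ : V, D₁ X₁ = a := hs₁ x hx₁ a
    obtain ⟨k, hk⟩ := e.surjective (b - L (D₂ X₁))
    obtain ⟨X₂, hX₂, hk2⟩ := k.2
    refine ⟨X₁ + X₂, ?_⟩
    refine (hGd x hxU₀ _).trans (Prod.ext ?_ ((hhd x hxU₀ _).trans ?_))
    · change D₁ (X₁ + X₂) = a
      have h1 : D₁ X₁ = a := hX₁
      have h2 : D₁ X₂ = 0 := hX₂
      rw [map_add, h1, h2, add_zero]
    · change L (D₂ (X₁ + X₂)) = b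
      have h2 : D₂ X₂ = k := hk2
      rw [map_add, map_add, h2, hLa k, hPk, hk]
      abel
  have hS'U : S' ∩ U₀ = {z ∈ U₀ | g₂ z = 0} := by
    ext z
    constructor
    · rintro ⟨hz, hzU⟩
      exact ⟨hzU, (hz₂.subset ⟨hz, hzU.2⟩).2⟩
    · rintro ⟨hzU, hz⟩
      exact ⟨(hz₂.symm.subset ⟨hzU.2, hz⟩).1, hzU⟩
  have hS'G : ∀ z ∈ S' ∩ U₀, G z = 0 := by
    rintro z ⟨hz, hzU⟩
    have e1 : g₁ z = 0 := (hz₁.subset ⟨hsub hz, hzU.1⟩).2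
    have e2 : g₂ z = 0 := (hz₂.subset ⟨hz, hzU.2⟩).2
    simp [hG, hh, e1, e2]
  -- A vector killed by `D₁` has its image under `D₂` in `R`, where the projection is injective; so
  -- the kernel of `dG` is tangent to `S'`, and the discarded components of `g₂` are not needed to
  -- cut out `S'`.
  have hev := eventually_mem_of_ker_le_tangentTo I hU₀o (hg₂.mono inter_subset_right) hxU₀ hx
    (hs₂ x hx₂) hS'U hGU hGs hS'G (by
      intro X hX
      rw [hGd x hxU₀, hhd x hxU₀] at hX
      rw [mem_tangentTo_iff_mfderiv_eq_zero I hU₂ hg₂ hx₂ hx (hs₂ x hx₂) hz₂]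
      have e1 : D₁ X = 0 := congrArg Prod.fst hX
      have e2 : L (D₂ X) = 0 := congrArg Prod.snd hX
      have e3 : D₂ X ∈ R := ⟨X, e1, rfl⟩
      rw [hLa, LinearEquiv.map_eq_zero_iff] at e2
      have e4 := hPk ⟨_, e3⟩
      simp only [e2] at e4
      exact (congrArg Subtype.val e4).symm)
  obtain ⟨O₁, hO₁, hxO₁, hO₁U, hO₁s⟩ := exists_isOpen_surjective_mfderiv I hU₀o hGU hxU₀ hGs
  obtain ⟨O₂, hO₂, hO₂o, hxO₂⟩ := eventually_nhds_iff.1 hev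
  have hset : S' ∩ (O₁ ∩ O₂) = {z ∈ O₁ ∩ O₂ | G z = 0} := by
    ext z
    constructor
    · rintro ⟨hz, hzU⟩
      exact ⟨hzU, hS'G z ⟨hz, hO₁U hzU.1⟩⟩
    · rintro ⟨hzU, hz⟩
      exact ⟨hO₂ z hzU.2 hz, hzU⟩
  refine ⟨r, O₁ ∩ O₂, h, hO₁.inter hO₂o, ⟨hxO₁, hxO₂⟩, hhU.mono (fun z hz => hO₁U hz.1), ?_, ?_, ?_⟩
  · ext z
    constructor
    · rintro ⟨hz, hzU⟩
      exact ⟨⟨hsub hz, hzU⟩, congrArg Prod.snd (hS'G z ⟨hz, hO₁U hzU.1⟩)⟩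
    · rintro ⟨⟨hz, hzU⟩, hz0⟩
      refine ⟨hO₂ z hzU.2 (Prod.ext ?_ hz0), hzU⟩
      exact (hz₁.subset ⟨hz, (hO₁U hzU.1).1⟩).2
  · rintro z ⟨hz, hzU⟩ w
    obtain ⟨X, hX⟩ := hO₁s z hzU.1 (0, w)
    rw [hGd z (hO₁U hzU.1)] at hX
    refine ⟨X, ?_, congrArg Prod.snd hX⟩
    rw [mem_tangentTo_iff_mfderiv_eq_zero I hU₁ hg₁ (hO₁U hzU.1).1 hz (hs₁ z (hO₁U hzU.1).1) hz₁]
    exact congrArg Prod.fst hX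
  · rintro z ⟨hz, hzU⟩ X hX hX0
    rw [mem_tangentTo_iff_mfderiv_eq_zero I (hO₁.inter hO₂o)
      (hGU.mono (fun z hz => hO₁U hz.1)) hzU hz (hO₁s z hzU.1) hset, hGd z (hO₁U hzU.1)]
    refine Prod.ext ?_ hX0
    exact (mem_tangentTo_iff_mfderiv_eq_zero I hU₁ hg₁ (hO₁U hzU.1).1 (hsub hz)
      (hs₁ z (hO₁U hzU.1).1) hz₁ X).1 hX

/-- A smooth function whose differential vanishes along a connected submanifold is constant. -/
lemma eqOn_of_dAt_eq_zero {S : Set N} (hS : IsRegularSubmanifold I S) (hc : IsPreconnected S)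
    {h : N → ℝ} (hh : ∀ z ∈ S, ContMDiffAt I 𝓘(ℝ, ℝ) ∞ h z)
    (h0 : ∀ z ∈ S, ∀ X ∈ tangentTo I S z, dAt I h z X = 0) {x y : N} (hx : x ∈ S) (hy : y ∈ S) :
    h x = h y := by
  have : PreconnectedSpace S := isPreconnected_iff_preconnectedSpace.1 hc
  have hloc : IsLocallyConstant (fun z : S => h z) := by
    rw [IsLocallyConstant.iff_eventually_eq]
    rintro ⟨x, hx⟩
    obtain ⟨c, U, g, hU, hxU, hg, hs, hz⟩ := hS x hx
    obtain ⟨K, Ψ, h1, h2, h3, h4, h5⟩ := exists_straightening I hU hg hxU (hs x hxU)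
    set k₀ : K := (Ψ x).2 with hk₀
    have hx0 : g x = 0 := (hz.subset ⟨hx, hxU⟩).2
    have hk : ((0 : Fin c → ℝ), k₀) = Ψ x := Prod.ext (by rw [h5 x h1, hx0]) rfl
    have hc1 : Continuous (fun k : K => ((0 : Fin c → ℝ), k)) := by fun_prop
    obtain ⟨ε, hε, hball⟩ := Metric.mem_nhds_iff.1 (hc1.continuousAt.preimage_mem_nhds
      (t := Ψ.target) (by rw [hk]; exact Ψ.open_target.mem_nhds (Ψ.map_source h1)) :
        _ ∈ 𝓝 k₀)
    -- The slice over this ball parametrizes `S` near `x`. Its velocities are tangent to `S`, so `h`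
    -- has zero derivative on a ball, which is connected.
    have hmem : ∀ k ∈ Metric.ball k₀ ε, Ψ.symm (0, k) ∈ S := by
      intro k hkb
      have h6 := Ψ.map_target (hball hkb)
      refine (hz.symm.subset ⟨h2 h6, ?_⟩).1
      rw [← h5 _ h6, Ψ.right_inv (hball hkb)]
    have hsm : ∀ k ∈ Metric.ball k₀ ε, ContMDiffAt 𝓘(ℝ, K) I ∞ (fun k : K => Ψ.symm (0, k)) k := by
      intro k hkb
      exact (h4.contMDiffAt (Ψ.open_target.mem_nhds (hball hkb))).comp k
        ((contDiff_prodMk_right (0 : Fin c → ℝ)).contMDiff.contMDiffAt)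
    have hder : ∀ k ∈ Metric.ball k₀ ε, fderiv ℝ (fun k : K => h (Ψ.symm (0, k))) k = 0 := by
      intro k hkb
      have h6 := mfderiv_comp k ((hh _ (hmem k hkb)).mdifferentiableAt (by simp))
        ((hsm k hkb).mdifferentiableAt (by simp))
      rw [← mfderiv_eq_fderiv]
      change mfderiv 𝓘(ℝ, K) 𝓘(ℝ, ℝ) (h ∘ fun k : K => Ψ.symm (0, k)) k = 0
      rw [h6]
      ext v
      refine h0 _ (hmem k hkb) _ (mfderiv_mem_tangentTo 𝓘(ℝ, K) I (S := Metric.ball k₀ ε)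
        (hsm k hkb) (eventually_nhdsWithin_of_forall hmem) ?_)
      rw [tangentTo_of_mem_nhds 𝓘(ℝ, K) (Metric.isOpen_ball.mem_nhds hkb)]
      trivial
    have hdiff : DifferentiableOn ℝ (fun k : K => h (Ψ.symm (0, k))) (Metric.ball k₀ ε) := by
      intro k hkb
      exact (((hh _ (hmem k hkb)).comp k (hsm k hkb)).mdifferentiableAt
        (by simp)).differentiableAt.differentiableWithinAt
    have hconst := fun k hkb => Metric.isOpen_ball.is_const_of_fderiv_eq_zero
      (convex_ball k₀ ε).isPreconnected hdiff hder (x := k) (y := k₀) hkb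
      (Metric.mem_ball_self hε)
    have hc3 : ContinuousAt (fun z => (Ψ z).2) x :=
      continuous_snd.continuousAt.comp (Ψ.continuousAt h1)
    have hev : ∀ᶠ z in 𝓝 x, z ∈ Ψ.source ∧ (Ψ z).2 ∈ Metric.ball k₀ ε :=
      (Ψ.open_source.eventually_mem h1).and
        (hc3.eventually_mem (Metric.isOpen_ball.mem_nhds (Metric.mem_ball_self hε)))
    filter_upwards [continuous_subtype_val.continuousAt.eventually hev] with z hz'
    have hzg : g z = 0 := (hz.subset ⟨z.2, h2 hz'.1⟩).2
    have e1 : ((0 : Fin c → ℝ), (Ψ z).2) = Ψ z := Prod.ext (by rw [h5 _ hz'.1, hzg]) rfl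
    have e2 := hconst _ hz'.2
    simp only [e1, hk, Ψ.left_inv hz'.1, Ψ.left_inv h1] at e2
    exact e2
  exact hloc.apply_eq_of_preconnectedSpace ⟨x, hx⟩ ⟨y, hy⟩

end ZeroSets

/-! ### Submersions onto a submanifold: preimages and local sections. -/

section Submersions

variable {V H N : Type*} [NormedAddCommGroup V] [NormedSpace ℝ V] [FiniteDimensional ℝ V]
  [TopologicalSpace H]
  (I : ModelWithCorners ℝ V H) [I.Boundaryless] [TopologicalSpace N] [ChartedSpace H N]
  [IsManifold I ∞ N]
  {V' H' N' : Type*} [NormedAddCommGroup V'] [NormedSpace ℝ V'] [FiniteDimensional ℝ V']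
  [TopologicalSpace H']
  (I' : ModelWithCorners ℝ V' H') [I'.Boundaryless] [TopologicalSpace N'] [ChartedSpace H' N']
  [IsManifold I' ∞ N']
  {f : N → N'} {T : Set N'}

lemma IsSubmersionBetween.contMDiff (hf : IsSubmersionBetween I I' f univ T) :
    ContMDiff I I' ∞ f := fun x => hf.2.1 x trivial

lemma IsSubmersionBetween.mem_tangentTo_iff (hf : IsSubmersionBetween I I' f univ T) (x : N)
    (W : TangentSpace I' (f x)) : W ∈ tangentTo I' T (f x) ↔ ∃ X, mfderiv I I' f x X = W := by
  rw [← hf.2.2 x trivial, tangentTo_of_mem_nhds I univ_mem]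
  simp only [Submodule.map_top]
  exact Iff.rfl

/-- The tangent space of the preimage of a submanifold under a submersion. -/
lemma mem_tangentTo_preimage_iff (hf : IsSubmersionBetween I I' f univ T)
    (hT : IsRegularSubmanifold I' T) {Q : Set N'} (hQ : IsRegularSubmanifold I' Q) (hQT : Q ⊆ T)
    {y : N} (hy : f y ∈ Q) (X : TangentSpace I y) :
    X ∈ tangentTo I (f ⁻¹' Q) y ↔ mfderiv I I' f y X ∈ tangentTo I' Q (f y) := by
  have hfs := hf.contMDiff
  constructor
  · exact mfderiv_mem_tangentTo I I' (hfs y) (eventually_nhdsWithin_of_forall fun z hz => hz)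
  -- The image of `f` stays in `T`, so the defining functions of `Q` must be independent on the
  -- tangent spaces of `T` for their composites with `f` to be a submersion.
  obtain ⟨r, U, h, hU, hyU, hh, hQU, hs, hk⟩ := exists_independent_functions I' hT hQ hQT hy
  intro hX
  have hfU : IsOpen (f ⁻¹' U) := hU.preimage hfs.continuous
  have hcomp : ContMDiffOn I 𝓘(ℝ, Fin r → ℝ) ∞ (h ∘ f) (f ⁻¹' U) :=
    hh.comp hfs.contMDiffOn (fun z hz => hz)
  have hd : ∀ X, mfderiv I 𝓘(ℝ, Fin r → ℝ) (h ∘ f) y X =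
      mfderiv I' 𝓘(ℝ, Fin r → ℝ) h (f y) (mfderiv I I' f y X) := by
    intro X
    rw [mfderiv_comp y ((hh.contMDiffAt (hU.mem_nhds hyU)).mdifferentiableAt (by simp))
      ((hfs y).mdifferentiableAt (by simp))]
    rfl
  refine (mem_tangentTo_iff_mfderiv_eq_zero I (S := f ⁻¹' Q) hfU hcomp hyU hy ?_ ?_ X).2 ?_
  · intro w
    obtain ⟨W, hW, hw⟩ := hs (f y) ⟨hQT hy, hyU⟩ w
    obtain ⟨X, rfl⟩ := (hf.mem_tangentTo_iff I I' y W).1 hW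
    exact ⟨X, (hd X).trans hw⟩
  · ext z
    constructor
    · rintro ⟨hz, hzU⟩
      exact ⟨hzU, (hQU.subset ⟨hz, hzU⟩).2⟩
    · rintro ⟨hzU, hz⟩
      exact ⟨(hQU.symm.subset ⟨⟨hf.1 trivial, hzU⟩, hz⟩).1, hzU⟩
  · refine (hd X).trans ?_
    refine mfderiv_eq_zero_of_mem_tangentTo I' (hh.contMDiffAt (hU.mem_nhds hyU)) ?_ hX
    filter_upwards [self_mem_nhdsWithin, nhdsWithin_le_nhds (hU.mem_nhds hyU)] with z hz hzU
    exact (hQU.subset ⟨hz, hzU⟩).2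

/-- A submersion onto a submanifold has smooth local sections through each point. -/
lemma exists_local_section (hf : IsSubmersionBetween I I' f univ T)
    (hT : IsRegularSubmanifold I' T) (y : N) :
    ∃ (O : Set N') (σ : N' → N), IsOpen O ∧ f y ∈ O ∧ ContMDiffOn I' I ∞ σ O ∧ σ (f y) = y ∧
      ∀ q ∈ T ∩ O, f (σ q) = q := by
  have hfs := hf.contMDiff
  have hfy : f y ∈ T := hf.1 trivial
  obtain ⟨c, U, g, hU, hyU, hg, hs, hz⟩ := hT (f y) hfy
  obtain ⟨K, Ψ, h1, h2, h3, h4, h5⟩ := exists_straightening I' hU hg hyU (hs _ hyU)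
  have hd := mdifferentiable_of_contMDiffOn I' h3 h4
  -- The coordinate of `f z` along `T`. It is a submersion at `y`; straightening it by `Ξ` gives the
  -- section, which keeps the remaining coordinate at its value at `y`.
  set u : N → K := fun z => (Ψ (f z)).2 with hu
  set U₀ : Set N := f ⁻¹' Ψ.source with hU₀
  have hU₀o : IsOpen U₀ := Ψ.open_source.preimage hfs.continuous
  have hΨf : ContMDiffOn I 𝓘(ℝ, (Fin c → ℝ) × K) ∞ (Ψ ∘ f) U₀ :=
    h3.comp hfs.contMDiffOn (fun z hz => hz)
  have hus : ContMDiffOn I 𝓘(ℝ, K) ∞ u U₀ :=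
    (ContinuousLinearMap.snd ℝ (Fin c → ℝ) K).contMDiff.comp_contMDiffOn hΨf
  have husurj : Surjective (mfderiv I 𝓘(ℝ, K) u y) := by
    intro k
    obtain ⟨W, hW⟩ := hd.mfderiv_surjective h1 ((0 : Fin c → ℝ), k)
    have hWT : W ∈ tangentTo I' T (f y) :=
      (mem_tangentTo_iff_mfderiv_eq_zero I' hU hg hyU hfy (hs _ hyU) hz W).2
        (by rw [mfderiv_fst_straightening I' h3 h5 h1, hW]; rfl)
    obtain ⟨X, rfl⟩ := (hf.mem_tangentTo_iff I I' y W).1 hWT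
    refine ⟨X, ?_⟩
    have e1 := mfderiv_clm_comp I ((hΨf.contMDiffAt (hU₀o.mem_nhds h1)).mdifferentiableAt
      (by simp)) (ContinuousLinearMap.snd ℝ (Fin c → ℝ) K) X
    refine e1.trans ?_
    rw [mfderiv_comp y (hd.mdifferentiableAt h1) ((hfs y).mdifferentiableAt (by simp))]
    exact congrArg Prod.snd hW
  obtain ⟨L, Ξ, j1, j2, j3, j4, j5⟩ := exists_straightening I hU₀o hus h1 husurj
  set s : N' → K × L := fun q => ((Ψ q).2, (Ξ y).2) with hsdef
  have hsc : ContMDiffOn I' 𝓘(ℝ, K × L) ∞ s Ψ.source := by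
    have : ContDiff ℝ ∞ (fun p : (Fin c → ℝ) × K => (p.2, (Ξ y).2)) := by fun_prop
    exact this.contMDiff.comp_contMDiffOn h3
  have hsy : s (f y) = Ξ y := Prod.ext (j5 y j1).symm rfl
  set O : Set N' := Ψ.source ∩ s ⁻¹' Ξ.target with hO
  have hOo : IsOpen O := hsc.continuousOn.isOpen_inter_preimage Ψ.open_source Ξ.open_target
  refine ⟨O, fun q => Ξ.symm (s q), hOo, ⟨h1, ?_⟩, ?_, ?_, ?_⟩
  · rw [mem_preimage, hsy]; exact Ξ.map_source j1
  · exact j4.comp (hsc.mono inter_subset_left) (fun q hq => hq.2)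
  · simp only [hsy]; exact Ξ.left_inv j1
  · rintro q ⟨hqT, hq1, hq2⟩
    have k1 : Ξ.symm (s q) ∈ Ξ.source := Ξ.map_target hq2
    have k2 : f (Ξ.symm (s q)) ∈ Ψ.source := j2 k1
    -- Both points lie in `T`, where the first `Ψ`-coordinate is zero, so the second one decides.
    refine Ψ.injOn k2 hq1 (Prod.ext ?_ ?_)
    · rw [h5 _ k2, h5 _ hq1, (hz.subset ⟨hqT, h2 hq1⟩).2]
      exact (hz.subset ⟨hf.1 trivial, h2 k2⟩).2
    · change u (Ξ.symm (s q)) = (Ψ q).2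
      rw [← j5 _ k1, Ξ.right_inv hq2]

end Submersions

/-! ### Generalized inverses of linear maps in families of constant rank. -/

section GeneralizedInverse

variable {V₁ V₂ : Type*} [NormedAddCommGroup V₁] [NormedSpace ℝ V₁] [FiniteDimensional ℝ V₁]
  [NormedAddCommGroup V₂] [NormedSpace ℝ V₂] [FiniteDimensional ℝ V₂]

/-- `R` projects onto the range of `A` and then chooses preimages linearly. -/
lemma exists_generalizedInverse (A : V₁ →L[ℝ] V₂) : ∃ R : V₂ →L[ℝ] V₁, ∀ v, A (R (A v)) = A v := by
  obtain ⟨s, hs⟩ := LinearMap.exists_rightInverse_of_surjective A.toLinearMap.rangeRestrict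
    (LinearMap.range_rangeRestrict _)
  obtain ⟨P, hP⟩ := LinearMap.exists_leftInverse_of_injective
    (LinearMap.range A.toLinearMap).subtype (by simp)
  refine ⟨LinearMap.toContinuousLinearMap (s ∘ₗ P), fun v => ?_⟩
  have h1 := congrArg (fun g => g ⟨A v, v, rfl⟩) hP
  have h2 := congrArg (fun g => ((g ⟨A v, v, rfl⟩ : LinearMap.range A.toLinearMap) : V₂)) hs
  have h3 : P (A v) = ⟨A v, v, rfl⟩ := h1
  change A (s (P (A v))) = A v
  rw [h3]
  exact h2

variable {V H N : Type*} [NormedAddCommGroup V] [NormedSpace ℝ V]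
  [TopologicalSpace H] (I : ModelWithCorners ℝ V H) [TopologicalSpace N] [ChartedSpace H N]

/-- A smooth family of linear maps has, where its rank is constant, a smooth family of generalized
inverses. -/
lemma exists_smooth_generalizedInverse {A : N → (V₁ →L[ℝ] V₂)} {O : Set N} {p : N} (hp : p ∈ O)
    (hA : ContMDiffOn I 𝓘(ℝ, V₁ →L[ℝ] V₂) ∞ A O) :
    ∃ (B : N → (V₂ →L[ℝ] V₁)) (U : Set N), IsOpen U ∧ p ∈ U ∧
      ContMDiffOn I 𝓘(ℝ, V₂ →L[ℝ] V₁) ∞ B (O ∩ U) ∧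
      ∀ q ∈ O ∩ U, Module.finrank ℝ (LinearMap.ker (A q).toLinearMap) =
        Module.finrank ℝ (LinearMap.ker (A p).toLinearMap) → ∀ v, A q (B q (A q v)) = A q v := by
  obtain ⟨R, hR⟩ := exists_generalizedInverse (A p)
  -- `T p` is the identity, so `T q` is invertible near `p`. The generalized inverse of `A q` will
  -- be `R` followed by the inverse of `T q`.
  set T : N → (V₁ →L[ℝ] V₁) := fun q => ContinuousLinearMap.id ℝ V₁ + R.comp (A q - A p) with hT
  have hTs : ContMDiffOn I 𝓘(ℝ, V₁ →L[ℝ] V₁) ∞ T O := by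
    have h1 : ContDiff ℝ ∞ (fun C : V₁ →L[ℝ] V₂ =>
        ContinuousLinearMap.id ℝ V₁ + R.comp (C - A p)) := by fun_prop
    exact h1.contMDiff.comp_contMDiffOn hA
  have hTp : T p = ((ContinuousLinearEquiv.refl ℝ V₁ : V₁ ≃L[ℝ] V₁) : V₁ →L[ℝ] V₁) := by
    ext v; simp [hT]
  have hmem : range ((↑) : (V₁ ≃L[ℝ] V₁) → V₁ →L[ℝ] V₁) ∈ 𝓝 (T p) :=
    ContinuousLinearEquiv.isOpen.mem_nhds ⟨_, hTp.symm⟩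
  obtain ⟨U, hU, hpU, hUT⟩ := mem_nhdsWithin.1 ((hTs.continuousOn p hp).preimage_mem_nhdsWithin hmem)
  refine ⟨fun q => (ContinuousLinearMap.inverse (T q)).comp R, U, hU, hpU, ?_, ?_⟩
  · have h1 : ContMDiffOn I 𝓘(ℝ, V₁ →L[ℝ] V₁) ∞ (fun q => ContinuousLinearMap.inverse (T q))
        (O ∩ U) := by
      intro q hq
      obtain ⟨e, he⟩ := hUT ⟨hq.2, hq.1⟩
      have h2 : ContDiffAt ℝ ∞ ContinuousLinearMap.inverse (T q) := by
        rw [← he]; exact contDiffAt_map_inverse e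
      exact h2.contMDiffAt.comp_contMDiffWithinAt q ((hTs q hq.1).mono inter_subset_left)
    have h3 : ContDiff ℝ ∞ (fun C : V₁ →L[ℝ] V₁ => C.comp R) := by fun_prop
    exact h3.contMDiff.comp_contMDiffOn h1
  · rintro q ⟨hqO, hqU⟩ hker v
    obtain ⟨e, he⟩ := hUT ⟨hqU, hqO⟩
    have hev : ∀ v, e v = v + R (A q v - A p v) := fun v => congrArg (fun g => g v) he
    -- For `w` in the kernel of `A q` one has `T q w = w - R (A p w)`, which `A p` kills. By
    -- equality of dimensions `T q` then maps one kernel onto the other.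
    have hle : (LinearMap.ker (A q).toLinearMap).map e.toLinearEquiv.toLinearMap ≤
        LinearMap.ker (A p).toLinearMap := by
      rintro _ ⟨w, hw, rfl⟩
      have hw' : A q w = 0 := hw
      change A p (e w) = 0
      rw [hev, hw', zero_sub, map_neg, map_add, map_neg, hR, add_neg_cancel]
    have heq := Submodule.eq_of_le_of_finrank_eq hle (by
      rw [← hker]
      exact LinearEquiv.finrank_map_eq e.toLinearEquiv _)
    have hinv : ContinuousLinearMap.inverse (T q) = e.symm := by
      rw [← he]; exact ContinuousLinearMap.inverse_equiv e
    -- Here `T q w = v - R (A p v)` lies in the kernel of `A p`, so `w` lies in that of `A q`; this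
    -- is the claim.
    set w := v - e.symm (R (A q v)) with hw
    have h1 : e w ∈ LinearMap.ker (A p).toLinearMap := by
      change A p (e w) = 0
      rw [hw, map_sub, e.apply_symm_apply, hev, map_sub, map_add, map_sub, map_sub, hR]
      abel
    rw [← heq] at h1
    obtain ⟨w', hw', hww⟩ := h1
    have h2 : w' = w := e.injective hww
    have h3 : A q w = 0 := by rw [← h2]; exact hw'
    change A q (ContinuousLinearMap.inverse (T q) (R (A q v))) = A q v
    rw [hinv]
    rw [hw, map_sub, sub_eq_zero] at h3
    exact h3.symm

end GeneralizedInverse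

/-! ### Components of tangent vectors in a fixed chart. -/

section Coordinates

variable {V H N : Type*} [NormedAddCommGroup V] [NormedSpace ℝ V] [FiniteDimensional ℝ V]
  [TopologicalSpace H]
  (I : ModelWithCorners ℝ V H) [I.Boundaryless] [TopologicalSpace N] [ChartedSpace H N]
  [IsManifold I ∞ N]
  {V' H' N' : Type*} [NormedAddCommGroup V'] [NormedSpace ℝ V'] [FiniteDimensional ℝ V']
  [TopologicalSpace H']
  (I' : ModelWithCorners ℝ V' H') [I'.Boundaryless] [TopologicalSpace N'] [ChartedSpace H' N']
  [IsManifold I' ∞ N']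
  {F : Type*} [NormedAddCommGroup F] [NormedSpace ℝ F]

/-- The components of tangent vectors at `q` in the chart at `p`. -/
def toCoord (p q : N) : TangentSpace I q →L[ℝ] V :=
  (trivializationAt V (TangentSpace I : N → Type _) p).continuousLinearMapAt ℝ q

/-- The tangent vector at `q` with given components in the chart at `p`. -/
def fromCoord (p q : N) : V →L[ℝ] TangentSpace I q :=
  (trivializationAt V (TangentSpace I : N → Type _) p).symmL ℝ q

variable {I}

lemma toCoord_fromCoord {p q : N} (hq : q ∈ (chartAt H p).source) (w : V) :
    toCoord I p q (fromCoord I p q w) = w :=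
  (trivializationAt V (TangentSpace I : N → Type _) p).continuousLinearMapAt_symmL (R := ℝ) hq w

lemma fromCoord_toCoord {p q : N} (hq : q ∈ (chartAt H p).source) (w : TangentSpace I q) :
    fromCoord I p q (toCoord I p q w) = w :=
  (trivializationAt V (TangentSpace I : N → Type _) p).symmL_continuousLinearMapAt (R := ℝ) hq w

lemma fromCoord_eq_mfderiv {p q : N} (hq : q ∈ (chartAt H p).source) :
    fromCoord I p q = mfderiv 𝓘(ℝ, V) I (extChartAt I p).symm (extChartAt I p q) := by
  rw [fromCoord, TangentBundle.symmL_trivializationAt hq, I.range_eq_univ, mfderivWithin_univ]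

lemma contMDiffOn_iff_toCoord {Z : N' → TangentBundle I N} {s : Set N'} (p : N)
    (hs : ∀ z ∈ s, (Z z).proj ∈ (chartAt H p).source) :
    ContMDiffOn I' I.tangent ∞ Z s ↔ ContMDiffOn I' I ∞ (fun z => (Z z).proj) s ∧
      ContMDiffOn I' 𝓘(ℝ, V) ∞ (fun z => toCoord I p (Z z).proj (Z z).2) s := by
  rw [(trivializationAt V (TangentSpace I : N → Type _) p).contMDiffOn_iff (IB := I) (n := ∞)]
  · refine and_congr_right fun _ => contMDiffOn_congr fun z hz => ?_
    rw [toCoord, Trivialization.continuousLinearMapAt_apply,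
      Trivialization.coe_linearMapAt_of_mem]
    exact hs z hz
  · intro z hz
    rw [Trivialization.mem_source]
    exact hs z hz

lemma contMDiffOn_section_iff_toCoord {Z : ∀ q : N, TangentSpace I q} {s : Set N} (p : N)
    (hs : s ⊆ (chartAt H p).source) :
    ContMDiffOn I I.tangent ∞ (fun q => (⟨q, Z q⟩ : TangentBundle I N)) s ↔
      ContMDiffOn I 𝓘(ℝ, V) ∞ (fun q => toCoord I p q (Z q)) s := by
  exact (contMDiffOn_iff_toCoord I p (Z := fun q => ⟨q, Z q⟩) hs).trans
    (and_iff_right contMDiffOn_id)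

lemma contMDiffOn_fromCoord {w : N → V} {s : Set N} (p : N)
    (hs : s ⊆ (chartAt H p).source) (hw : ContMDiffOn I 𝓘(ℝ, V) ∞ w s) :
    ContMDiffOn I I.tangent ∞ (fun q => (⟨q, fromCoord I p q (w q)⟩ : TangentBundle I N)) s := by
  rw [contMDiffOn_section_iff_toCoord p hs]
  exact hw.congr fun q hq => toCoord_fromCoord (hs hq) _

omit [I.Boundaryless] [FiniteDimensional ℝ V] [FiniteDimensional ℝ V'] [I'.Boundaryless] in
lemma contMDiffOn_tangentMap {f : N → N'} {U : Set N} (hU : IsOpen U)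
    (hf : ContMDiffOn I I' ∞ f U) :
    ContMDiffOn I.tangent I'.tangent ∞ (tangentMap I I' f) (TotalSpace.proj ⁻¹' U) := by
  refine (hf.contMDiffOn_tangentMapWithin (m := ∞) (by simp) hU.uniqueMDiffOn).congr ?_
  intro v hv
  exact (tangentMapWithin_eq_tangentMap (hU.uniqueMDiffOn _ hv)
    ((hf.contMDiffAt (hU.mem_nhds hv)).mdifferentiableAt (by simp))).symm

-- Over a finite-dimensional space a family of linear maps is a sum of constant linear expressions
-- in its values at a basis.
omit [I.Boundaryless] [FiniteDimensional ℝ V] [IsManifold I ∞ N] in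
lemma contMDiffOn_clm_of_apply {W : Type*} [NormedAddCommGroup W] [NormedSpace ℝ W]
    [FiniteDimensional ℝ W] {A : N → (W →L[ℝ] F)} {s : Set N}
    (h : ∀ w, ContMDiffOn I 𝓘(ℝ, F) ∞ (fun q => A q w) s) :
    ContMDiffOn I 𝓘(ℝ, W →L[ℝ] F) ∞ A s := by
  let b := Module.finBasis ℝ W
  let φ : Fin (Module.finrank ℝ W) → (F →L[ℝ] (W →L[ℝ] F)) := fun i =>
    ContinuousLinearMap.smulRightL ℝ W F (LinearMap.toContinuousLinearMap (b.coord i))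
  have h1 : A = fun q => ∑ i, φ i (A q (b i)) := by
    funext q
    ext w
    have h2 := congrArg (A q) (b.sum_repr w)
    simp only [map_sum, map_smul] at h2
    simp [φ, ← h2]
  rw [h1]
  exact contMDiffOn_finsetSum fun i _ => (φ i).contMDiff.comp_contMDiffOn (h _)

/-- In coordinates, the differential of a smooth map to a vector space is smooth. -/
lemma contMDiffOn_mfderiv_fromCoord {g : N → F} {U : Set N} (hU : IsOpen U)
    (hg : ContMDiffOn I 𝓘(ℝ, F) ∞ g U) (p : N) :
    ContMDiffOn I 𝓘(ℝ, V →L[ℝ] F) ∞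
      (fun q => (show V →L[ℝ] F from (mfderiv I 𝓘(ℝ, F) g q).comp (fromCoord I p q)))
      (U ∩ (chartAt H p).source) := by
  refine contMDiffOn_clm_of_apply fun w => ?_
  have h1 := contMDiffOn_fromCoord (w := fun _ => w) p (inter_subset_right (s := U))
    (I := I) contMDiffOn_const
  have h2 := (contMDiffOn_tangentMap 𝓘(ℝ, F) hU hg).comp h1 (fun q hq => hq.1)
  intro q hq
  have h3 := (Bundle.contMDiffWithinAt_totalSpace.1 (h2 q hq)).2
  refine h3.congr_of_eventuallyEq_of_mem ?_ hq
  refine Eventually.of_forall fun z => ?_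
  simp [tangentMap]
  rfl

/-- In coordinates, the differential of a smooth map is smooth. -/
lemma contMDiffOn_toCoord_mfderiv_fromCoord {f : N → N'} {U : Set N} (hU : IsOpen U)
    (hf : ContMDiffOn I I' ∞ f U) (p : N) (p' : N')
    (hfU : ∀ z ∈ U, f z ∈ (chartAt H' p').source) :
    ContMDiffOn I 𝓘(ℝ, V →L[ℝ] V') ∞
      (fun q => (toCoord I' p' (f q)).comp ((mfderiv I I' f q).comp (fromCoord I p q)))
      (U ∩ (chartAt H p).source) := by
  refine contMDiffOn_clm_of_apply fun w => ?_
  have h1 := contMDiffOn_fromCoord (w := fun _ => w) p (inter_subset_right (s := U))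
    (I := I) contMDiffOn_const
  have h2 := (contMDiffOn_tangentMap I' hU hf).comp h1 (fun q hq => hq.1)
  exact ((contMDiffOn_iff_toCoord I p' (fun z hz => hfU z hz.1)).1 h2).2

end Coordinates

/-! ### Naturality of the exterior derivative. -/

section ExteriorDerivative

variable {V H N : Type*} [NormedAddCommGroup V] [NormedSpace ℝ V] [FiniteDimensional ℝ V]
  [TopologicalSpace H]
  (I : ModelWithCorners ℝ V H) [I.Boundaryless] [TopologicalSpace N] [ChartedSpace H N]
  {V' H' N' : Type*} [NormedAddCommGroup V'] [NormedSpace ℝ V'] [FiniteDimensional ℝ V']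
  [TopologicalSpace H']
  (I' : ModelWithCorners ℝ V' H') [I'.Boundaryless] [TopologicalSpace N'] [ChartedSpace H' N']

/-- The expression of a 1-form in the chart at `x`. -/
def chartForm (θ : ∀ x : N, TangentSpace I x →L[ℝ] ℝ) (x : N) : V → (V →L[ℝ] ℝ) := fun v =>
  (θ ((extChartAt I x).symm v)).comp (mfderiv 𝓘(ℝ, V) I (extChartAt I x).symm v)

omit [FiniteDimensional ℝ V] [I.Boundaryless] in
lemma extDer_apply (θ : ∀ x : N, TangentSpace I x →L[ℝ] ℝ) (x : N) (X Y : TangentSpace I x) :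
    extDer I θ x X Y = fderiv ℝ (chartForm I θ x) (extChartAt I x x) X Y -
      fderiv ℝ (chartForm I θ x) (extChartAt I x x) Y X := rfl

omit [FiniteDimensional ℝ V] [I.Boundaryless] in
lemma extDer_swap (θ : ∀ x : N, TangentSpace I x →L[ℝ] ℝ) (x : N) (X Y : TangentSpace I x) :
    extDer I θ x X Y = -extDer I θ x Y X := by rw [extDer_apply, extDer_apply]; exact (neg_sub _ _).symm

-- All tangent spaces are the model space `V`, so an equality of base points can be used without
-- transporting the vector.
omit [FiniteDimensional ℝ V] [I.Boundaryless] in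
lemma form_apply_congr (θ : ∀ x : N, TangentSpace I x →L[ℝ] ℝ) {x y : N} (h : x = y) (w : V) :
    (θ x : V →L[ℝ] ℝ) w = (θ y : V →L[ℝ] ℝ) w := by subst h; rfl

variable {I}

/-- The exterior derivative commutes with pullbacks. -/
lemma extDer_pullback [IsManifold I ∞ N] [IsManifold I' ∞ N'] {f : N → N'} {x : N} (hf : ContMDiffAt I I' 2 f x)
    {θ : ∀ x : N, TangentSpace I x →L[ℝ] ℝ} {θ' : ∀ x : N', TangentSpace I' x →L[ℝ] ℝ}
    (hθ : ∀ᶠ z in 𝓝 x, θ z = (θ' (f z)).comp (mfderiv I I' f z))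
    (hd : DifferentiableAt ℝ (chartForm I' θ' (f x)) (extChartAt I' (f x) (f x)))
    (X Y : TangentSpace I x) :
    extDer I θ x X Y = extDer I' θ' (f x) (mfderiv I I' f x X) (mfderiv I I' f x Y) := by
  set e := extHomeo I x with he
  set e' := extHomeo I' (f x) with he'
  have hxe : x ∈ e.source := by simp [he]
  have hxe' : f x ∈ e'.source := by simp [he']
  set u : V → V' := fun v => e' (f (e.symm v)) with hu
  set v₀ := e x with hv₀
  have hv₀t : v₀ ∈ e.target := e.map_source hxe
  have hsx : e.symm v₀ = x := e.left_inv hxe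
  have hu₀ : u v₀ = e' (f x) := by simp only [hu, hsx]
  have huc : ContDiffAt ℝ 2 u v₀ := by
    have := ((contMDiffAt_iff_of_mem_source (mem_chart_source H x) (mem_chart_source H' (f x))).1 hf).2
    rw [I.range_eq_univ, contDiffWithinAt_univ] at this
    exact this
  have hdu : mfderiv I I' f x = fderiv ℝ u v₀ := by
    refine (hf.mdifferentiableAt (by simp)).mfderiv.trans ?_
    rw [I.range_eq_univ, fderivWithin_univ]
    rfl
  -- In charts, `θ` is the pullback of `θ'` by the coordinate expression `u` of `f`.
  have hloc : chartForm I θ x =ᶠ[𝓝 v₀]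
      fun v => (chartForm I' θ' (f x) (u v)).comp (fderiv ℝ u v) := by
    have hesym : ContinuousAt e.symm v₀ := e.continuousAt_symm hv₀t
    have hm1 : ∀ᶠ z in 𝓝 x, ContMDiffAt I I' 2 f z := (contMDiffAt_iff_contMDiffAt_nhds (by simp)).1 hf
    have hm2 : ∀ᶠ z in 𝓝 x, f z ∈ e'.source :=
      hf.continuousAt.eventually_mem (e'.open_source.mem_nhds hxe')
    rw [ContinuousAt, hsx] at hesym
    filter_upwards [e.open_target.mem_nhds hv₀t, hesym.eventually hθ, hesym.eventually hm1,
      hesym.eventually hm2, huc.eventually (by simp)] with v h1 h2 h3 h4 h5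
    have hsd : MDifferentiableAt 𝓘(ℝ, V) I e.symm v :=
      ((contMDiffOn_extChartAt_symm (I := I) (n := ∞) x).contMDiffAt
        ((extHomeo_target I x ▸ e.open_target).mem_nhds (by rwa [← extHomeo_target]))
        ).mdifferentiableAt (by simp)
    have hfd := h3.mdifferentiableAt (by simp)
    have hes : MDifferentiableAt 𝓘(ℝ, V') I' e'.symm (u v) :=
      ((contMDiffOn_extChartAt_symm (I := I') (n := ∞) (f x)).contMDiffAt
        ((extHomeo_target I' (f x) ▸ e'.open_target).mem_nhds
          (by rw [← extHomeo_target]; exact e'.map_source h4))).mdifferentiableAt (by simp)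
    have hud := (h5.differentiableAt (by simp)).hasFDerivAt.hasMFDerivAt
    have hc1 := hfd.hasMFDerivAt.comp v hsd.hasMFDerivAt
    have hc2 := hes.hasMFDerivAt.comp v hud
    have hc3 : (f ∘ e.symm) =ᶠ[𝓝 v] e'.symm ∘ u := by
      have h6 := hfd.continuousAt.comp (e.continuousAt_symm h1)
      filter_upwards [h6.eventually_mem (e'.open_source.mem_nhds h4)] with v' hv'
      exact (e'.left_inv hv').symm
    have hc4 : mfderiv 𝓘(ℝ, V) I' (f ∘ e.symm) v = mfderiv 𝓘(ℝ, V) I' (e'.symm ∘ u) v :=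
      hc3.mfderiv_eq
    rw [hc1.mfderiv, hc2.mfderiv] at hc4
    ext w
    have hc5 : mfderiv I I' f (e.symm v) (mfderiv 𝓘(ℝ, V) I e.symm v w) =
      mfderiv 𝓘(ℝ, V') I' e'.symm (u v) (fderiv ℝ u v w) := congrArg (fun g => g w) hc4
    have hc6 : e'.symm (u v) = f (e.symm v) := e'.left_inv h4
    change (θ (e.symm v)) (mfderiv 𝓘(ℝ, V) I e.symm v w) =
      (θ' (e'.symm (u v))) (mfderiv 𝓘(ℝ, V') I' e'.symm (u v) (fderiv ℝ u v w))
    rw [h2]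
    refine (congrArg (θ' (f (e.symm v))) hc5).trans ?_
    exact form_apply_congr I' θ' hc6.symm _
  have hd' : HasFDerivAt (fun v => chartForm I' θ' (f x) (u v))
      ((fderiv ℝ (chartForm I' θ' (f x)) (e' (f x))).comp (fderiv ℝ u v₀)) v₀ := by
    have : HasFDerivAt (chartForm I' θ' (f x)) (fderiv ℝ (chartForm I' θ' (f x)) (e' (f x))) (u v₀) := by
      rw [hu₀]; exact hd.hasFDerivAt
    exact this.comp v₀ (huc.differentiableAt (by simp)).hasFDerivAt
  have hdd : HasFDerivAt (fderiv ℝ u) (fderiv ℝ (fderiv ℝ u) v₀) v₀ :=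
    ((huc.fderiv_right (m := 1) (by norm_num)).differentiableAt (by simp)).hasFDerivAt
  have hfin := (hd'.clm_comp hdd).congr_of_eventuallyEq hloc
  -- Differentiating the pullback produces a term with the second derivative of `u`; being
  -- symmetric, it cancels in the antisymmetrization.
  have hsymm := (huc.isSymmSndFDerivAt (by simp))
  have key : ∀ X Y : V, fderiv ℝ (chartForm I θ x) v₀ X Y - fderiv ℝ (chartForm I θ x) v₀ Y X =
      fderiv ℝ (chartForm I' θ' (f x)) (e' (f x)) (fderiv ℝ u v₀ X) (fderiv ℝ u v₀ Y) -
      fderiv ℝ (chartForm I' θ' (f x)) (e' (f x)) (fderiv ℝ u v₀ Y) (fderiv ℝ u v₀ X) := by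
    intro X Y
    rw [hfin.fderiv]
    simp only [add_apply, ContinuousLinearMap.comp_apply, ContinuousLinearMap.compL_apply,
      ContinuousLinearMap.flip_apply, hsymm X Y]
    ring
  rw [extDer_apply, extDer_apply, hdu]
  exact key X Y

end ExteriorDerivative

/-! ### Smooth forms and smoothness of their exterior derivatives. -/

section SmoothForms

variable {V H N : Type*} [NormedAddCommGroup V] [NormedSpace ℝ V] [FiniteDimensional ℝ V]
  [TopologicalSpace H]
  {I : ModelWithCorners ℝ V H} [I.Boundaryless] [TopologicalSpace N] [ChartedSpace H N]
  [IsManifold I ∞ N]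

variable (I) in
/-- A 1-form is smooth if it is smooth as a function on the tangent bundle. -/
def IsSmoothForm (θ : ∀ x : N, TangentSpace I x →L[ℝ] ℝ) : Prop :=
  ContMDiff I.tangent 𝓘(ℝ, ℝ) ∞ (fun v : TangentBundle I N => θ v.proj v.2)

variable (I) in
/-- A bilinear form on the tangent bundle is smooth if its matrix in every chart is. -/
def IsSmoothTwoForm (Ω : ∀ x : N, TangentSpace I x →L[ℝ] TangentSpace I x →L[ℝ] ℝ) : Prop :=
  ∀ p : N, ∃ A : N → (V →L[ℝ] V →L[ℝ] ℝ),
    ContMDiffOn I 𝓘(ℝ, V →L[ℝ] V →L[ℝ] ℝ) ∞ A (chartAt H p).source ∧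
    ∀ q ∈ (chartAt H p).source, ∀ v w, A q v w = Ω q (fromCoord I p q v) (fromCoord I p q w)

variable {θ : ∀ x : N, TangentSpace I x →L[ℝ] ℝ}

lemma IsSmoothForm.contMDiffOn_coord (hθ : IsSmoothForm I θ) (p : N) :
    ContMDiffOn I 𝓘(ℝ, V →L[ℝ] ℝ) ∞
      (fun q => (show V →L[ℝ] ℝ from (θ q).comp (fromCoord I p q))) (chartAt H p).source := by
  refine contMDiffOn_clm_of_apply fun w => ?_
  exact hθ.comp_contMDiffOn (contMDiffOn_fromCoord (w := fun _ => w) p subset_rfl contMDiffOn_const)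

lemma IsSmoothForm.contDiffOn_chartForm (hθ : IsSmoothForm I θ) (x : N) :
    ContDiffOn ℝ ∞ (chartForm I θ x) (extChartAt I x).target := by
  rw [contDiffOn_clm_apply]
  intro w
  rw [← contMDiffOn_iff_contDiffOn]
  have h1 : ContMDiff 𝓘(ℝ, V) 𝓘(ℝ, V).tangent ∞
      (fun v : V => (⟨v, w⟩ : TangentBundle 𝓘(ℝ, V) V)) := fun v =>
    contMDiffWithinAt_vectorSpace_iff_contDiffWithinAt.2 contDiffWithinAt_const
  have h2 := contMDiffOn_tangentMap I (extHomeo_target I x ▸ (extHomeo I x).open_target)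
    (contMDiffOn_extChartAt_symm (I := I) (n := ∞) x)
  exact hθ.comp_contMDiffOn (h2.comp h1.contMDiffOn fun v hv => hv)

lemma chartForm_model (θ : ∀ v : V, TangentSpace 𝓘(ℝ, V) v →L[ℝ] ℝ) (x : V) :
    chartForm 𝓘(ℝ, V) θ x = θ := by
  funext v
  ext w
  have h : ((extChartAt 𝓘(ℝ, V) x).symm : V → V) = id := by
    rw [extChartAt_model_space_eq_id]; rfl
  change (θ ((extChartAt 𝓘(ℝ, V) x).symm v)) (mfderiv 𝓘(ℝ, V) 𝓘(ℝ, V)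
    (extChartAt 𝓘(ℝ, V) x).symm v w) = _
  rw [h, mfderiv_id]
  rfl

/-- `extDer` at a point uses the chart centred there, whereas smoothness requires one fixed chart.
The inverse of the chart at `p` is a smooth map, and naturality under it makes the change. -/
lemma IsSmoothForm.extDer_symm (hθ : IsSmoothForm I θ) (p : N) {v : V}
    (hv : v ∈ (extChartAt I p).target) (w w' : V) :
    extDer I θ ((extChartAt I p).symm v) (mfderiv 𝓘(ℝ, V) I (extChartAt I p).symm v w)
      (mfderiv 𝓘(ℝ, V) I (extChartAt I p).symm v w') =
      fderiv ℝ (chartForm I θ p) v w w' - fderiv ℝ (chartForm I θ p) v w' w := by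
  have hop : IsOpen (extChartAt I p).target := extHomeo_target I p ▸ (extHomeo I p).open_target
  have h1 : ContMDiffAt 𝓘(ℝ, V) I 2 (extChartAt I p).symm v :=
    ((contMDiffOn_extChartAt_symm (I := I) (n := ∞) p).contMDiffAt (hop.mem_nhds hv)).of_le
      (by norm_cast)
  set q := (extChartAt I p).symm v with hq
  have h2 : DifferentiableAt ℝ (chartForm I θ q) (extChartAt I q q) :=
    ((hθ.contDiffOn_chartForm q).contDiffAt
      ((extHomeo_target I q ▸ (extHomeo I q).open_target).mem_nhds
        (mem_extChartAt_target q))).differentiableAt (by simp)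
  have h3 := extDer_pullback (I := 𝓘(ℝ, V)) I (x := v) h1 (θ := chartForm I θ p) (θ' := θ)
    (Eventually.of_forall fun z => rfl) h2 w w'
  let θV : ∀ v : V, TangentSpace 𝓘(ℝ, V) v →L[ℝ] ℝ := chartForm I θ p
  refine h3.symm.trans ((extDer_apply 𝓘(ℝ, V) θV v w w').trans ?_)
  rw [chartForm_model]
  rfl

/-- The exterior derivative of a smooth form is smooth. -/
lemma IsSmoothForm.isSmoothTwoForm_neg_extDer (hθ : IsSmoothForm I θ) :
    IsSmoothTwoForm I (fun x => -extDer I θ x) := by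
  intro p
  have hop : IsOpen (extChartAt I p).target := extHomeo_target I p ▸ (extHomeo I p).open_target
  set D : V → V →L[ℝ] V →L[ℝ] ℝ := fderiv ℝ (chartForm I θ p) with hD
  refine ⟨fun q => (D (extChartAt I p q)).flip - D (extChartAt I p q), ?_, ?_⟩
  · have h1 : ContDiffOn ℝ ∞ D (extChartAt I p).target :=
      (hθ.contDiffOn_chartForm p).fderiv_of_isOpen hop (by simp)
    have h2 : ContMDiffOn I 𝓘(ℝ, V →L[ℝ] V →L[ℝ] ℝ) ∞ (fun q => D (extChartAt I p q))
        (chartAt H p).source := by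
      refine h1.contMDiffOn.comp (contMDiffOn_extChartAt (I := I) (n := ∞) (x := p)) ?_
      intro q hq
      exact (extChartAt I p).map_source (by rwa [extChartAt_source])
    refine contMDiffOn_clm_of_apply fun v => contMDiffOn_clm_of_apply fun w => ?_
    have h3 : ∀ v w : V, ContMDiffOn I 𝓘(ℝ, ℝ) ∞ (fun q => D (extChartAt I p q) v w)
        (chartAt H p).source := fun v w =>
      (h2.clm_apply contMDiffOn_const).clm_apply contMDiffOn_const
    exact (h3 w v).sub (h3 v w)
  · intro q hq v w
    have hq' : q ∈ (extChartAt I p).source := by rwa [extChartAt_source]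
    have h1 := hθ.extDer_symm p ((extChartAt I p).map_source hq') v w
    -- `q` and the point with the same coordinates are equal only by a theorem; the vectors are kept
    -- as elements of `V`.
    have key : ∀ q', q' = (extChartAt I p).symm (extChartAt I p q) → ∀ X Y : V,
        (extDer I θ q' : V →L[ℝ] V →L[ℝ] ℝ) X Y =
        (extDer I θ ((extChartAt I p).symm (extChartAt I p q)) : V →L[ℝ] V →L[ℝ] ℝ) X Y := by
      rintro _ rfl X Y; rfl
    have h2 := key q ((extChartAt I p).left_inv hq').symm
      (mfderiv 𝓘(ℝ, V) I (extChartAt I p).symm (extChartAt I p q) v)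
      (mfderiv 𝓘(ℝ, V) I (extChartAt I p).symm (extChartAt I p q) w)
    rw [fromCoord_eq_mfderiv hq]
    change D _ w v - D _ v w = -(extDer I θ q _ _)
    refine Eq.trans ?_ (congrArg Neg.neg (h2.trans h1)).symm
    rw [neg_sub]

end SmoothForms

/-! ### Fredholm alternative and dimension counts. -/

section LinearAlgebra

variable {V V' : Type*} [AddCommGroup V] [Module ℝ V] [FiniteDimensional ℝ V]
  [AddCommGroup V'] [Module ℝ V']

/-- The Fredholm alternative for a bilinear pairing of two subspaces. -/
lemma exists_mem_forall_eq_of_orthogonal (S C : Submodule ℝ V) (B : V →ₗ[ℝ] V →ₗ[ℝ] ℝ)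
    (l : V →ₗ[ℝ] ℝ) (h : ∀ Z ∈ S, (∀ X ∈ C, B Z X = 0) → l Z = 0) :
    ∃ X ∈ C, ∀ Z ∈ S, B Z X = l Z := by
  let φ : C →ₗ[ℝ] Module.Dual ℝ S :=
    (LinearMap.lcomp ℝ ℝ S.subtype) ∘ₗ B.flip ∘ₗ C.subtype
  have hφ : ∀ (X : C) (Z : S), φ X Z = B Z X := fun X Z => rfl
  have hl : l ∘ₗ S.subtype ∈ LinearMap.range φ := by
    -- In finite dimension the range of `φ` is its own double annihilator, so solvability becomes a
    -- condition on the vectors orthogonal to `C`.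
    rw [← Subspace.dualCoannihilator_dualAnnihilator_eq (W := LinearMap.range φ),
      Submodule.mem_dualAnnihilator]
    intro Z hZ
    rw [Submodule.mem_dualCoannihilator] at hZ
    refine h Z Z.2 fun X hX => ?_
    exact (hφ ⟨X, hX⟩ Z).symm.trans (hZ _ ⟨⟨X, hX⟩, rfl⟩)
  obtain ⟨X, hX⟩ := hl
  exact ⟨X, X.2, fun Z hZ => congrArg (fun g => g ⟨Z, hZ⟩) hX⟩

lemma finrank_comap_of_le_range (L : V →ₗ[ℝ] V') {q : Submodule ℝ V'} (hq : q ≤ LinearMap.range L) :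
    Module.finrank ℝ (q.comap L) = Module.finrank ℝ (LinearMap.ker L) + Module.finrank ℝ q := by
  have h1 := LinearMap.finrank_range_add_finrank_ker (L.domRestrict (q.comap L))
  have h2 : LinearMap.range (L.domRestrict (q.comap L)) = q := by
    rw [LinearMap.range_domRestrict, Submodule.map_comap_eq, inf_eq_right.2 hq]
  have h3 : LinearMap.ker (L.domRestrict (q.comap L)) =
      (LinearMap.ker L).comap (q.comap L).subtype := by
    rw [LinearMap.ker_domRestrict]
  have h4 : LinearMap.ker L ≤ q.comap L := fun v hv => by
    rw [Submodule.mem_comap, LinearMap.mem_ker.1 hv]; exact zero_mem _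
  rw [h2, h3, (Submodule.comapSubtypeEquivOfLe h4).finrank_eq] at h1
  omega

/-- A vanishing combination, evaluated at a vector on which the forms take the values of a unit
vector, shows that its coefficient is zero. -/
lemma linearIndependent_of_dual {r : ℕ} {φ : Fin r → V →ₗ[ℝ] ℝ}
    (h : ∀ w : Fin r → ℝ, ∃ X, ∀ k, φ k X = w k) : LinearIndependent ℝ φ := by
  rw [Fintype.linearIndependent_iff]
  intro c hc j
  obtain ⟨X, hX⟩ := h (Pi.single j 1)
  have := congrArg (fun g => g X) hc
  simpa [hX, Pi.single_apply] using this

end LinearAlgebra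

/-! ### The constraint algorithm under a submersion that intertwines the forms. -/

section Algorithm

variable {V H N : Type*} [NormedAddCommGroup V] [NormedSpace ℝ V] [FiniteDimensional ℝ V]
  [TopologicalSpace H]
  (I : ModelWithCorners ℝ V H) [I.Boundaryless] [TopologicalSpace N] [ChartedSpace H N]
  [IsManifold I ∞ N]
  {V' H' N' : Type*} [NormedAddCommGroup V'] [NormedSpace ℝ V'] [FiniteDimensional ℝ V']
  [TopologicalSpace H']
  (I' : ModelWithCorners ℝ V' H') [I'.Boundaryless] [TopologicalSpace N'] [ChartedSpace H' N']
  [IsManifold I' ∞ N']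
  {F : Set N} {f : N → N'} {T : Set N'}
  {η : ∀ x : N, TangentSpace I x →L[ℝ] ℝ}
  {Ω : ∀ x : N, TangentSpace I x →L[ℝ] TangentSpace I x →L[ℝ] ℝ}
  {η' : ∀ x : N', TangentSpace I' x →L[ℝ] ℝ}
  {Ω' : ∀ x : N', TangentSpace I' x →L[ℝ] TangentSpace I' x →L[ℝ] ℝ}
  {Y : ∀ x : N, TangentSpace I x} {Y' : ∀ x : N', TangentSpace I' x}

omit [I.Boundaryless] [IsManifold I ∞ N] in
instance finiteDimensional_tangentSpace (x : N) : FiniteDimensional ℝ (TangentSpace I x) :=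
  (inferInstance : FiniteDimensional ℝ V)

lemma constraintSet_subset (i : ℕ) : constraintSet I F η Ω i ⊆ F := by
  induction i with
  | zero => exact subset_rfl
  | succ i ih => exact fun x hx => ih hx.1

lemma orthTo_le (C : Set N) (x : N) : orthTo I F η Ω Y C x ≤ tangentTo I F x := fun _ hZ => hZ.1

/-- The next constraint set is the set of common zeros of the constraints `i(Z) (η - γ)`. -/
lemma mem_constraintSet_succ_iff {i : ℕ} {x : N} (hΩ : ∀ X Z, Ω x X Z = -Ω x Z X)
    (hY : Y x ∈ tangentTo I F x) (hηY : η x (Y x) = 1) :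
    x ∈ constraintSet I F η Ω (i + 1) ↔ x ∈ constraintSet I F η Ω i ∧
      ∀ Z ∈ orthTo I F η Ω Y (constraintSet I F η Ω i) x, η x Z - Ω x (Y x) Z = 0 := by
  have hself : ∀ X, Ω x X X = 0 := fun X => by linarith [hΩ X X]
  have hCF : tangentTo I (constraintSet I F η Ω i) x ≤ tangentTo I F x :=
    tangentTo_mono I (eventually_nhdsWithin_of_forall fun z hz => constraintSet_subset I i hz)
  constructor
  · rintro ⟨hx, X, hX, hX0, hX1⟩
    refine ⟨hx, fun Z hZ => ?_⟩
    have h1 := hZ.2 X hX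
    have h2 := hX0 Z hZ.1
    have h3 := hX0 (Y x) hY
    rw [hX1, hΩ Z X, hΩ (Y x) X, h2, h3] at h1
    linarith
  · rintro ⟨hx, h⟩
    refine ⟨hx, ?_⟩
    let B : TangentSpace I x →ₗ[ℝ] TangentSpace I x →ₗ[ℝ] ℝ := LinearMap.mk₂ ℝ
      (fun Z X => (Ω x Z X - (η x Z * Ω x (Y x) X - η x X * Ω x (Y x) Z)) - η x Z * η x X)
      (fun Z Z' X => by simp only [map_add, add_apply]; ring)
      (fun c Z X => by simp only [map_smul, smul_apply, smul_eq_mul]; ring)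
      (fun X Z Z' => by simp only [map_add]; ring)
      (fun c X Z => by simp only [map_smul, smul_eq_mul]; ring)
    have hB : ∀ Z X : TangentSpace I x, B Z X =
      (Ω x Z X - (η x Z * Ω x (Y x) X - η x X * Ω x (Y x) Z)) - η x Z * η x X := fun Z X => rfl
    let l : TangentSpace I x →ₗ[ℝ] ℝ := (η x - Ω x (Y x)).toLinearMap
    have hl : ∀ Z : TangentSpace I x, l Z = η x Z - Ω x (Y x) Z := fun Z => rfl
    -- The solution wanted is `-X`: by the signs in the definition of the orthogonal space, testing
    -- with `Z = Y x` gives `η x X = -1`.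
    obtain ⟨X, hX, hXZ⟩ := exists_mem_forall_eq_of_orthogonal (tangentTo I F x)
      (tangentTo I (constraintSet I F η Ω i) x) B l
      (fun Z hZ hZ0 => h Z ⟨hZ, fun X hX => hZ0 X hX⟩)
    have hYX := hXZ (Y x) hY
    rw [hB, hl, hηY, hself] at hYX
    have h1 : η x X = -1 := by linarith
    have h2 : ∀ Z ∈ tangentTo I F x, Ω x Z X = η x Z * Ω x (Y x) X := by
      intro Z hZ
      have h3 := hXZ Z hZ
      rw [hB, hl, h1] at h3
      linarith
    -- Testing `h2` with `Z = X` itself, which is tangent to `F`, removes the remaining term.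
    have h3 : Ω x (Y x) X = 0 := by
      have := h2 X (hCF hX)
      rw [hself, h1] at this
      linarith
    refine ⟨-X, neg_mem hX, fun Z hZ => ?_, ?_⟩
    · rw [map_neg, neg_apply, hΩ X Z, h2 Z hZ, h3, mul_zero, neg_zero, neg_zero]
    · rw [map_neg, h1, neg_neg]

/-- A submersion intertwining the forms intertwines the two constraint algorithms. -/
lemma constraintSet_eq_preimage (hf : IsSubmersionBetween I I' f univ T)
    (hT : IsRegularSubmanifold I' T)
    (hη : ∀ y X, η y X = η' (f y) (mfderiv I I' f y X))
    (hΩ : ∀ y X Z, Ω y X Z = Ω' (f y) (mfderiv I I' f y X) (mfderiv I I' f y Z)) (i : ℕ)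
    (hreg : ∀ j < i, IsRegularSubmanifold I' (constraintSet I' T η' Ω' j)) :
    constraintSet I univ η Ω i = f ⁻¹' constraintSet I' T η' Ω' i := by
  induction i with
  | zero => exact (eq_univ_of_forall fun y => hf.1 trivial).symm
  | succ i ih =>
    have ih' := ih fun j hj => hreg j (by omega)
    -- Tangency in `N` is expressed through tangency in `N'`, so only the constraint sets of `N'`
    -- need to be regular.
    have hpre := fun {y : N} (hy : f y ∈ constraintSet I' T η' Ω' i) X =>
      mem_tangentTo_preimage_iff I I' hf hT (hreg i (by omega)) (constraintSet_subset I' i) hy X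
    have hsurj := fun y => hf.mem_tangentTo_iff I I' y
    ext y
    simp only [constraintSet, mem_preimage, mem_ofPred_eq, ih']
    refine and_congr_right fun hy => ?_
    constructor
    · rintro ⟨X, hX, hX0, hX1⟩
      refine ⟨mfderiv I I' f y X, (hpre hy X).1 hX, fun W hW => ?_, by rw [← hη, hX1]⟩
      obtain ⟨Z, rfl⟩ := (hsurj y W).1 hW
      rw [← hΩ]
      exact hX0 Z (by rw [tangentTo_of_mem_nhds I univ_mem]; trivial)
    · rintro ⟨W, hW, hW0, hW1⟩
      obtain ⟨X, rfl⟩ := (hsurj y W).1 (tangentTo_mono I' (eventually_nhdsWithin_of_forall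
        fun z hz => constraintSet_subset I' i hz) hW)
      refine ⟨X, (hpre hy X).2 hW, fun Z _ => ?_, by rw [hη, hW1]⟩
      rw [hΩ]
      exact hW0 _ ((hsurj y _).2 ⟨Z, rfl⟩)

lemma map_tangentTo_preimage (hf : IsSubmersionBetween I I' f univ T)
    (hT : IsRegularSubmanifold I' T) {Q : Set N'} (hQ : IsRegularSubmanifold I' Q) (hQT : Q ⊆ T)
    {y : N} (hy : f y ∈ Q) :
    (tangentTo I (f ⁻¹' Q) y).map (mfderiv I I' f y).toLinearMap = tangentTo I' Q (f y) := by
  ext W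
  constructor
  · rintro ⟨X, hX, rfl⟩
    exact (mem_tangentTo_preimage_iff I I' hf hT hQ hQT hy X).1 hX
  · intro hW
    obtain ⟨X, rfl⟩ := (hf.mem_tangentTo_iff I I' y W).1
      (tangentTo_mono I' (eventually_nhdsWithin_of_forall hQT) hW)
    exact ⟨X, (mem_tangentTo_preimage_iff I I' hf hT hQ hQT hy X).2 hW, rfl⟩

/-- Rank-nullity, as `f_*` reaches all of `R`. It serves for tangent spaces and for orthogonal
spaces. -/
lemma finrank_tangentTo_preimage (hf : IsSubmersionBetween I I' f univ T)
    {y : N} {P : Submodule ℝ (TangentSpace I y)} {R : Submodule ℝ (TangentSpace I' (f y))}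
    (hR : R ≤ tangentTo I' T (f y)) (hP : ∀ X, X ∈ P ↔ mfderiv I I' f y X ∈ R) :
    Module.finrank ℝ P = Module.finrank ℝ (LinearMap.ker (mfderiv I I' f y).toLinearMap) +
      Module.finrank ℝ R := by
  have h1 : P = R.comap (mfderiv I I' f y).toLinearMap := by ext X; exact hP X
  rw [h1]
  exact finrank_comap_of_le_range
    (mfderiv I I' f y).toLinearMap fun W hW => (hf.mem_tangentTo_iff I I' y W).1 (hR hW)

/-- Both dimensions in the source exceed those in the target by the dimension of the kernel of
`f_*`, which cancels. -/
lemma codimAt_preimage (hf : IsSubmersionBetween I I' f univ T)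
    (hT : IsRegularSubmanifold I' T) {Q : Set N'} (hQ : IsRegularSubmanifold I' Q) (hQT : Q ⊆ T)
    {y : N} (hy : f y ∈ Q) : codimAt I univ (f ⁻¹' Q) y = codimAt I' T Q (f y) := by
  have h1 := finrank_tangentTo_preimage I I' hf (P := tangentTo I (f ⁻¹' Q) y)
    (tangentTo_mono I' (eventually_nhdsWithin_of_forall hQT))
    (mem_tangentTo_preimage_iff I I' hf hT hQ hQT hy)
  have h2 := finrank_tangentTo_preimage I I' hf (y := y) (P := tangentTo I univ y) le_rfl (by
    intro X
    rw [tangentTo_of_mem_nhds I univ_mem]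
    exact iff_of_true trivial ((hf.mem_tangentTo_iff I I' y _).2 ⟨X, rfl⟩))
  rw [codimAt, codimAt, h1, h2]
  omega

/-- Under a submersion intertwining the forms and the connections, orthogonal spaces are preimages of
orthogonal spaces. -/
lemma mem_orthTo_preimage_iff (hf : IsSubmersionBetween I I' f univ T)
    (hT : IsRegularSubmanifold I' T)
    (hη : ∀ y X, η y X = η' (f y) (mfderiv I I' f y X))
    (hΩ : ∀ y X Z, Ω y X Z = Ω' (f y) (mfderiv I I' f y X) (mfderiv I I' f y Z))
    (hY : ∀ y, mfderiv I I' f y (Y y) = Y' (f y))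
    {Q : Set N'} (hQ : IsRegularSubmanifold I' Q) (hQT : Q ⊆ T) {y : N} (hy : f y ∈ Q)
    (Z : TangentSpace I y) :
    Z ∈ orthTo I univ η Ω Y (f ⁻¹' Q) y ↔ mfderiv I I' f y Z ∈ orthTo I' T η' Ω' Y' Q (f y) := by
  have hpre := mem_tangentTo_preimage_iff I I' hf hT hQ hQT hy
  have hsurj := hf.mem_tangentTo_iff I I' y
  constructor
  · rintro ⟨-, h⟩
    refine ⟨(hsurj _).2 ⟨Z, rfl⟩, fun W hW => ?_⟩
    obtain ⟨X, rfl⟩ := (hsurj W).1 (tangentTo_mono I' (eventually_nhdsWithin_of_forall hQT) hW)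
    have := h X ((hpre X).2 hW)
    rwa [hΩ, hη, hΩ, hη, hΩ, hY] at this
  · rintro ⟨-, h⟩
    refine ⟨by rw [tangentTo_of_mem_nhds I univ_mem]; trivial, fun X hX => ?_⟩
    rw [hΩ, hη, hΩ, hη, hΩ, hY]
    exact h _ ((hpre X).1 hX)

/-- Only values on `F` matter. This permits replacing functions on T^*E by functions that descend to
the quotient by μ. -/
lemma IsIndependentBasis.congr {C C' W : Set N} {r : ℕ} {χ χ' : Fin r → N → ℝ}
    (h : IsIndependentBasis I F C C' W χ) (hC : C ⊆ F) (hχ : ∀ j, EqOn (χ' j) (χ j) F) :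
    IsIndependentBasis I F C C' W χ' := by
  obtain ⟨h1, h2, g, h3, h4, h5⟩ := h
  refine ⟨fun j => (h1 j).congr (hχ j), ?_, g, h3, fun j z hz => ?_, h5⟩
  · rw [h2]
    ext z
    refine and_congr_right fun hz => forall_congr' fun j => ?_
    rw [hχ j (hC hz.1)]
  · rw [h4 j hz, hχ j hz.1]

variable [T2Space N']

/-- A bump function makes the local defining functions of `Q'` global. Their composites with `f`
stay independent because `f_*` maps the tangent spaces of `f ⁻¹' Q` onto those of `Q`. -/
lemma exists_independentBasis (hf : IsSubmersionBetween I I' f univ T)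
    (hT : IsRegularSubmanifold I' T) {Q Q' : Set N'} (hQ : IsRegularSubmanifold I' Q) (hQT : Q ⊆ T)
    (hQ' : IsRegularSubmanifold I' Q') (hQQ : Q' ⊆ Q) {p : N'} (hp : p ∈ Q') :
    ∃ (U : Set N') (r : ℕ) (χ : Fin r → N' → ℝ), IsOpen U ∧ p ∈ U ∧
      IsIndependentBasis I' T Q Q' U χ ∧
      IsIndependentBasis I univ (f ⁻¹' Q) (f ⁻¹' Q') (f ⁻¹' U) (fun j z => χ j (f z)) := by
  obtain ⟨r, U, h, hU, hpU, hh, hset, hsurj, -⟩ := exists_independent_functions I' hQ hQ' hQQ hp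
  have hfs := hf.contMDiff
  obtain ⟨ρ, -, hρ⟩ := (SmoothBumpFunction.nhds_basis_tsupport (I := I') p).mem_iff.1
    (hU.mem_nhds hpU)
  obtain ⟨O, hO1, hO, hpO⟩ := eventually_nhds_iff.1 ρ.eventuallyEq_one
  set χ : Fin r → N' → ℝ := fun j q => ρ q * h q j with hχ
  have hχs : ∀ j, ContMDiff I' 𝓘(ℝ, ℝ) ∞ (χ j) := by
    intro j
    refine contMDiff_of_tsupport fun q hq => ?_
    have hqU : q ∈ U := hρ (closure_mono (fun z hz => by
      rw [mem_support] at hz ⊢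
      exact fun h0 => hz (by simp [hχ, h0])) hq)
    have h1 : ContMDiffAt I' 𝓘(ℝ, ℝ) ∞ (fun q => h q j) q :=
      (ContinuousLinearMap.proj (R := ℝ) (φ := fun _ : Fin r => ℝ) j).contMDiff.contMDiffAt.comp q
        (hh.contMDiffAt (hU.mem_nhds hqU))
    exact ρ.contMDiffAt.mul h1
  have hχO : ∀ q ∈ O, ∀ j, χ j q = h q j := fun q hq j => by
    have : ρ q = 1 := hO1 q hq
    simp [hχ, this]
  have hdχ : ∀ q ∈ U ∩ O, ∀ j (X : TangentSpace I' q), dAt I' (χ j) q X =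
      (show Fin r → ℝ from mfderiv I' 𝓘(ℝ, Fin r → ℝ) h q X) j := by
    intro q hq j X
    have e1 : χ j =ᶠ[𝓝 q] fun q => ContinuousLinearMap.proj (R := ℝ) (φ := fun _ : Fin r => ℝ) j (h q) := by
      filter_upwards [hO.mem_nhds hq.2] with z hz
      exact hχO z hz j
    rw [dAt, e1.mfderiv_eq]
    exact mfderiv_clm_comp I' ((hh.contMDiffAt (hU.mem_nhds hq.1)).mdifferentiableAt (by simp))
      (ContinuousLinearMap.proj (R := ℝ) (φ := fun _ : Fin r => ℝ) j) X
  have hzero : Q' ∩ (U ∩ O) = {z ∈ Q ∩ (U ∩ O) | ∀ j, χ j z = 0} := by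
    ext z
    constructor
    · rintro ⟨hz, hzU, hzO⟩
      refine ⟨⟨hQQ hz, hzU, hzO⟩, fun j => ?_⟩
      rw [hχO z hzO, (hset.subset ⟨hz, hzU⟩).2]; rfl
    · rintro ⟨⟨hz, hzU, hzO⟩, hz0⟩
      refine ⟨(hset.symm.subset ⟨⟨hz, hzU⟩, funext fun j => ?_⟩).1, hzU, hzO⟩
      rw [← hχO z hzO, hz0]; rfl
  refine ⟨U ∩ O, r, χ, hU.inter hO, ⟨hpU, hpO⟩, ⟨fun j => (hχs j).contMDiffOn, hzero, χ,
    fun j => (hχs j).contMDiffOn, fun j => eqOn_refl _ _, ?_⟩,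
    ⟨fun j => ((hχs j).comp hfs).contMDiffOn, ?_, _, fun j => ((hχs j).comp hfs).contMDiffOn,
      fun j => eqOn_refl _ _, ?_⟩⟩
  · rintro z ⟨hz, hzU⟩
    refine linearIndependent_of_dual fun w => ?_
    obtain ⟨X, hX, hXw⟩ := hsurj z ⟨hQQ hz, hzU.1⟩ w
    refine ⟨⟨X, hX⟩, fun k => (hdχ z hzU k X).trans ?_⟩
    rw [hXw]
  · ext z
    exact Set.ext_iff.1 hzero (f z)
  · rintro z ⟨hz, hzU⟩
    refine linearIndependent_of_dual fun w => ?_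
    obtain ⟨W, hW, hXw⟩ := hsurj (f z) ⟨hQQ hz, hzU.1⟩ w
    rw [← map_tangentTo_preimage I I' hf hT hQ hQT (hQQ hz)] at hW
    obtain ⟨X, hX, rfl⟩ := hW
    refine ⟨⟨X, hX⟩, fun k => ?_⟩
    have e1 := mfderiv_comp z (((hχs k) (f z)).mdifferentiableAt (by simp))
      ((hfs z).mdifferentiableAt (by simp))
    refine (congrArg (fun g => g X) e1).trans ((hdχ (f z) hzU k (mfderiv I I' f z X)).trans ?_)
    exact congrArg (fun g => g k) hXw

end Algorithm

/-! ### Smooth projections onto tangent spaces, and lifting of vector fields. -/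

section TangentProjection

variable {V H N : Type*} [NormedAddCommGroup V] [NormedSpace ℝ V] [FiniteDimensional ℝ V]
  [TopologicalSpace H]
  (I : ModelWithCorners ℝ V H) [I.Boundaryless] [TopologicalSpace N] [ChartedSpace H N]
  [IsManifold I ∞ N]
  {V' H' N' : Type*} [NormedAddCommGroup V'] [NormedSpace ℝ V'] [FiniteDimensional ℝ V']
  [TopologicalSpace H']
  (I' : ModelWithCorners ℝ V' H') [I'.Boundaryless] [TopologicalSpace N'] [ChartedSpace H' N']
  [IsManifold I' ∞ N']

lemma finrank_ker_of_surjective {F : Type*} [NormedAddCommGroup F] [NormedSpace ℝ F]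
    [FiniteDimensional ℝ F] {A : V →L[ℝ] F} (h : Surjective A) :
    Module.finrank ℝ (LinearMap.ker A.toLinearMap) = Module.finrank ℝ V - Module.finrank ℝ F := by
  have := LinearMap.finrank_range_add_finrank_ker A.toLinearMap
  rw [LinearMap.range_eq_top.2 h, finrank_top] at this
  omega

/-- Near a point of a submanifold there is a smooth family of projections of the model space which
project, at the points of the submanifold, onto its tangent space. -/
lemma exists_smooth_tangentProjection {S : Set N} (hS : IsRegularSubmanifold I S) {p : N}
    (hp : p ∈ S) :
    ∃ (U : Set N) (P : N → (V →L[ℝ] V)), IsOpen U ∧ p ∈ U ∧ U ⊆ (chartAt H p).source ∧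
      ContMDiffOn I 𝓘(ℝ, V →L[ℝ] V) ∞ P U ∧ ∀ q ∈ S ∩ U,
        (∀ w, fromCoord I p q (P q w) ∈ tangentTo I S q) ∧
        ∀ X ∈ tangentTo I S q, P q (toCoord I p q X) = toCoord I p q X := by
  obtain ⟨c, U, g, hU, hpU, hg, hs, hz⟩ := hS p hp
  set O := U ∩ (chartAt H p).source with hO
  have hOo : IsOpen O := hU.inter (chartAt H p).open_source
  have hpO : p ∈ O := ⟨hpU, mem_chart_source H p⟩
  set A : N → (V →L[ℝ] (Fin c → ℝ)) := fun q =>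
    (show V →L[ℝ] (Fin c → ℝ) from (mfderiv I 𝓘(ℝ, Fin c → ℝ) g q).comp (fromCoord I p q)) with hA
  have hAs : ContMDiffOn I 𝓘(ℝ, V →L[ℝ] (Fin c → ℝ)) ∞ A O :=
    contMDiffOn_mfderiv_fromCoord hU hg p
  have hAa : ∀ q w, A q w = mfderiv I 𝓘(ℝ, Fin c → ℝ) g q (fromCoord I p q w) := fun q w => rfl
  have hAsurj : ∀ q ∈ O, Surjective (A q) := by
    intro q hq w
    obtain ⟨X, hX⟩ := hs q hq.1 w
    exact ⟨toCoord I p q X, by rw [hAa, fromCoord_toCoord hq.2, hX]⟩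
  obtain ⟨B, U', hU', hpU', hB, hBA⟩ := exists_smooth_generalizedInverse I hpO hAs
  -- As `A B A = A`, the map `id - B A` takes values in the kernel of `A q`, and it fixes that
  -- kernel; at points of `S` the kernel is the tangent space in coordinates.
  refine ⟨O ∩ U', fun q => ContinuousLinearMap.id ℝ V - (B q).comp (A q), hOo.inter hU',
    ⟨hpO, hpU'⟩, fun q hq => hq.1.2, ?_, ?_⟩
  · exact contMDiffOn_const.sub (hB.clm_comp (hAs.mono inter_subset_left))
  · rintro q ⟨hqS, hq⟩
    have hmem := mem_tangentTo_iff_mfderiv_eq_zero I hU hg hq.1.1 hqS (hs q hq.1.1) hz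
    have h1 := hBA q hq (by
      rw [finrank_ker_of_surjective (hAsurj q hq.1), finrank_ker_of_surjective (hAsurj p hpO)])
    refine ⟨fun w => (hmem _).2 ?_, fun X hX => ?_⟩
    · rw [← hAa]
      simp [h1]
      rfl
    · have h2 : A q (toCoord I p q X) = 0 := by
        rw [hAa, fromCoord_toCoord hq.1.2]; exact (hmem X).1 hX
      simp [h2]

variable {I I'}

/-- Vector fields along a submersion onto a submanifold lift smoothly. -/
lemma exists_lift [T2Space N] [SigmaCompactSpace N] {f : N → N'} {T : Set N'}
    (hf : IsSubmersionBetween I I' f univ T) (hT : IsRegularSubmanifold I' T)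
    {Z : ∀ q : N', TangentSpace I' q} (hZ : IsVectorFieldOn I' T Z) :
    ∃ W : ∀ y : N, TangentSpace I y, IsVectorFieldOn I univ W ∧
      ∀ y, mfderiv I I' f y (W y) = Z (f y) := by
  have hfs := hf.contMDiff
  have hZf : ContMDiff I I'.tangent ∞ (fun y => (⟨f y, Z (f y)⟩ : TangentBundle I' N')) :=
    contMDiffOn_univ.1 (hZ.1.comp hfs.contMDiffOn fun y _ => hf.1 trivial)
  -- The lifts of a vector form an affine space, hence a convex set, so local lifts can be glued by
  -- a partition of unity.
  have hconv : ∀ y, Convex ℝ {w : TangentSpace I y | mfderiv I I' f y w = Z (f y)} := by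
    intro y w hw w' hw' a b ha hb hab
    simp only [mem_ofPred_eq] at hw hw' ⊢
    rw [map_add, map_smul, map_smul, hw, hw', ← add_smul, hab, one_smul]
  have hloc : ∀ y₀ : N, ∃ O ∈ 𝓝 y₀, ∃ s : ∀ y : N, TangentSpace I y,
      ContMDiffOn I I.tangent ∞ (fun y => (⟨y, s y⟩ : TangentBundle I N)) O ∧
        ∀ y ∈ O, mfderiv I I' f y (s y) = Z (f y) := by
    intro y₀
    obtain ⟨c, U, g, hU, hyU, hg, hgs, hz⟩ := hT (f y₀) (hf.1 trivial)
    set U₁ : Set N' := U ∩ (chartAt H' (f y₀)).source with hU₁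
    have hU₁o : IsOpen U₁ := hU.inter (chartAt H' (f y₀)).open_source
    set U₂ : Set N := f ⁻¹' U₁ with hU₂
    have hU₂o : IsOpen U₂ := hU₁o.preimage hfs.continuous
    set O := U₂ ∩ (chartAt H y₀).source with hO
    have hOo : IsOpen O := hU₂o.inter (chartAt H y₀).open_source
    have hyO : y₀ ∈ O := ⟨⟨hyU, mem_chart_source H' _⟩, mem_chart_source H _⟩
    set A : N → (V →L[ℝ] V') := fun y =>
      (toCoord I' (f y₀) (f y)).comp ((mfderiv I I' f y).comp (fromCoord I y₀ y)) with hA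
    have hAs : ContMDiffOn I 𝓘(ℝ, V →L[ℝ] V') ∞ A O :=
      contMDiffOn_toCoord_mfderiv_fromCoord I' hU₂o hfs.contMDiffOn y₀ (f y₀) fun z hz => hz.2
    have hAa : ∀ y w, A y w = toCoord I' (f y₀) (f y) (mfderiv I I' f y (fromCoord I y₀ y w)) :=
      fun y w => rfl
    -- In coordinates the range of `A y` is the tangent space of `T`, whose dimension is constant on
    -- `O`; so `A` has constant rank and a smooth generalized inverse.
    have hker : ∀ y ∈ O, Module.finrank ℝ (LinearMap.ker (A y).toLinearMap) =
        Module.finrank ℝ V - (Module.finrank ℝ V' - Module.finrank ℝ (Fin c → ℝ)) := by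
      intro y hy
      have h1 := LinearMap.finrank_range_add_finrank_ker (A y).toLinearMap
      set G : V' →L[ℝ] (Fin c → ℝ) := (show V' →L[ℝ] (Fin c → ℝ) from
        (mfderiv I' 𝓘(ℝ, Fin c → ℝ) g (f y)).comp (fromCoord I' (f y₀) (f y))) with hG
      have hGs : Surjective G := by
        intro w
        obtain ⟨X, hX⟩ := hgs (f y) hy.1.1 w
        refine ⟨toCoord I' (f y₀) (f y) X, ?_⟩
        change mfderiv I' 𝓘(ℝ, Fin c → ℝ) g (f y) (fromCoord I' (f y₀) (f y) _) = w
        rw [fromCoord_toCoord hy.1.2, hX]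
      have h2 : LinearMap.range (A y).toLinearMap = LinearMap.ker G.toLinearMap := by
        ext w
        have h3 : w ∈ LinearMap.ker G.toLinearMap ↔
            fromCoord I' (f y₀) (f y) w ∈ tangentTo I' T (f y) :=
          (mem_tangentTo_iff_mfderiv_eq_zero I' hU hg hy.1.1 (hf.1 trivial)
            (hgs (f y) hy.1.1) hz _).symm
        rw [h3, hf.mem_tangentTo_iff]
        constructor
        · rintro ⟨v, rfl⟩
          refine ⟨fromCoord I y₀ y v, ?_⟩
          change _ = fromCoord I' (f y₀) (f y) (A y v)
          rw [hAa, fromCoord_toCoord hy.1.2]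
        · rintro ⟨X, hX⟩
          refine ⟨toCoord I y₀ y X, ?_⟩
          change A y _ = w
          rw [hAa, fromCoord_toCoord hy.2, hX, toCoord_fromCoord hy.1.2]
      rw [h2, finrank_ker_of_surjective hGs] at h1
      omega
    obtain ⟨B, U', hU', hyU', hB, hBA⟩ := exists_smooth_generalizedInverse I hyO hAs
    refine ⟨O ∩ U', (hOo.inter hU').mem_nhds ⟨hyO, hyU'⟩,
      fun y => fromCoord I y₀ y (B y (toCoord I' (f y₀) (f y) (Z (f y)))), ?_, ?_⟩
    · refine contMDiffOn_fromCoord y₀ (fun y hy => hy.1.2) ?_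
      refine hB.clm_apply ?_
      exact ((contMDiffOn_iff_toCoord I (f y₀) (fun z hz => hz.1.1.2)).1
        (hZf.contMDiffOn (s := O ∩ U'))).2
    · intro y hy
      have h1 := hBA y hy (by rw [hker y hy.1, hker y₀ hyO])
      obtain ⟨X, hX⟩ := (hf.mem_tangentTo_iff I I' y (Z (f y))).1 (hZ.2 (f y) (hf.1 trivial))
      have h2 : A y (toCoord I y₀ y X) = toCoord I' (f y₀) (f y) (Z (f y)) := by
        rw [hAa, fromCoord_toCoord hy.1.2, hX]
      have h3 := h1 (toCoord I y₀ y X)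
      rw [h2, hAa] at h3
      have h4 := congrArg (fromCoord I' (f y₀) (f y)) h3
      rw [fromCoord_toCoord hy.1.1.2, fromCoord_toCoord hy.1.1.2] at h4
      exact h4
  obtain ⟨s, hs⟩ := exists_contMDiffSection_forall_mem_convex_of_local (n := ⊤) I
    (F_fiber := V) (fun y : N => TangentSpace I y)
    (fun y => {w | mfderiv I I' f y w = Z (f y)}) hconv hloc
  exact ⟨s, ⟨s.contMDiff.contMDiffOn, fun x _ => by
    rw [tangentTo_of_mem_nhds I univ_mem]; trivial⟩, hs⟩

end TangentProjection

/-! ### Vector fields spanning the orthogonal spaces. -/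

section Generators

variable {V H N : Type*} [NormedAddCommGroup V] [NormedSpace ℝ V] [FiniteDimensional ℝ V]
  [TopologicalSpace H]
  (I : ModelWithCorners ℝ V H) [I.Boundaryless] [TopologicalSpace N] [ChartedSpace H N]
  [IsManifold I ∞ N]
  {V' H' N' : Type*} [NormedAddCommGroup V'] [NormedSpace ℝ V'] [FiniteDimensional ℝ V']
  [TopologicalSpace H']
  (I' : ModelWithCorners ℝ V' H') [I'.Boundaryless] [TopologicalSpace N'] [ChartedSpace H' N']
  [IsManifold I' ∞ N']
  {F : Set N} {f : N → N'} {T : Set N'}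
  {η : ∀ x : N, TangentSpace I x →L[ℝ] ℝ}
  {Ω : ∀ x : N, TangentSpace I x →L[ℝ] TangentSpace I x →L[ℝ] ℝ}
  {η' : ∀ x : N', TangentSpace I' x →L[ℝ] ℝ}
  {Ω' : ∀ x : N', TangentSpace I' x →L[ℝ] TangentSpace I' x →L[ℝ] ℝ}
  {Y : ∀ x : N, TangentSpace I x} {Y' : ∀ x : N', TangentSpace I' x}

/-- A vector field given by its components near `p`, cut off by a bump function, is smooth. -/
lemma contMDiffOn_bump_fromCoord [T2Space N] {p : N} (ρ : SmoothBumpFunction I p) {U : Set N}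
    (hU : IsOpen U) (hUs : U ⊆ (chartAt H p).source) (hρ : tsupport ρ ⊆ U) {w : N → V}
    (hw : ContMDiffOn I 𝓘(ℝ, V) ∞ w (F ∩ U)) :
    ContMDiffOn I I.tangent ∞
      (fun q => (⟨q, fromCoord I p q (ρ q • w q)⟩ : TangentBundle I N)) F := by
  intro q hq
  by_cases hqU : q ∈ tsupport ρ
  · have h1 : ContMDiffOn I 𝓘(ℝ, V) ∞ (fun q => ρ q • w q) (F ∩ U) :=
      ρ.contMDiff.contMDiffOn.smul hw
    have h2 := contMDiffOn_fromCoord p (fun z hz => hUs hz.2) h1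
    exact (h2 q ⟨hq, hρ hqU⟩).mono_of_mem_nhdsWithin
      (inter_mem self_mem_nhdsWithin (mem_nhdsWithin_of_mem_nhds (hU.mem_nhds (hρ hqU))))
  · have h1 : ∀ᶠ z in 𝓝 q, ρ z = 0 := by
      filter_upwards [(isClosed_tsupport ρ).isOpen_compl.mem_nhds hqU] with z hz
      exact image_eq_zero_of_notMem_tsupport hz
    have h2 : ContMDiffAt I I.tangent ∞
        (fun q : N => (⟨q, (0 : V)⟩ : TangentBundle I N)) q :=
      Bundle.contMDiff_zeroSection ℝ (TangentSpace I : N → Type _) q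
    refine (h2.congr_of_eventuallyEq ?_).contMDiffWithinAt
    filter_upwards [h1] with z hz
    simp only [hz, zero_smul, map_zero]
    rfl

variable [T2Space N]

/-- Where its rank is constant, the orthogonal space of a submanifold is spanned by vector fields. -/
lemma exists_orthTo_generators (hF : IsRegularSubmanifold I F) (hη : IsSmoothForm I η)
    (hΩ : IsSmoothTwoForm I Ω) (hY : IsVectorFieldOn I F Y) {C : Set N}
    (hC : IsRegularSubmanifold I C) (hCF : C ⊆ F) {p : N} (hp : p ∈ C)
    (hrk : ∀ᶠ q in 𝓝 p, q ∈ C → Module.finrank ℝ (orthTo I F η Ω Y C q) =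
      Module.finrank ℝ (orthTo I F η Ω Y C p)) :
    ∃ (m : ℕ) (Z : Fin m → ∀ q : N, TangentSpace I q) (U : Set N) (c : Fin m → (V →L[ℝ] ℝ)),
      IsOpen U ∧ p ∈ U ∧ U ⊆ (chartAt H p).source ∧ (∀ a, IsVectorFieldOn I F (Z a)) ∧
      (∀ a, ∀ q ∈ C, Z a q ∈ orthTo I F η Ω Y C q) ∧
      ∀ q ∈ C ∩ U, ∀ W ∈ orthTo I F η Ω Y C q, W = ∑ a, c a (toCoord I p q W) • Z a q := by
  obtain ⟨U₁, P, hU₁, hpU₁, hU₁s, hP, hPT⟩ := exists_smooth_tangentProjection I hF (hCF hp)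
  obtain ⟨U₂, P', hU₂, hpU₂, hU₂s, hP', hPC⟩ := exists_smooth_tangentProjection I hC hp
  obtain ⟨A, hA, hAΩ⟩ := hΩ p
  have hη1 := hη.contMDiffOn_coord p
  set ηc : N → (V →L[ℝ] ℝ) := fun q => (η q).comp (fromCoord I p q) with hηc
  set U := U₁ ∩ U₂ with hU
  have hUo : IsOpen U := hU₁.inter hU₂
  have hUs : U ⊆ (chartAt H p).source := fun q hq => hU₁s hq.1
  set γc : N → (V →L[ℝ] ℝ) := fun q => A q (toCoord I p q (Y q)) with hγc
  have hγ1 : ContMDiffOn I 𝓘(ℝ, V →L[ℝ] ℝ) ∞ γc (F ∩ U) := by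
    refine (hA.mono fun q hq => hUs hq.2).clm_apply ?_
    exact (contMDiffOn_section_iff_toCoord p fun q hq => hUs hq.2).1 (hY.1.mono inter_subset_left)
  set β : N → (V →L[ℝ] V →L[ℝ] ℝ) := fun q =>
    A q - ((ηc q).smulRight (γc q) - (γc q).smulRight (ηc q)) - (ηc q).smulRight (ηc q) with hβ
  have hβa : ∀ q v w, β q v w = A q v w - (ηc q v * γc q w - ηc q w * γc q v) -
      ηc q v * ηc q w := fun q v w => by
    change A q v w - (ηc q v * γc q w - γc q v * ηc q w) - ηc q v * ηc q w = _
    ring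
  have hβo : ∀ q ∈ U, ∀ v w, β q v w =
      (Ω q (fromCoord I p q v) (fromCoord I p q w) -
        (η q (fromCoord I p q v) * Ω q (Y q) (fromCoord I p q w) -
          η q (fromCoord I p q w) * Ω q (Y q) (fromCoord I p q v))) -
        η q (fromCoord I p q v) * η q (fromCoord I p q w) := by
    intro q hq v w
    have h1 : ∀ w, γc q w = Ω q (Y q) (fromCoord I p q w) := fun w => by
      rw [hγc]
      exact (hAΩ q (hUs hq) _ _).trans (by rw [fromCoord_toCoord (hUs hq)])
    rw [hβa, hAΩ q (hUs hq), h1, h1]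
    rfl
  -- At points of `C` the kernel of `L q` is the orthogonal space in coordinates: the first
  -- component tests tangency to `F`, the second tests `β` against the tangent space of `C`,
  -- parametrized by the projection `P'`.
  set L : N → (V →L[ℝ] V × (V →L[ℝ] ℝ)) := fun q =>
    (ContinuousLinearMap.id ℝ V - P q).prod
      (((ContinuousLinearMap.compL ℝ V V ℝ).flip (P' q)).comp (β q)) with hL
  have hLa : ∀ q v, L q v = (v - P q v, (β q v).comp (P' q)) := fun q v => rfl
  have hLs : ContMDiffOn I 𝓘(ℝ, V →L[ℝ] V × (V →L[ℝ] ℝ)) ∞ L (F ∩ U) := by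
    have e1 : ContMDiffOn I 𝓘(ℝ, V →L[ℝ] V) ∞ P (F ∩ U) := hP.mono fun q hq => hq.2.1
    have e2 : ContMDiffOn I 𝓘(ℝ, V →L[ℝ] V) ∞ P' (F ∩ U) := hP'.mono fun q hq => hq.2.2
    have e3 : ContMDiffOn I 𝓘(ℝ, V →L[ℝ] V →L[ℝ] ℝ) ∞ A (F ∩ U) := hA.mono fun q hq => hUs hq.2
    have e4 : ContMDiffOn I 𝓘(ℝ, V →L[ℝ] ℝ) ∞ ηc (F ∩ U) := hη1.mono fun q hq => hUs hq.2
    have e5 : ContMDiffOn I 𝓘(ℝ, V →L[ℝ] V →L[ℝ] ℝ) ∞ β (F ∩ U) := by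
      refine contMDiffOn_clm_of_apply fun v => contMDiffOn_clm_of_apply fun w => ?_
      have k1 : ∀ v, ContMDiffOn I 𝓘(ℝ, ℝ) ∞ (fun q => ηc q v) (F ∩ U) := fun v =>
        e4.clm_apply contMDiffOn_const
      have k2 : ∀ v, ContMDiffOn I 𝓘(ℝ, ℝ) ∞ (fun q => γc q v) (F ∩ U) := fun v =>
        hγ1.clm_apply contMDiffOn_const
      have k3 : ContMDiffOn I 𝓘(ℝ, ℝ) ∞ (fun q => A q v w) (F ∩ U) :=
        (e3.clm_apply contMDiffOn_const).clm_apply contMDiffOn_const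
      refine ((k3.sub (((k1 v).mul (k2 w)).sub ((k1 w).mul (k2 v)))).sub
        ((k1 v).mul (k1 w))).congr fun q _ => hβa q v w
    refine contMDiffOn_clm_of_apply fun v => ?_
    exact (contMDiffOn_const.sub (e1.clm_apply contMDiffOn_const)).prodMk_space
      ((e5.clm_apply contMDiffOn_const).clm_comp e2)
  have hker : ∀ q ∈ C ∩ U, ∀ v, L q v = 0 ↔ fromCoord I p q v ∈ orthTo I F η Ω Y C q := by
    rintro q ⟨hqC, hqU⟩ v
    rw [hLa, Prod.mk_eq_zero]
    constructor
    · rintro ⟨h1, h2⟩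
      refine ⟨?_, fun X hX => ?_⟩
      · rw [sub_eq_zero.1 h1]
        exact (hPT q ⟨hCF hqC, hqU.1⟩).1 v
      · have h3 := congrArg (fun g => g (toCoord I p q X)) h2
        have h4 : β q v (P' q (toCoord I p q X)) = 0 := h3
        rwa [(hPC q ⟨hqC, hqU.2⟩).2 X hX, hβo q hqU, fromCoord_toCoord (hUs hqU)] at h4
    · rintro ⟨h1, h2⟩
      constructor
      · have := (hPT q ⟨hCF hqC, hqU.1⟩).2 _ h1
        rw [toCoord_fromCoord (hUs hqU)] at this
        rw [this, sub_self]
      · ext x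
        change β q v (P' q x) = 0
        rw [hβo q hqU]
        exact h2 _ ((hPC q ⟨hqC, hqU.2⟩).1 x)
  have hdim : ∀ q ∈ C ∩ U, Module.finrank ℝ (LinearMap.ker (L q).toLinearMap) =
      Module.finrank ℝ (orthTo I F η Ω Y C q) := by
    intro q hq
    have h1 : LinearMap.ker (L q).toLinearMap =
        (orthTo I F η Ω Y C q).comap (fromCoord I p q).toLinearMap := by
      ext v
      exact hker q hq v
    have h2 : LinearMap.ker (fromCoord I p q).toLinearMap = ⊥ := by
      rw [LinearMap.ker_eq_bot]
      intro v w hvw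
      have := congrArg (toCoord I p q) hvw
      simpa only [ContinuousLinearMap.coe_coe, toCoord_fromCoord (hUs hq.2)] using this
    rw [h1, finrank_comap_of_le_range (fromCoord I p q).toLinearMap
      fun W _ => ⟨toCoord I p q W, fromCoord_toCoord (hUs hq.2) W⟩, h2, finrank_bot, zero_add]
  have hpU : p ∈ U := ⟨hpU₁, hpU₂⟩
  have hpFU : p ∈ F ∩ U := ⟨hCF hp, hpU⟩
  -- The rank of `L` is controlled only along `C`. `B` is nevertheless smooth on a neighbourhood in
  -- `F`, and its defining identity is used only on `C`.
  obtain ⟨B, U₃, hU₃, hpU₃, hB, hBL⟩ := exists_smooth_generalizedInverse I hpFU hLs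
  obtain ⟨U₄, hU₄r, hU₄, hpU₄⟩ := eventually_nhds_iff.1 hrk
  set W := U ∩ U₃ ∩ U₄ with hW
  have hWo : IsOpen W := (hUo.inter hU₃).inter hU₄
  have hpW : p ∈ W := ⟨⟨hpU, hpU₃⟩, hpU₄⟩
  have hWs : W ⊆ (chartAt H p).source := fun q hq => hUs hq.1.1
  have hBL' : ∀ q ∈ C ∩ W, ∀ v, L q (v - B q (L q v)) = 0 := by
    rintro q ⟨hqC, ⟨hqU, hq3⟩, hq4⟩ v
    have h1 := hBL q ⟨⟨hCF hqC, hqU⟩, hq3⟩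
      (by rw [hdim q ⟨hqC, hqU⟩, hdim p ⟨hp, hpU⟩, hU₄r q hq4 hqC]) v
    rw [map_sub, h1, sub_self]
  obtain ⟨ρ, -, hρ⟩ := (SmoothBumpFunction.nhds_basis_tsupport (I := I) p).mem_iff.1
    (hWo.mem_nhds hpW)
  obtain ⟨O, hO1, hO, hpO⟩ := eventually_nhds_iff.1 ρ.eventuallyEq_one
  let b := Module.finBasis ℝ V
  -- Along `C` the map `id - B L` projects onto the kernel of `L`. The extra `P` makes the fields
  -- tangent to `F` away from `C` and changes nothing on `C`.
  set w : Fin (Module.finrank ℝ V) → N → V := fun a q =>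
    P q (b a - B q (L q (b a))) with hw
  have hPw : ∀ q ∈ C ∩ W, ∀ a, w a q = b a - B q (L q (b a)) := by
    intro q hq a
    have h1 := hBL' q hq (b a)
    rw [hLa, Prod.mk_eq_zero] at h1
    exact (sub_eq_zero.1 h1.1).symm
  refine ⟨_, fun a q => fromCoord I p q (ρ q • w a q), W ∩ O,
    fun a => LinearMap.toContinuousLinearMap (b.coord a), hWo.inter hO, ⟨hpW, hpO⟩,
    fun q hq => hWs hq.1, fun a => ⟨?_, ?_⟩, ?_, ?_⟩
  · refine contMDiffOn_bump_fromCoord I ρ hWo hWs hρ ?_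
    have e1 : ContMDiffOn I 𝓘(ℝ, V × (V →L[ℝ] ℝ)) ∞ (fun q => L q (b a)) (F ∩ W) :=
      (hLs.mono fun q hq => ⟨hq.1, hq.2.1.1⟩).clm_apply contMDiffOn_const
    exact (hP.mono fun q hq => hq.2.1.1.1).clm_apply (contMDiffOn_const.sub
      ((hB.mono fun q hq => ⟨⟨hq.1, hq.2.1.1⟩, hq.2.1.2⟩).clm_apply e1))
  · intro q hq
    beta_reduce
    rw [map_smul]
    by_cases hqW : q ∈ W
    · exact Submodule.smul_mem _ _ ((hPT q ⟨hq, hqW.1.1.1⟩).1 _)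
    · rw [image_eq_zero_of_notMem_tsupport (f := ρ) fun h => hqW (hρ h), zero_smul]
      exact zero_mem _
  · intro a q hq
    beta_reduce
    rw [map_smul]
    by_cases hqW : q ∈ W
    · refine Submodule.smul_mem _ _ ?_
      rw [hPw q ⟨hq, hqW⟩]
      exact (hker q ⟨hq, hqW.1.1⟩ _).1 (hBL' q ⟨hq, hqW⟩ _)
    · rw [image_eq_zero_of_notMem_tsupport (f := ρ) fun h => hqW (hρ h), zero_smul]
      exact zero_mem _
  · rintro q ⟨hqC, hqW, hqO⟩ X hX
    have hρ1 : ρ q = 1 := hO1 q hqO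
    set v := toCoord I p q X with hv
    have hX' : fromCoord I p q v = X := fromCoord_toCoord (hWs hqW) X
    have h1 : L q v = 0 := (hker q ⟨hqC, hqW.1.1⟩ v).2 (by rw [hX']; exact hX)
    -- The projection `id - B L` fixes `v`, so the coordinates of `v` in the basis serve as
    -- coefficients.
    have h2 : v = ∑ a, b.coord a v • (b a - B q (L q (b a))) := by
      have h3 : ∑ a, b.coord a v • (b a - B q (L q (b a))) =
          (∑ a, b.coord a v • b a) - B q (L q (∑ a, b.coord a v • b a)) := by
        simp only [smul_sub, Finset.sum_sub_distrib, map_sum, map_smul]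
      have h4 : ∑ a, b.coord a v • b a = v := b.sum_repr v
      rw [h3, h4, h1, map_zero, sub_zero]
    have h5 := congrArg (fromCoord I p q) h2
    rw [hX', map_sum] at h5
    refine h5.trans (Finset.sum_congr rfl fun a _ => ?_)
    beta_reduce
    rw [hρ1, one_smul, hPw q ⟨hqC, hqW⟩, map_smul]
    rfl

end Generators

/-! ### Bases of constraints and their pullbacks. -/

section ConstraintBasis

variable {V H N : Type*} [NormedAddCommGroup V] [NormedSpace ℝ V] [FiniteDimensional ℝ V]
  [TopologicalSpace H]
  (I : ModelWithCorners ℝ V H) [I.Boundaryless] [TopologicalSpace N] [ChartedSpace H N]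
  [IsManifold I ∞ N]
  {V' H' N' : Type*} [NormedAddCommGroup V'] [NormedSpace ℝ V'] [FiniteDimensional ℝ V']
  [TopologicalSpace H']
  (I' : ModelWithCorners ℝ V' H') [I'.Boundaryless] [TopologicalSpace N'] [ChartedSpace H' N']
  [IsManifold I' ∞ N']
  {F : Set N} {f : N → N'} {T : Set N'}
  {η : ∀ x : N, TangentSpace I x →L[ℝ] ℝ}
  {Ω : ∀ x : N, TangentSpace I x →L[ℝ] TangentSpace I x →L[ℝ] ℝ}
  {η' : ∀ x : N', TangentSpace I' x →L[ℝ] ℝ}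
  {Ω' : ∀ x : N', TangentSpace I' x →L[ℝ] TangentSpace I' x →L[ℝ] ℝ}
  {Y : ∀ x : N, TangentSpace I x} {Y' : ∀ x : N', TangentSpace I' x}

/-- Finitely many functions have a subfamily which generates them all near a given point of `C`,
and of which no member is there a combination of the other ones. -/
lemma exists_minimal_generators (C : Set N) (p : N) {m : ℕ} (ψ : Fin m → N → ℝ) :
    ∃ (r : ℕ) (e : Fin r → Fin m) (U : Set N), IsOpen U ∧ p ∈ U ∧
      (∀ a, ∃ c : Fin r → N → ℝ, (∀ j, ContMDiffOn I 𝓘(ℝ, ℝ) ∞ (c j) (C ∩ U)) ∧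
        ∀ z ∈ C ∩ U, ψ a z = ∑ j, c j z * ψ (e j) z) ∧
      ∀ j, ¬ ∃ (W : Set N) (a : Fin r → N → ℝ), IsOpen W ∧ p ∈ W ∧
        (∀ k, ContMDiffOn I 𝓘(ℝ, ℝ) ∞ (a k) (C ∩ W)) ∧
        ∀ z ∈ C ∩ W, ψ (e j) z = ∑ k ∈ Finset.univ.erase j, a k z * ψ (e k) z := by
  classical
  have hex : ∃ r, ∃ (e : Fin r → Fin m) (U : Set N), IsOpen U ∧ p ∈ U ∧
      ∀ a, ∃ c : Fin r → N → ℝ, (∀ j, ContMDiffOn I 𝓘(ℝ, ℝ) ∞ (c j) (C ∩ U)) ∧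
        ∀ z ∈ C ∩ U, ψ a z = ∑ j, c j z * ψ (e j) z :=
    ⟨m, id, univ, isOpen_univ, mem_univ p, fun a => ⟨fun j _ => if j = a then 1 else 0,
      fun j => contMDiffOn_const, fun z _ => by simp⟩⟩
  -- A generating subfamily with the fewest members, over all neighbourhoods of `p`.
  obtain ⟨e, U, hU, hpU, hgen⟩ := Nat.find_spec hex
  have hmin := fun r hr => Nat.find_min (m := r) hex hr
  generalize Nat.find hex = r at e hgen hmin
  refine ⟨r, e, U, hU, hpU, hgen, ?_⟩
  rintro j ⟨W, a, hW, hpW, ha, haψ⟩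
  obtain _ | r := r
  · exact j.elim0
  -- A redundant member can be substituted away on a smaller neighbourhood, which contradicts
  -- minimality.
  refine hmin r (Nat.lt_succ_self r) ⟨fun k => e (j.succAbove k), U ∩ W, hU.inter hW, ⟨hpU, hpW⟩,
    fun b => ?_⟩
  obtain ⟨c, hc, hcψ⟩ := hgen b
  refine ⟨fun k z => c (j.succAbove k) z + c j z * a (j.succAbove k) z, fun k => ?_, ?_⟩
  · have h1 : C ∩ (U ∩ W) ⊆ C ∩ U := fun z hz => ⟨hz.1, hz.2.1⟩
    have h2 : C ∩ (U ∩ W) ⊆ C ∩ W := fun z hz => ⟨hz.1, hz.2.2⟩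
    exact ((hc _).mono h1).add (((hc j).mono h1).mul ((ha _).mono h2))
  · rintro z ⟨hzC, hzU, hzW⟩
    have h1 := haψ z ⟨hzC, hzW⟩
    rw [Finset.sum_erase_eq_sub (Finset.mem_univ j), Fin.sum_univ_succAbove _ j,
      add_sub_cancel_left] at h1
    rw [hcψ z ⟨hzC, hzU⟩, Fin.sum_univ_succAbove _ j, h1, Finset.mul_sum,
      ← Finset.sum_add_distrib]
    exact Finset.sum_congr rfl fun k _ => by ring

omit [I.Boundaryless] in
lemma IsConstraintBasis.congr {C C' W : Set N} {x : N} {r : ℕ} {χ χ' : Fin r → N → ℝ}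
    (h : IsConstraintBasis I F η Ω Y C C' x W χ) (hC : C ⊆ F) (hχ : ∀ j, EqOn (χ' j) (χ j) F) :
    IsConstraintBasis I F η Ω Y C C' x W χ' := by
  obtain ⟨h1, h2, h3, h4⟩ := h
  refine ⟨fun j => ?_, fun ψ hψ => ?_, ?_, ?_⟩
  · obtain ⟨Z, hZ, hZC, hZψ⟩ := h1 j
    exact ⟨Z, hZ, hZC, fun x hx => (hχ j hx).trans (hZψ x hx)⟩
  · obtain ⟨a, ha, haψ⟩ := h2 ψ hψ
    refine ⟨a, ha, fun z hz => (haψ z hz).trans (Finset.sum_congr rfl fun j _ => ?_)⟩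
    rw [hχ j (hC hz.1)]
  · rintro j ⟨W', a, hW', hx, ha, haψ⟩
    refine h3 j ⟨W', a, hW', hx, ha, fun z hz => ?_⟩
    rw [← hχ j (hC hz.1), haψ z hz]
    exact Finset.sum_congr rfl fun k _ => by rw [hχ k (hC hz.1)]
  · rw [h4]
    ext z
    refine and_congr_right fun hz => forall_congr' fun j => ?_
    rw [hχ j (hC hz.1)]

lemma IsRegularSubmanifold.eventually_finrank_tangentTo_eq {S : Set N}
    (hS : IsRegularSubmanifold I S) {p : N} (hp : p ∈ S) :
    ∀ᶠ q in 𝓝 p, q ∈ S →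
      Module.finrank ℝ (tangentTo I S q) = Module.finrank ℝ (tangentTo I S p) := by
  obtain ⟨c, U, g, hU, hpU, hg, hs, hz⟩ := hS p hp
  have h : ∀ q ∈ S ∩ U, Module.finrank ℝ (tangentTo I S q) = Module.finrank ℝ V - c := by
    rintro q ⟨hqS, hqU⟩
    have h1 : tangentTo I S q = LinearMap.ker (mfderiv I 𝓘(ℝ, Fin c → ℝ) g q).toLinearMap := by
      ext X
      exact mem_tangentTo_iff_mfderiv_eq_zero I hU hg hqU hqS (hs q hqU) hz X
    have h2 := finrank_ker_of_surjective (V := V) (F := Fin c → ℝ)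
      (A := mfderiv I 𝓘(ℝ, Fin c → ℝ) g q) (hs q hqU)
    rw [h1]
    refine h2.trans ?_
    simp
  filter_upwards [hU.mem_nhds hpU] with q hqU hqS
  rw [h q ⟨hqS, hqU⟩, h p ⟨hp, hpU⟩]

variable [T2Space N] [SigmaCompactSpace N] [T2Space N']

/-- A submersion intertwining the forms and the connections pulls back suitable local bases of
constraints to bases of constraints. -/
lemma exists_constraintBasis (hf : IsSubmersionBetween I I' f univ T) (hTf : T ⊆ range f)
    (hT : IsRegularSubmanifold I' T) (hηs : IsSmoothForm I' η') (hΩs : IsSmoothTwoForm I' Ω')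
    (hη : ∀ y X, η y X = η' (f y) (mfderiv I I' f y X))
    (hΩ : ∀ y X Z, Ω y X Z = Ω' (f y) (mfderiv I I' f y X) (mfderiv I I' f y Z))
    (hΩa : ∀ q X Z, Ω' q X Z = -Ω' q Z X)
    (hY' : IsConnectionField I' T η' Y') (hY : ∀ y, mfderiv I I' f y (Y y) = Y' (f y)) {i : ℕ}
    (hQ : IsRegularSubmanifold I' (constraintSet I' T η' Ω' i)) {s : ℕ}
    (hrk : ∀ y ∈ f ⁻¹' constraintSet I' T η' Ω' i, Module.finrank ℝ
      (orthTo I univ η Ω Y (f ⁻¹' constraintSet I' T η' Ω' i) y) = s)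
    {p : N'} (hp : p ∈ constraintSet I' T η' Ω' i) :
    ∃ (U : Set N') (r : ℕ) (χ : Fin r → N' → ℝ), IsOpen U ∧ p ∈ U ∧
      IsConstraintBasis I' T η' Ω' Y' (constraintSet I' T η' Ω' i)
        (constraintSet I' T η' Ω' (i + 1)) p U χ ∧
      ∀ y, f y = p → IsConstraintBasis I univ η Ω Y (f ⁻¹' constraintSet I' T η' Ω' i)
        (f ⁻¹' constraintSet I' T η' Ω' (i + 1)) y (f ⁻¹' U) (fun j z => χ j (f z)) := by
  have hsucc : ∀ q ∈ T, q ∈ constraintSet I' T η' Ω' (i + 1) ↔ _ := fun q hq =>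
    mem_constraintSet_succ_iff I' (i := i) (hΩa q) (hY'.1.2 q hq) (hY'.2 q hq)
  have hQT : constraintSet I' T η' Ω' i ⊆ T := constraintSet_subset I' i
  set Q := constraintSet I' T η' Ω' i with hQdef
  have hfs := hf.contMDiff
  have horth := fun {y : N} (hy : f y ∈ Q) Z => mem_orthTo_preimage_iff I I' hf hT hη hΩ hY hQ hQT hy Z
  have hrk' : ∀ᶠ q in 𝓝 p, q ∈ Q → Module.finrank ℝ (orthTo I' T η' Ω' Y' Q q) =
      Module.finrank ℝ (orthTo I' T η' Ω' Y' Q p) := by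
    -- The kernel of `f_*` has dimension `dim V` minus the dimension of the tangent space of `T`.
    -- Eliminating it from the two dimension formulas transfers the constant rank from `N` to `Q`,
    -- locally, where the dimension of `T` is constant.
    have key : ∀ q ∈ Q, s + Module.finrank ℝ (tangentTo I' T q) =
        Module.finrank ℝ V + Module.finrank ℝ (orthTo I' T η' Ω' Y' Q q) := by
      intro q hq
      obtain ⟨y, rfl⟩ := hTf (hQT hq)
      have h1 := finrank_tangentTo_preimage I I' hf (P := orthTo I univ η Ω Y (f ⁻¹' Q) y)
        (orthTo_le I' Q (f y)) (horth hq)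
      have h2 := finrank_tangentTo_preimage I I' hf (y := y) (P := ⊤) le_rfl (fun X =>
        iff_of_true trivial ((hf.mem_tangentTo_iff I I' y _).2 ⟨X, rfl⟩))
      rw [hrk y hq] at h1
      rw [finrank_top] at h2
      change Module.finrank ℝ V = _ at h2
      omega
    filter_upwards [hT.eventually_finrank_tangentTo_eq I' (hQT hp)] with q hq hqQ
    have h1 := key q hqQ
    have h2 := key p hp
    rw [hq (hQT hqQ)] at h1
    omega
  obtain ⟨m, Z, U₁, c, hU₁, hpU₁, hU₁s, hZ, hZQ, hgen⟩ :=
    exists_orthTo_generators I' hT hηs hΩs hY'.1 hQ hQT hp hrk'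
  set ψ : Fin m → N' → ℝ := fun a q => η' q (Z a q) - Ω' q (Y' q) (Z a q) with hψ
  obtain ⟨r, e, U₂, hU₂, hpU₂, hg, hmin⟩ := exists_minimal_generators I' Q p ψ
  choose d hds hdψ using hg
  set U := U₁ ∩ U₂ with hU
  -- The formula holds for single vectors, with coefficients linear in the coordinates of `X`. It
  -- thus applies both to vector fields on `T` and to vectors pushed forward from `N`.
  have hcomb : ∀ q ∈ Q ∩ U, ∀ X ∈ orthTo I' T η' Ω' Y' Q q, η' q X - Ω' q (Y' q) X =
      ∑ j, (∑ a, c a (toCoord I' p q X) * d a j q) * ψ (e j) q := by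
    rintro q ⟨hqQ, hq1, hq2⟩ X hX
    set k : Fin m → ℝ := fun a => c a (toCoord I' p q X) with hk
    have h1 : X = ∑ a, k a • Z a q := hgen q ⟨hqQ, hq1⟩ X hX
    have h2 : η' q X - Ω' q (Y' q) X = ∑ a, k a * ψ a q := by
      have h3 := congrArg (fun X => (η' q - Ω' q (Y' q)) X) h1
      simp only [map_sum, map_smul, smul_eq_mul] at h3
      exact h3
    rw [h2]
    have h4 : ∀ a, ψ a q = ∑ j, d a j q * ψ (e j) q := fun a => hdψ a q ⟨hqQ, hq2⟩
    have h5 : ∑ a, k a * ψ a q = ∑ a, ∑ j, k a * d a j q * ψ (e j) q :=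
      Finset.sum_congr rfl fun a _ => by
        rw [h4 a, Finset.mul_sum]
        exact Finset.sum_congr rfl fun j _ => by ring
    rw [h5, Finset.sum_comm]
    exact Finset.sum_congr rfl fun j _ => by rw [Finset.sum_mul]
  have hzero : constraintSet I' T η' Ω' (i + 1) ∩ U = {z ∈ Q ∩ U | ∀ j, ψ (e j) z = 0} := by
    ext q
    constructor
    · rintro ⟨hq, hqU⟩
      have h1 := (hsucc q (constraintSet_subset I' _ hq)).1 hq
      exact ⟨⟨h1.1, hqU⟩, fun j => h1.2 _ (hZQ (e j) q h1.1)⟩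
    · rintro ⟨⟨hqQ, hqU⟩, hq⟩
      refine ⟨(hsucc q (hQT hqQ)).2 ⟨hqQ, fun X hX => ?_⟩, hqU⟩
      rw [hcomb q ⟨hqQ, hqU⟩ X hX]
      exact Finset.sum_eq_zero fun j _ => by rw [hq j, mul_zero]
  refine ⟨U, r, fun j => ψ (e j), hU₁.inter hU₂, ⟨hpU₁, hpU₂⟩,
    ⟨fun j => ⟨Z (e j), hZ _, hZQ _, fun q _ => rfl⟩, ?_, hmin, hzero⟩,
    fun y hy => ⟨fun j => ?_, ?_, ?_, ?_⟩⟩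
  · rintro φ ⟨X, hX, hXQ, hφ⟩
    refine ⟨fun j q => ∑ a, c a (toCoord I' p q (X q)) * d a j q, fun j => ?_, fun q hq => ?_⟩
    · have h1 : ContMDiffOn I' 𝓘(ℝ, V') ∞ (fun q => toCoord I' p q (X q)) (Q ∩ U) :=
        (contMDiffOn_section_iff_toCoord p fun q hq => hU₁s hq.2.1).1
          (hX.1.mono fun q hq => hQT hq.1)
      refine contMDiffOn_finsetSum fun a _ => ?_
      exact ((c a).contMDiff.comp_contMDiffOn h1).mul
        ((hds a j).mono fun q hq => ⟨hq.1, hq.2.2⟩)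
    · rw [hφ q (hQT hq.1)]
      exact hcomb q hq _ (hXQ q hq.1)
  -- The pullback of a constraint is a constraint because its vector field lifts, and the lift takes
  -- values in the orthogonal spaces.
  · obtain ⟨W, hW, hWZ⟩ := exists_lift hf hT (hZ (e j))
    refine ⟨W, hW, fun z hz => (horth hz _).2 ?_, fun z _ => ?_⟩
    · rw [hWZ]
      exact hZQ _ _ hz
    · rw [hη, hΩ, hY, hWZ]
  · rintro φ ⟨X, hX, hXQ, hφ⟩
    -- The field `X` need not project to a field on `T`. It is pushed forward point by point, so the
    -- coefficients are functions on `N`.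
    refine ⟨fun j z => ∑ a, c a (toCoord I' p (f z) (mfderiv I I' f z (X z))) * d a j (f z),
      fun j => ?_, fun z hz => ?_⟩
    · have h1 : ContMDiffOn I I'.tangent ∞ (fun z => tangentMap I I' f ⟨z, X z⟩)
          (f ⁻¹' Q ∩ f ⁻¹' U) :=
        (contMDiffOn_tangentMap I' isOpen_univ hfs.contMDiffOn).comp
          (hX.1.mono (subset_univ _)) fun z _ => trivial
      have h2 := ((contMDiffOn_iff_toCoord I p fun z hz => hU₁s hz.2.1).1 h1).2
      refine contMDiffOn_finsetSum fun a _ => ?_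
      exact ((c a).contMDiff.comp_contMDiffOn h2).mul
        ((hds a j).comp hfs.contMDiffOn fun z hz => ⟨hz.1, hz.2.2⟩)
    · rw [hφ z trivial, hη, hΩ, hY]
      exact hcomb (f z) hz _ ((horth hz.1 _).1 (hXQ z hz.1))
  · rintro j ⟨W, a, hW, hyW, ha, haψ⟩
    -- A section through the given `y` turns a redundancy near `y` into one near `p`; this gives
    -- minimality at each point of the fibre.
    obtain ⟨O, σ, hO, hyO, hσ, hσy, hfσ⟩ := exists_local_section I I' hf hT y
    refine hmin j ⟨O ∩ σ ⁻¹' W, fun k q => a k (σ q), hσ.continuousOn.isOpen_inter_preimage hO hW,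
      ⟨hy ▸ hyO, ?_⟩, fun k => ?_, fun q hq => ?_⟩
    · rw [mem_preimage, ← hy, hσy]
      exact hyW
    · refine (ha k).comp (hσ.mono fun q hq => hq.2.1) fun q hq => ⟨?_, hq.2.2⟩
      rw [mem_preimage, hfσ q ⟨hQT hq.1, hq.2.1⟩]
      exact hq.1
    · have h1 := hfσ q ⟨hQT hq.1, hq.2.1⟩
      have h2 := haψ (σ q) ⟨by rw [mem_preimage, h1]; exact hq.1, hq.2.2⟩
      simpa only [h1] using h2
  · ext z
    exact Set.ext_iff.1 hzero (f z)

end ConstraintBasis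

/-! ### Separation in total spaces of bundles. -/

section Topology

/-- Points over the same base point are separated in a trivialization, the others in the base. -/
lemma t2Space_totalSpace {B F : Type*} (E : B → Type*) [TopologicalSpace B] [TopologicalSpace F]
    [T2Space B] [T2Space F] [TopologicalSpace (TotalSpace F E)] [∀ b, TopologicalSpace (E b)]
    [FiberBundle F E] : T2Space (TotalSpace F E) := by
  refine ⟨fun x y hxy => ?_⟩
  by_cases h : x.proj = y.proj
  · set e := trivializationAt F E x.proj with he
    have hx : x ∈ e.source := e.mem_source.2 (FiberBundle.mem_baseSet_trivializationAt' x.proj)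
    have hy : y ∈ e.source :=
      e.mem_source.2 (h ▸ FiberBundle.mem_baseSet_trivializationAt' x.proj)
    obtain ⟨u, v, hu, hv, hxu, hyv, huv⟩ := t2_separation
      (show e x ≠ e y from fun h1 => hxy (e.injOn hx hy h1))
    refine ⟨_, _, e.continuousOn_toFun.isOpen_inter_preimage e.open_source hu,
      e.continuousOn_toFun.isOpen_inter_preimage e.open_source hv, ⟨hx, hxu⟩, ⟨hy, hyv⟩, ?_⟩
    exact (huv.preimage e).mono inter_subset_right inter_subset_right
  · obtain ⟨u, v, hu, hv, hxu, hyv, huv⟩ := t2_separation h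
    have hc := FiberBundle.continuous_proj F E
    exact ⟨_, _, hu.preimage hc, hv.preimage hc, hxu, hyv, huv.preimage _⟩

end Topology

/-! ### Topology of J¹E and T^*E, smooth forms, and pullback by the Legendre map. -/

namespace FiberedManifold

variable {n : ℕ} {E B : Type*}
    [TopologicalSpace E] [ChartedSpace (EuclideanSpace ℝ (Fin (n + 1))) E]
    [IsManifold (𝓡 (n + 1)) ∞ E]
    [TopologicalSpace B] [ChartedSpace ℝ B] [IsManifold 𝓘(ℝ, ℝ) ∞ B]
    (Φ : FiberedManifold n E B)

instance [T2Space E] : T2Space Φ.Cotangent :=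
  t2Space_totalSpace (fun e : E => TangentSpace (𝓡 (n + 1)) e →L[ℝ] Bundle.Trivial E ℝ e)

instance [T2Space E] : T2Space Φ.J1 := by
  have : T2Space (TangentBundle (𝓡 (n + 1)) E) := t2Space_totalSpace _
  exact T2Space.of_injective_continuous (f := J1.toTangent) (fun _ _ => J1.ext)
    Φ.continuous_toTangent

/-- Countably many chart domains cover `E`, hence J¹E, which becomes second countable; it is locally
compact as well. Partitions of unity on J¹E depend on this. -/
instance [SigmaCompactSpace E] : SigmaCompactSpace Φ.J1 := by
  obtain ⟨s, hs, hsU⟩ := LindelofSpace.elim_nhds_subcover (X := E) Φ.chartBase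
    fun e => (Φ.isOpen_chartBase e).mem_nhds (Φ.mem_chartBase e)
  let σ : E → Φ.J1 := fun e => ⟨⟨e, (Classical.choice (Φ.nonempty_fiber e)).1⟩,
    (Classical.choice (Φ.nonempty_fiber e)).2⟩
  have h1 : SecondCountableTopology Φ.J1 :=
    ChartedSpace.secondCountable_of_countable_cover
      (EuclideanSpace ℝ (Fin (n + 1)) × EuclideanSpace ℝ (Fin n)) (s := σ '' s)
      (eq_univ_of_forall fun y => by
        obtain ⟨e, he, hye⟩ := mem_iUnion₂.1 (hsU.symm.subset (mem_univ y.toTangent.proj))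
        exact mem_iUnion₂.2 ⟨σ e, mem_image_of_mem σ he, hye⟩) (hs.image σ)
  have h2 : LocallyCompactSpace Φ.J1 := ChartedSpace.locallyCompactSpace
    (EuclideanSpace ℝ (Fin (n + 1)) × EuclideanSpace ℝ (Fin n)) Φ.J1
  infer_instance

lemma contMDiff_toTangent : ContMDiff 𝓘(ℝ, J1Model n) (𝓡 (n + 1)).tangent ∞
    (J1.toTangent : Φ.J1 → TangentBundle (𝓡 (n + 1)) E) := by
  intro y
  have h1 := (contMDiffOn_chart (I := 𝓘(ℝ, J1Model n)) (n := ∞) (x := y))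
  have h2 := (Φ.contMDiffOn_chartInv y.toTangent.proj).comp h1
    (chartAt (J1Model n) y).mapsTo
  refine (h2.congr fun z hz => ?_).contMDiffAt ((chartAt (J1Model n) y).open_source.mem_nhds
    (mem_chart_source (J1Model n) y))
  exact (Φ.chartInv_chartFun y.toTangent.proj hz z.baseForm_eq_one).symm

lemma contMDiff_base : ContMDiff 𝓘(ℝ, J1Model n) (𝓡 (n + 1)) ∞ (J1.base : Φ.J1 → E) :=
  (Bundle.contMDiff_proj _).comp Φ.contMDiff_toTangent

lemma contMDiff_cotProj : ContMDiff (cotModel n) (𝓡 (n + 1)) ∞ (fun q : Φ.Cotangent => q.proj) :=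
  Bundle.contMDiff_proj (fun e : E => TangentSpace (𝓡 (n + 1)) e →L[ℝ] Bundle.Trivial E ℝ e)

lemma isSmoothForm_etaH : IsSmoothForm (cotModel n) Φ.etaH :=
  Φ.contMDiff_baseForm.comp (Φ.contMDiff_cotProj.contMDiff_tangentMap (m := ∞) (by simp))

lemma isSmoothForm_liouville : IsSmoothForm (cotModel n) Φ.liouville := by
  have hs : ContMDiff (cotModel n).tangent (cotModel n) ∞
      (fun v : TangentBundle (cotModel n) Φ.Cotangent =>
        TotalSpace.mk' (EuclideanSpace ℝ (Fin (n + 1)) →L[ℝ] ℝ)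
        (E := fun e : E => TangentSpace (𝓡 (n + 1)) e →L[ℝ] Bundle.Trivial E ℝ e)
        v.proj.proj v.proj.2) :=
    Bundle.contMDiff_proj (TangentSpace (cotModel n) : Φ.Cotangent → Type _)
  have hv : ContMDiff (cotModel n).tangent (𝓡 (n + 1)).tangent ∞
      (fun v : TangentBundle (cotModel n) Φ.Cotangent =>
        TotalSpace.mk' (EuclideanSpace ℝ (Fin (n + 1))) (E := fun e : E => TangentSpace (𝓡 (n + 1)) e)
        v.proj.proj (Φ.dCotProj v.proj v.2)) :=
    Φ.contMDiff_cotProj.contMDiff_tangentMap (m := ∞) (by simp)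
  have := ContMDiff.clm_bundle_apply (F₁ := EuclideanSpace ℝ (Fin (n + 1))) (F₂ := ℝ)
    (E₁ := fun e : E => TangentSpace (𝓡 (n + 1)) e) (E₂ := fun e : E => Bundle.Trivial E ℝ e)
    (ϕ := fun v : TangentBundle (cotModel n) Φ.Cotangent => v.proj.2) hs hv
  intro x
  exact (contMDiffAt_totalSpace.1 (this x)).2

variable {Φ} {ℓ : Φ.J1 → ℝ}

section Pullback

variable (hf : ContMDiff 𝓘(ℝ, J1Model n) (cotModel n) ∞ (extLegendre ℓ))
include hf

lemma dCotProj_dExtLegendre (y : Φ.J1) (X : TangentSpace 𝓘(ℝ, J1Model n) y) :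
    Φ.dCotProj (extLegendre ℓ y) (dExtLegendre ℓ y X) = dBase y X := by
  have h := mfderiv_comp y ((Φ.contMDiff_cotProj (extLegendre ℓ y)).mdifferentiableAt (by simp))
    ((hf y).mdifferentiableAt (by simp))
  exact (congrArg (fun g => g X) h).symm

lemma etaL_eq (y : Φ.J1) (X : TangentSpace 𝓘(ℝ, J1Model n) y) :
    Φ.etaL y X = Φ.etaH (extLegendre ℓ y) (dExtLegendre ℓ y X) :=
  congrArg (Φ.baseForm y.base) (dCotProj_dExtLegendre hf y X).symm

/-- The defining property `extLegendre_apply` is this pullback formula, since `extLegendre` covers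
the identity of `E`. -/
lemma thetaL_eq (y : Φ.J1) :
    thetaL ℓ y = (Φ.liouville (extLegendre ℓ y)).comp (dExtLegendre ℓ y) := by
  ext X
  rw [← extLegendre_apply, ← dCotProj_dExtLegendre hf]
  rfl

lemma omegaL_eq (y : Φ.J1) (X Z : TangentSpace 𝓘(ℝ, J1Model n) y) :
    omegaL ℓ y X Z = Φ.omegaH (extLegendre ℓ y) (dExtLegendre ℓ y X) (dExtLegendre ℓ y Z) := by
  have h := extDer_pullback (cotModel n) ((hf y).of_le (by norm_cast))
    (θ := thetaL ℓ) (θ' := Φ.liouville) (Eventually.of_forall fun z => thetaL_eq hf z)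
    (((Φ.isSmoothForm_liouville.contDiffOn_chartForm _).contDiffAt
      ((extHomeo_target (cotModel n) (extLegendre ℓ y) ▸ (extHomeo (cotModel n) (extLegendre ℓ y)).open_target).mem_nhds
        (mem_extChartAt_target _))).differentiableAt (by simp)) X Z
  exact congrArg Neg.neg h

end Pullback

end FiberedManifold

/-! ### Auxiliary derivatives. -/

section

variable {V H N : Type*} [NormedAddCommGroup V] [NormedSpace ℝ V] [TopologicalSpace H]
  (I : ModelWithCorners ℝ V H) [TopologicalSpace N] [ChartedSpace H N]
  {V' H' N' : Type*} [NormedAddCommGroup V'] [NormedSpace ℝ V'] [TopologicalSpace H']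
  (I' : ModelWithCorners ℝ V' H') [TopologicalSpace N'] [ChartedSpace H' N']

lemma fderiv_apply_eq_of_eventuallyEq_clm {W : Type*} [NormedAddCommGroup W] [NormedSpace ℝ W]
    {θ : W → (W →L[ℝ] ℝ)} {K : W →L[ℝ] W →L[ℝ] ℝ} {z : W} (h : θ =ᶠ[𝓝 z] K) (X Y : W) :
    fderiv ℝ θ z X Y = K X Y := by
  rw [h.fderiv_eq, K.fderiv]

/-- This is the Liouville form in canonical coordinates: it depends linearly on the point, so its
derivative is itself. -/
lemma fderiv_eq_of_eventually_pairing {F : Type*} [NormedAddCommGroup F] [NormedSpace ℝ F]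
    {θ : F × (F →L[ℝ] ℝ) → (F × (F →L[ℝ] ℝ) →L[ℝ] ℝ)} {z : F × (F →L[ℝ] ℝ)}
    (h : ∀ᶠ z' in 𝓝 z, ∀ w, θ z' w = z'.2 w.1) (X Y : F × (F →L[ℝ] ℝ)) :
    fderiv ℝ θ z X Y = X.2 Y.1 := by
  let K : F × (F →L[ℝ] ℝ) →L[ℝ] (F × (F →L[ℝ] ℝ) →L[ℝ] ℝ) :=
    ((ContinuousLinearMap.compL ℝ (F × (F →L[ℝ] ℝ)) F ℝ).flip
      (ContinuousLinearMap.fst ℝ F (F →L[ℝ] ℝ))).comp (ContinuousLinearMap.snd ℝ F (F →L[ℝ] ℝ))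
  have h1 : θ =ᶠ[𝓝 z] K := by
    filter_upwards [h] with z' hz'
    exact ContinuousLinearMap.ext hz'
  exact fderiv_apply_eq_of_eventuallyEq_clm h1 X Y

lemma mfderiv_apply_congr (f : N → N') {x y : N} (h : x = y) (w : V) :
    (show V' from mfderiv I I' f x w) = (show V' from mfderiv I I' f y w) := by subst h; rfl

end

/-! ### The symplectic form of T^*E in canonical coordinates. -/

namespace FiberedManifold

variable {n : ℕ} {E B : Type*}
    [TopologicalSpace E] [ChartedSpace (EuclideanSpace ℝ (Fin (n + 1))) E]
    [IsManifold (𝓡 (n + 1)) ∞ E]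
    [TopologicalSpace B] [ChartedSpace ℝ B] [IsManifold 𝓘(ℝ, ℝ) ∞ B]
    (Φ : FiberedManifold n E B)

/-- The model space of `T^*E`. -/
abbrev CotModel (n : ℕ) : Type :=
  EuclideanSpace ℝ (Fin (n + 1)) × (EuclideanSpace ℝ (Fin (n + 1)) →L[ℝ] ℝ)

section Cotangent

lemma extChartAt_cotangent (p q : Φ.Cotangent) :
    extChartAt (cotModel n) p q =
      (extChartAt (𝓡 (n + 1)) p.proj q.proj, q.2.comp (fromCoord (𝓡 (n + 1)) p.proj q.proj)) := by
  have h1 := FiberBundle.extChartAt (IB := 𝓡 (n + 1))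
    (E := fun e : E => TangentSpace (𝓡 (n + 1)) e →L[ℝ] Bundle.Trivial E ℝ e) p
  refine (congrArg (fun χ : PartialEquiv Φ.Cotangent (CotModel n) => χ q) h1).trans ?_
  refine Prod.ext rfl ?_
  change ContinuousLinearMap.inCoordinates (EuclideanSpace ℝ (Fin (n + 1)))
    (fun e : E => TangentSpace (𝓡 (n + 1)) e) ℝ (fun e : E => Bundle.Trivial E ℝ e)
    p.proj q.proj p.proj q.proj q.2 = _
  rw [ContinuousLinearMap.inCoordinates]
  ext w
  have h2 := Bundle.Trivial.continuousLinearMapAt_trivialization ℝ E ℝ q.proj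
  exact congrArg (fun g : ℝ →L[ℝ] ℝ => g (q.2 (fromCoord (𝓡 (n + 1)) p.proj q.proj w))) h2

lemma mem_chart_cotangent (p q : Φ.Cotangent) (hq : q ∈ (extChartAt (cotModel n) p).source) :
    q.proj ∈ (chartAt (EuclideanSpace ℝ (Fin (n + 1))) p.proj).source := by
  rw [extChartAt_source] at hq
  have h := FiberBundle.chartedSpace_chartAt (HB := EuclideanSpace ℝ (Fin (n + 1)))
    (E := fun e : E => TangentSpace (𝓡 (n + 1)) e →L[ℝ] Bundle.Trivial E ℝ e) p
  have hq' := hq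
  erw [h] at hq'
  exact hq'.2.1

lemma dCotProj_eq (p : Φ.Cotangent) :
    Φ.dCotProj p = (ContinuousLinearMap.fst ℝ _ _ : CotModel n →L[ℝ] _) := by
  refine HasMFDerivAt.mfderiv ⟨(Φ.contMDiff_cotProj p).continuousAt, ?_⟩
  refine (hasFDerivAt_fst.congr_of_eventuallyEq ?_).hasFDerivWithinAt
  filter_upwards [(extHomeo_target (cotModel n) p ▸ (extHomeo (cotModel n) p).open_target).mem_nhds
    (mem_extChartAt_target p)] with z hz
  have h1 := Φ.extChartAt_cotangent p ((extChartAt (cotModel n) p).symm z)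
  rw [(extChartAt (cotModel n) p).right_inv hz] at h1
  exact (congrArg Prod.fst h1).symm

/-- The form is p dq: in canonical coordinates the projection to `E` is `Prod.fst`, and the covector
is read in the trivialization given by the same chart of `E`. -/
lemma chartForm_liouville (p : Φ.Cotangent) {z : CotModel n}
    (hz : z ∈ (extChartAt (cotModel n) p).target) (w : CotModel n) :
    chartForm (cotModel n) Φ.liouville p z w = z.2 w.1 := by
  set χ := extChartAt (cotModel n) p with hχ
  set q := χ.symm z with hq
  have hqs : q ∈ χ.source := χ.map_target hz
  have hqE := Φ.mem_chart_cotangent p q hqs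
  have h1 : z = _ := (χ.right_inv hz).symm.trans (Φ.extChartAt_cotangent p q)
  have hop : IsOpen χ.target := extHomeo_target (cotModel n) p ▸ (extHomeo (cotModel n) p).open_target
  have hχs : ContMDiffAt 𝓘(ℝ, CotModel n) (cotModel n) ∞ χ.symm z :=
    (contMDiffOn_extChartAt_symm (I := cotModel n) (n := ∞) p).contMDiffAt (hop.mem_nhds hz)
  have h2 := mfderiv_comp z ((Φ.contMDiff_cotProj q).mdifferentiableAt (by simp))
    (hχs.mdifferentiableAt (by simp))
  have hz1 : z.1 ∈ (extChartAt (𝓡 (n + 1)) p.proj).target := by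
    rw [h1]
    exact (extChartAt (𝓡 (n + 1)) p.proj).map_source (by rwa [extChartAt_source])
  have h3 : ((fun q : Φ.Cotangent => q.proj) ∘ χ.symm) =ᶠ[𝓝 z]
      (extChartAt (𝓡 (n + 1)) p.proj).symm ∘ Prod.fst := by
    filter_upwards [hop.mem_nhds hz] with z' hz'
    have hs' := χ.map_target hz'
    have h1' : z' = _ := (χ.right_inv hz').symm.trans (Φ.extChartAt_cotangent p (χ.symm z'))
    have h4 := (extChartAt (𝓡 (n + 1)) p.proj).left_inv
      (by rw [extChartAt_source]; exact Φ.mem_chart_cotangent p _ hs')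
    have h5 := congrArg (fun z : CotModel n => (extChartAt (𝓡 (n + 1)) p.proj).symm z.1) h1'
    exact (h5.trans h4).symm
  have hE : MDifferentiableAt 𝓘(ℝ, EuclideanSpace ℝ (Fin (n + 1))) (𝓡 (n + 1))
      (extChartAt (𝓡 (n + 1)) p.proj).symm z.1 :=
    ((contMDiffOn_extChartAt_symm (I := 𝓡 (n + 1)) (n := ∞) p.proj).contMDiffAt
      ((extHomeo_target (𝓡 (n + 1)) p.proj ▸
        (extHomeo (𝓡 (n + 1)) p.proj).open_target).mem_nhds hz1)).mdifferentiableAt (by simp)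
  have h4 := mfderiv_comp (I := 𝓘(ℝ, CotModel n)) z hE
    differentiableAt_fst.mdifferentiableAt
  have h5 := h2.symm.trans (h3.mfderiv_eq.trans h4)
  have h7 : (fromCoord (𝓡 (n + 1)) p.proj q.proj w.1 : EuclideanSpace ℝ (Fin (n + 1))) =
      mfderiv 𝓘(ℝ, EuclideanSpace ℝ (Fin (n + 1))) (𝓡 (n + 1))
        (extChartAt (𝓡 (n + 1)) p.proj).symm z.1 w.1 := by
    rw [fromCoord_eq_mfderiv (I := 𝓡 (n + 1)) hqE]
    exact mfderiv_apply_congr 𝓘(ℝ, EuclideanSpace ℝ (Fin (n + 1))) (𝓡 (n + 1))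
      (extChartAt (𝓡 (n + 1)) p.proj).symm (congrArg Prod.fst h1).symm w.1
  have h8 : mfderiv 𝓘(ℝ, CotModel n) 𝓘(ℝ, EuclideanSpace ℝ (Fin (n + 1)))
      (Prod.fst : CotModel n → _) z w = w.1 := by
    rw [mfderiv_eq_fderiv, fderiv_fst]
    rfl
  have h9 : Φ.dCotProj q (mfderiv 𝓘(ℝ, CotModel n) (cotModel n) χ.symm z w) =
      fromCoord (𝓡 (n + 1)) p.proj q.proj w.1 := by
    refine (congrArg (fun g => g w) h5).trans (Eq.trans ?_ h7.symm)
    exact congrArg (mfderiv 𝓘(ℝ, EuclideanSpace ℝ (Fin (n + 1))) (𝓡 (n + 1))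
      (extChartAt (𝓡 (n + 1)) p.proj).symm z.1) h8
  have h10 : z.2 = q.2.comp (fromCoord (𝓡 (n + 1)) p.proj q.proj) := congrArg Prod.snd h1
  refine (congrArg q.2 h9).trans ?_
  rw [h10]
  rfl

/-- The canonical symplectic form in coordinates. -/
lemma omegaH_apply (p : Φ.Cotangent) (X Y : CotModel n) :
    Φ.omegaH p X Y = Y.2 X.1 - X.2 Y.1 := by
  have h1 := fderiv_eq_of_eventually_pairing (F := EuclideanSpace ℝ (Fin (n + 1)))
    (θ := chartForm (cotModel n) Φ.liouville p) (z := extChartAt (cotModel n) p p) (by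
      filter_upwards [(extHomeo_target (cotModel n) p ▸
        (extHomeo (cotModel n) p).open_target).mem_nhds (mem_extChartAt_target p)] with z hz w
      exact Φ.chartForm_liouville p hz w)
  refine (congrArg Neg.neg ((extDer_apply (cotModel n) Φ.liouville p X Y).trans
    (congrArg₂ (· - ·) (h1 X Y) (h1 Y X)))).trans ?_
  exact neg_sub _ _

lemma omegaH_swap (p : Φ.Cotangent) (X Y : TangentSpace (cotModel n) p) :
    Φ.omegaH p X Y = -Φ.omegaH p Y X :=
  congrArg Neg.neg (extDer_swap (cotModel n) Φ.liouville p X Y)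

/-- A vertical vector is determined by its contraction with the symplectic form. -/
lemma eq_zero_of_omegaH {p : Φ.Cotangent} {V : TangentSpace (cotModel n) p}
    (hV : Φ.dCotProj p V = 0) (h : ∀ w, ∃ W, Φ.dCotProj p W = w ∧ Φ.omegaH p V W = 0) : V = 0 := by
  have hfst : ∀ X : CotModel n, Φ.dCotProj p X = X.1 := fun X => by rw [dCotProj_eq]; rfl
  have hV1 : (show CotModel n from V).1 = 0 := (hfst V).symm.trans hV
  refine Prod.ext hV1 (ContinuousLinearMap.ext fun w => ?_)
  obtain ⟨W, hW, h0⟩ := h w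
  -- With `V` vertical, only the pairing of its covector part with the projection `w` of `W`
  -- survives, and `w` is arbitrary.
  have h1 := (Φ.omegaH_apply p V W).symm.trans h0
  have h2 : (show CotModel n from W).1 = w := (hfst W).symm.trans hW
  have h3 : (show CotModel n from W).2 (show CotModel n from V).1 = 0 := by rw [hV1, map_zero]
  have h4 : (show CotModel n from V).2 (show CotModel n from W).1 = 0 :=
    (sub_eq_zero.1 h1).symm.trans h3
  rw [h2] at h4
  exact h4

end Cotangent

end FiberedManifold

/-! ### Vertical vectors and velocities on J¹E. -/

namespace FiberedManifold

variable {n : ℕ} {E B : Type*}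
    [TopologicalSpace E] [ChartedSpace (EuclideanSpace ℝ (Fin (n + 1))) E]
    [IsManifold (𝓡 (n + 1)) ∞ E]
    [TopologicalSpace B] [ChartedSpace ℝ B] [IsManifold 𝓘(ℝ, ℝ) ∞ B]
    {Φ : FiberedManifold n E B}

section JetBundle

lemma hasMFDerivAt_chart_base (z : Φ.J1) :
    HasMFDerivAt 𝓘(ℝ, J1Model n) 𝓘(ℝ, EuclideanSpace ℝ (Fin (n + 1)))
      (fun y : Φ.J1 => extChartAt (𝓡 (n + 1)) z.base y.base) z
      (ContinuousLinearMap.fst ℝ _ _ : J1Model n →L[ℝ] _) := by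
  refine ⟨((continuousAt_extChartAt z.base).comp (Φ.contMDiff_base z).continuousAt), ?_⟩
  refine (hasFDerivAt_fst.congr_of_eventuallyEq ?_).hasFDerivWithinAt
  filter_upwards [(extHomeo_target 𝓘(ℝ, J1Model n) z ▸
    (extHomeo 𝓘(ℝ, J1Model n) z).open_target).mem_nhds (mem_extChartAt_target z)] with p hp
  exact congrArg Prod.fst ((extChartAt 𝓘(ℝ, J1Model n) z).right_inv hp)

lemma dBase_eq (z : Φ.J1) :
    dBase z = (ContinuousLinearMap.fst ℝ _ _ : J1Model n →L[ℝ] _) := by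
  refine HasMFDerivAt.mfderiv ⟨(Φ.contMDiff_base z).continuousAt, ?_⟩
  exact (hasMFDerivAt_chart_base z).2

lemma surjective_dBase (z : Φ.J1) : Surjective (dBase z) := by
  intro w
  refine ⟨((w, 0) : J1Model n), ?_⟩
  rw [dBase_eq]
  rfl

/-- The differential of `w ↦ z + (w - η(w) z)` at the origin, in the chart at `z`. -/
def shiftDeriv (z : Φ.J1) : EuclideanSpace ℝ (Fin (n + 1)) →L[ℝ] J1Model n :=
  (0 : EuclideanSpace ℝ (Fin (n + 1)) →L[ℝ] EuclideanSpace ℝ (Fin (n + 1))).prod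
    ((ContinuousLinearMap.snd ℝ ℝ (EuclideanSpace ℝ (Fin n))).comp
      ((Φ.splitting z.base : EuclideanSpace ℝ (Fin (n + 1)) →L[ℝ] ℝ × EuclideanSpace ℝ (Fin n)).comp
        ((show EuclideanSpace ℝ (Fin (n + 1)) →L[ℝ] EuclideanSpace ℝ (Fin (n + 1)) from
          toCoord (𝓡 (n + 1)) z.base z.base).comp
          (ContinuousLinearMap.id ℝ (EuclideanSpace ℝ (Fin (n + 1))) -
            (show EuclideanSpace ℝ (Fin (n + 1)) →L[ℝ] ℝ from Φ.baseForm z.base).smulRight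
              (show EuclideanSpace ℝ (Fin (n + 1)) from z.velocity)))))

lemma shiftDeriv_apply (z : Φ.J1) (w : TangentSpace (𝓡 (n + 1)) z.base) :
    shiftDeriv z w = (0, (Φ.splitting z.base
      (toCoord (𝓡 (n + 1)) z.base z.base (w - Φ.baseForm z.base w • z.velocity))).2) := rfl

lemma triv_eq_toCoord {e e' : E} (he : e' ∈ (chartAt (EuclideanSpace ℝ (Fin (n + 1))) e).source)
    (v : TangentSpace (𝓡 (n + 1)) e') :
    (Φ.triv e ⟨e', v⟩).2 = toCoord (𝓡 (n + 1)) e e' v := by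
  rw [toCoord, Trivialization.continuousLinearMapAt_apply, Trivialization.coe_linearMapAt_of_mem]
  exact he

lemma continuous_shift (z : Φ.J1) :
    Continuous (fun w : EuclideanSpace ℝ (Fin (n + 1)) => z.shift w) := by
  refine continuous_induced_rng.2 ?_
  have h1 : ∀ (β : EuclideanSpace ℝ (Fin (n + 1)) →L[ℝ] ℝ) (v : EuclideanSpace ℝ (Fin (n + 1))),
      Continuous (fun w : EuclideanSpace ℝ (Fin (n + 1)) => v + (w - β w • v)) := by
    intro β v
    fun_prop
  exact (FiberBundle.totalSpaceMk_isInducing (EuclideanSpace ℝ (Fin (n + 1)))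
    (TangentSpace (𝓡 (n + 1)) : E → Type _) z.base).continuous.comp
    (h1 (Φ.baseForm z.base) z.velocity)

/-- In the chart at `z` the base coordinates do not move and the fibre coordinates are affine in
`w`, with linear part `shiftDeriv z`. -/
lemma hasMFDerivAt_shift (z : Φ.J1) :
    HasMFDerivAt 𝓘(ℝ, EuclideanSpace ℝ (Fin (n + 1))) 𝓘(ℝ, J1Model n)
      (fun w : EuclideanSpace ℝ (Fin (n + 1)) => z.shift w) 0 (shiftDeriv z) := by
  refine ⟨(continuous_shift z).continuousAt, ?_⟩
  set c : J1Model n := (extChartAt (𝓡 (n + 1)) z.base z.base,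
    (Φ.splitting z.base (toCoord (𝓡 (n + 1)) z.base z.base z.velocity)).2) with hc
  have h1 : HasFDerivAt (fun w : EuclideanSpace ℝ (Fin (n + 1)) => c + shiftDeriv z w)
      (shiftDeriv z) 0 := (shiftDeriv z).hasFDerivAt.const_add c
  refine (h1.congr_of_eventuallyEq (Eventually.of_forall fun w => ?_)).hasFDerivWithinAt
  refine Prod.ext (add_zero _).symm ?_
  have h2 := triv_eq_toCoord (Φ := Φ) (mem_chart_source (EuclideanSpace ℝ (Fin (n + 1))) z.base)
    (z.velocity + ((show TangentSpace (𝓡 (n + 1)) z.base from w) -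
      Φ.baseForm z.base w • z.velocity))
  refine (congrArg (fun v => (Φ.splitting z.base v).2) h2).trans ?_
  rw [map_add, map_add]
  rfl

lemma vertLift_eq (z : Φ.J1) : vertLift z = shiftDeriv z := (hasMFDerivAt_shift z).mfderiv

lemma vertLift_velocity (z : Φ.J1) : vertLift z z.velocity = 0 := by
  have h : Φ.baseForm z.base z.velocity = 1 := z.baseForm_eq_one
  rw [vertLift_eq]
  refine (shiftDeriv_apply z z.velocity).trans ?_
  rw [h, one_smul, sub_self, map_zero, map_zero]
  rfl

/-- Every vertical vector of `J¹E` is the vertical lift of a `π`-vertical vector. -/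
lemma exists_vertLift_eq (z : Φ.J1) {X : TangentSpace 𝓘(ℝ, J1Model n) z} (hX : dBase z X = 0) :
    ∃ w, Φ.baseForm z.base w = 0 ∧ vertLift z w = X := by
  have hX1 : (show J1Model n from X).1 = 0 := by
    rw [dBase_eq] at hX
    exact hX
  set u := (show J1Model n from X).2 with hu
  have hmem := mem_chart_source (EuclideanSpace ℝ (Fin (n + 1))) z.base
  -- The first component of `splitting` is the form `baseForm`, so the entry 0 makes the vector
  -- π-vertical; `u` is the prescribed fibre part.
  refine ⟨fromCoord (𝓡 (n + 1)) z.base z.base ((Φ.splitting z.base).symm (0, u)), ?_, ?_⟩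
  · refine (Φ.splitting_fst z.base ((Φ.splitting z.base).symm (0, u))).symm.trans ?_
    rw [ContinuousLinearEquiv.apply_symm_apply]
  · have h0 : Φ.baseForm z.base (fromCoord (𝓡 (n + 1)) z.base z.base
        ((Φ.splitting z.base).symm (0, u))) = 0 := by
      refine (Φ.splitting_fst z.base ((Φ.splitting z.base).symm (0, u))).symm.trans ?_
      rw [ContinuousLinearEquiv.apply_symm_apply]
    rw [vertLift_eq]
    refine (shiftDeriv_apply z _).trans ?_
    rw [h0, zero_smul, sub_zero, toCoord_fromCoord hmem, ContinuousLinearEquiv.apply_symm_apply]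
    exact Prod.ext hX1.symm rfl

lemma shift_zero (z : Φ.J1) : z.shift (0 : EuclideanSpace ℝ (Fin (n + 1))) = z := by
  refine J1.ext ?_
  have h : z.velocity + ((0 : TangentSpace (𝓡 (n + 1)) z.base) -
      Φ.baseForm z.base (0 : TangentSpace (𝓡 (n + 1)) z.base) • z.velocity) = z.velocity := by
    rw [map_zero, zero_smul, sub_zero, add_zero]
  exact congrArg (TotalSpace.mk z.base) h

/-- The velocity of a jet, in the chart at `e`. -/
def coordVelocity (e : E) (z : Φ.J1) : EuclideanSpace ℝ (Fin (n + 1)) :=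
  toCoord (𝓡 (n + 1)) e z.base z.velocity

lemma contMDiffAt_coordVelocity {e : E} {z : Φ.J1}
    (hz : z.base ∈ (chartAt (EuclideanSpace ℝ (Fin (n + 1))) e).source) :
    ContMDiffAt 𝓘(ℝ, J1Model n) 𝓘(ℝ, EuclideanSpace ℝ (Fin (n + 1))) ∞ (coordVelocity e) z := by
  set O : Set Φ.J1 := J1.base ⁻¹' (chartAt (EuclideanSpace ℝ (Fin (n + 1))) e).source with hO
  have hOo : IsOpen O := (chartAt _ e).open_source.preimage Φ.contMDiff_base.continuous
  have h1 := (contMDiffOn_iff_toCoord (I := 𝓡 (n + 1)) 𝓘(ℝ, J1Model n) e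
    (Z := (J1.toTangent : Φ.J1 → TangentBundle (𝓡 (n + 1)) E)) (s := O) fun z hz => hz).1
    Φ.contMDiff_toTangent.contMDiffOn
  exact h1.2.contMDiffAt (hOo.mem_nhds hz)

/-- Along `w ↦ z.shift w` the base point is fixed, so the coordinate velocity is affine in `w`; the
chain rule then gives its derivative in vertical directions. -/
lemma mfderiv_coordVelocity_vertLift {e : E} {z : Φ.J1}
    (hz : z.base ∈ (chartAt (EuclideanSpace ℝ (Fin (n + 1))) e).source)
    (w : TangentSpace (𝓡 (n + 1)) z.base) :
    mfderiv 𝓘(ℝ, J1Model n) 𝓘(ℝ, EuclideanSpace ℝ (Fin (n + 1))) (coordVelocity e) z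
      (vertLift z w) =
      toCoord (𝓡 (n + 1)) e z.base (w - Φ.baseForm z.base w • z.velocity) := by
  set τ : Φ.J1 → EuclideanSpace ℝ (Fin (n + 1)) := coordVelocity e with hτ
  have h0 : z.shift (0 : EuclideanSpace ℝ (Fin (n + 1))) = z := shift_zero z
  have h1 : MDifferentiableAt 𝓘(ℝ, J1Model n) 𝓘(ℝ, EuclideanSpace ℝ (Fin (n + 1))) τ
      (z.shift (0 : EuclideanSpace ℝ (Fin (n + 1)))) := by
    rw [h0]
    exact (contMDiffAt_coordVelocity hz).mdifferentiableAt (by simp)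
  have h2 := h1.hasMFDerivAt.comp (0 : EuclideanSpace ℝ (Fin (n + 1))) (hasMFDerivAt_shift z)
  let D : EuclideanSpace ℝ (Fin (n + 1)) →L[ℝ] EuclideanSpace ℝ (Fin (n + 1)) :=
    (show EuclideanSpace ℝ (Fin (n + 1)) →L[ℝ] EuclideanSpace ℝ (Fin (n + 1)) from
      toCoord (𝓡 (n + 1)) e z.base).comp
      (ContinuousLinearMap.id ℝ (EuclideanSpace ℝ (Fin (n + 1))) -
        (show EuclideanSpace ℝ (Fin (n + 1)) →L[ℝ] ℝ from Φ.baseForm z.base).smulRight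
          (show EuclideanSpace ℝ (Fin (n + 1)) from z.velocity))
  have h3 : HasFDerivAt (fun w : EuclideanSpace ℝ (Fin (n + 1)) => coordVelocity e z + D w) D 0 :=
    D.hasFDerivAt.const_add _
  have h4 : τ ∘ (fun w : EuclideanSpace ℝ (Fin (n + 1)) => z.shift w) =
      fun w : EuclideanSpace ℝ (Fin (n + 1)) => coordVelocity e z + D w := by
    funext w
    exact map_add (toCoord (𝓡 (n + 1)) e z.base) _ _
  rw [h4] at h2
  have h5 := congrArg (fun g => g w) (hasMFDerivAt_unique h2 h3.hasMFDerivAt)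
  refine Eq.trans ?_ h5
  rw [vertLift_eq]
  exact (mfderiv_apply_congr 𝓘(ℝ, J1Model n) 𝓘(ℝ, EuclideanSpace ℝ (Fin (n + 1))) τ h0
    (shiftDeriv z w)).symm

end JetBundle

end FiberedManifold

/-! ### The kernel of the Legendre map and the injectivity of μ₀. -/

namespace FiberedManifold

variable {n : ℕ} {E B : Type*}
    [TopologicalSpace E] [ChartedSpace (EuclideanSpace ℝ (Fin (n + 1))) E]
    [IsManifold (𝓡 (n + 1)) ∞ E]
    [TopologicalSpace B] [ChartedSpace ℝ B] [IsManifold 𝓘(ℝ, ℝ) ∞ B]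
    {Φ : FiberedManifold n E B} {ℓ : Φ.J1 → ℝ}

/-- Both conditions on `X` factor through its image in T^*E. Conversely they make that image a
vertical vector orthogonal to the vectors `dExtLegendre ℓ y Z`, whose projections fill the tangent
space of `E`; nondegeneracy does the rest. -/
lemma dExtLegendre_eq_zero_iff (hf : ContMDiff 𝓘(ℝ, J1Model n) (cotModel n) ∞ (extLegendre ℓ))
    (y : Φ.J1) (X : TangentSpace 𝓘(ℝ, J1Model n) y) :
    dExtLegendre ℓ y X = 0 ↔ dBase y X = 0 ∧ omegaL ℓ y X = 0 := by
  constructor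
  · intro h
    refine ⟨by rw [← dCotProj_dExtLegendre hf, h, ContinuousLinearMap.map_zero]; rfl,
      ContinuousLinearMap.ext fun Z => ?_⟩
    rw [omegaL_eq hf, h, ContinuousLinearMap.map_zero]
    rfl
  · rintro ⟨h1, h2⟩
    refine Φ.eq_zero_of_omegaH ((dCotProj_dExtLegendre hf y X).trans h1) fun w => ?_
    obtain ⟨Z, hZ⟩ := surjective_dBase y w
    refine ⟨dExtLegendre ℓ y Z, (dCotProj_dExtLegendre hf y Z).trans hZ, ?_⟩
    rw [← omegaL_eq hf, h2]
    rfl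

lemma baseForm_eq_zero_iff (e : E) (w : TangentSpace (𝓡 (n + 1)) e) :
    Φ.baseForm e w = 0 ↔ mfderiv (𝓡 (n + 1)) 𝓘(ℝ, ℝ) Φ.proj e w = 0 := by
  constructor
  · intro h
    have h1 : ∀ L : ℝ →L[ℝ] ℝ, L ≠ 0 → ∀ r, L r = 0 → r = 0 := by
      intro L hL r hr
      by_contra hr0
      refine hL (ContinuousLinearMap.ext fun s => ?_)
      have : s = (s / r) • r := by rw [smul_eq_mul, div_mul_cancel₀ _ hr0]
      rw [this, map_smul, hr, smul_zero]
      rfl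
    exact h1 (Φ.vol (Φ.proj e)) (Φ.vol_ne_zero _) _ h
  · intro h
    change Φ.vol (Φ.proj e) (mfderiv (𝓡 (n + 1)) 𝓘(ℝ, ℝ) Φ.proj e w) = 0
    rw [h, map_zero]

lemma extLegendre_snd_apply (y : Φ.J1) (w : TangentSpace (𝓡 (n + 1)) y.base) :
    (extLegendre ℓ y).2 w = dAt 𝓘(ℝ, J1Model n) ℓ y (vertLift y w) + ℓ y * Φ.baseForm y.base w :=
  rfl

/-- μ forgets the value of a covector on one transversal vector; on the velocity of the jet this
value is the Lagrangian itself. -/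
lemma extLegendre_snd_velocity (y : Φ.J1) : (extLegendre ℓ y).2 y.velocity = ℓ y := by
  have h : Φ.baseForm y.base y.velocity = 1 := y.baseForm_eq_one
  refine (extLegendre_snd_apply y y.velocity).trans ?_
  rw [vertLift_velocity, map_zero, h, zero_add, mul_one]

lemma eq_of_mu_eq {p q : Φ.Cotangent} (h : Φ.mu p = Φ.mu q) : p.proj = q.proj ∧
    ∀ w : EuclideanSpace ℝ (Fin (n + 1)), Φ.baseForm p.proj w = 0 →
      (p.2 : EuclideanSpace ℝ (Fin (n + 1)) → ℝ) w = q.2 w := by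
  obtain ⟨e, a⟩ := p
  obtain ⟨e', b⟩ := q
  obtain rfl : e = e' := congrArg Sigma.fst h
  refine ⟨rfl, fun w hw => ?_⟩
  have h1 := (Submodule.Quotient.eq _).1 (eq_of_heq (Sigma.mk.inj h).2)
  exact sub_eq_zero.1 (h1 w ((baseForm_eq_zero_iff e w).1 hw))

lemma fromCoord_toCoord_of_eq {e e' : E} (h : e' = e) (v : EuclideanSpace ℝ (Fin (n + 1))) :
    (fromCoord (𝓡 (n + 1)) e e (toCoord (𝓡 (n + 1)) e e' v) :
      EuclideanSpace ℝ (Fin (n + 1))) = v := by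
  subst h
  exact fromCoord_toCoord (mem_chart_source _ _) _

lemma cotangent_ext {p q : Φ.Cotangent} (h : p.proj = q.proj)
    (h2 : ∀ w : EuclideanSpace ℝ (Fin (n + 1)),
      (p.2 : EuclideanSpace ℝ (Fin (n + 1)) → ℝ) w = q.2 w) : p = q := by
  obtain ⟨e, a⟩ := p
  obtain ⟨e', b⟩ := q
  obtain rfl : e = e' := h
  exact congrArg (TotalSpace.mk e) (ContinuousLinearMap.ext h2)

/-- The extended Legendre map is constant along the fibres of the restricted one. -/
lemma extLegendre_eq_of_legendre_eq (hℓ : ContMDiff 𝓘(ℝ, J1Model n) 𝓘(ℝ, ℝ) ∞ ℓ)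
    (hreg : IsAlmostRegular ℓ) {y z : Φ.J1} (hyz : legendre ℓ z = legendre ℓ y) :
    extLegendre ℓ z = extLegendre ℓ y := by
  set S : Set Φ.J1 := legendre ℓ ⁻¹' {legendre ℓ y} with hS
  set p : Φ.Cotangent := extLegendre ℓ y with hp
  have hmem : ∀ {z'}, z' ∈ S → z'.base = y.base ∧ ∀ w : EuclideanSpace ℝ (Fin (n + 1)),
      Φ.baseForm z'.base w = 0 →
      ((extLegendre ℓ z').2 : EuclideanSpace ℝ (Fin (n + 1)) → ℝ) w = p.2 w :=
    fun hz' => eq_of_mu_eq hz'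
  have hmemc : ∀ {z'}, z' ∈ S → z'.base ∈
      (chartAt (EuclideanSpace ℝ (Fin (n + 1))) y.base).source := fun hz' => by
    rw [(hmem hz').1]
    exact mem_chart_source _ _
  let a : EuclideanSpace ℝ (Fin (n + 1)) →L[ℝ] ℝ :=
    (show EuclideanSpace ℝ (Fin (n + 1)) →L[ℝ] ℝ from p.2.comp (fromCoord (𝓡 (n + 1)) y.base y.base))
  have ha : ∀ {z'}, z' ∈ S → ∀ w : EuclideanSpace ℝ (Fin (n + 1)),
      a (toCoord (𝓡 (n + 1)) y.base z'.base w) = p.2 w := fun hz' w =>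
    congrArg p.2 (fromCoord_toCoord_of_eq (hmem hz').1 w)
  -- On the fibre this is ℓ minus the fixed covector `p` applied to the velocity. The chart
  -- expression `a` of `p` extends it smoothly to jets over nearby points of `E`.
  set h : Φ.J1 → ℝ := fun z' => ℓ z' - a (coordVelocity y.base z') with hh
  have hv : ∀ {z'}, z' ∈ S → MDifferentiableAt 𝓘(ℝ, J1Model n) 𝓘(ℝ, EuclideanSpace ℝ (Fin (n + 1)))
      (coordVelocity y.base) z' := fun hz' =>
    (contMDiffAt_coordVelocity (hmemc hz')).mdifferentiableAt (by simp)
  have hyS : y ∈ S := rfl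
  have hzS : z ∈ S := hyz
  have hconst : h z = h y := by
    refine eqOn_of_dAt_eq_zero 𝓘(ℝ, J1Model n) (hreg.regular_fiber y)
      (hreg.connected_fiber y).isPreconnected (fun z' hz' => ?_) (fun z' hz' X hX => ?_) hzS hyS
    · exact (hℓ z').sub (a.contMDiff.contMDiffAt.comp z' (contMDiffAt_coordVelocity (hmemc hz')))
    -- The fibre lies over one point of `E`, so its tangent vectors are vertical.
    · have hX0 : dBase z' X = 0 := by
        have h1 := hasMFDerivAt_chart_base z'
        have h2 : ContMDiffAt 𝓘(ℝ, J1Model n) 𝓘(ℝ, EuclideanSpace ℝ (Fin (n + 1))) ∞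
            (fun y : Φ.J1 => extChartAt (𝓡 (n + 1)) z'.base y.base -
              extChartAt (𝓡 (n + 1)) z'.base z'.base) z' :=
          (contMDiffAt_extChartAt.comp z' (Φ.contMDiff_base z')).sub contMDiffAt_const
        have h3 := mfderiv_eq_zero_of_mem_tangentTo 𝓘(ℝ, J1Model n) h2
          (eventually_nhdsWithin_of_forall fun z'' hz'' => by
            rw [(hmem hz'').1, (hmem hz').1, sub_self]) hX
        have h4 := (h1.sub (hasMFDerivAt_const
          (extChartAt (𝓡 (n + 1)) z'.base z'.base) z')).mfderiv
        have h5 := (congrArg (fun g => g X) h4).symm.trans h3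
        rw [dBase_eq]
        exact (sub_zero (show J1Model n from X).1).symm.trans h5
      -- For the lift of a π-vertical `w`, the derivative of ℓ is `(extLegendre ℓ z').2 w`, which
      -- equals `p.2 w` on the fibre; this is also the derivative of `p` applied to the velocity.
      obtain ⟨w, hw0, rfl⟩ := exists_vertLift_eq z' hX0
      have h1 : dAt 𝓘(ℝ, J1Model n) h z' (vertLift z' w) =
          dAt 𝓘(ℝ, J1Model n) ℓ z' (vertLift z' w) -
            a (mfderiv 𝓘(ℝ, J1Model n) 𝓘(ℝ, EuclideanSpace ℝ (Fin (n + 1)))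
              (coordVelocity y.base) z' (vertLift z' w)) := by
        rw [← mfderiv_clm_comp 𝓘(ℝ, J1Model n) (hv hz')]
        have h2 := mfderiv_sub ((hℓ z').mdifferentiableAt (by simp))
          ((a.contMDiff.contMDiffAt (n := 1).mdifferentiableAt (by simp)).comp z' (hv hz'))
        exact congrArg (fun g => g (vertLift z' w)) h2
      have h2 := (extLegendre_snd_apply (ℓ := ℓ) z' w).symm.trans ((hmem hz').2 w hw0)
      rw [hw0, mul_zero, add_zero] at h2
      have h3 := mfderiv_coordVelocity_vertLift (hmemc hz') w
      rw [hw0, zero_smul, sub_zero] at h3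
      rw [h1, h2, h3]
      exact sub_eq_zero.2 (ha hz' w).symm
  have hval : ∀ {z'}, z' ∈ S → h z' = ℓ z' - p.2 (z'.velocity : EuclideanSpace ℝ (Fin (n + 1))) :=
    fun hz' => congrArg (fun r => ℓ _ - r) (ha hz' _)
  -- So `h` vanishes on the whole fibre: both covectors take the value `ℓ z` on the velocity of `z`.
  -- They already agree on π-vertical vectors, and together these span.
  have hy0 : h y = 0 := by
    rw [hval hyS]
    exact sub_eq_zero.2 (extLegendre_snd_velocity y).symm
  rw [hy0, hval hzS, sub_eq_zero] at hconst
  refine cotangent_ext (hmem hzS).1 fun w => ?_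
  set β : EuclideanSpace ℝ (Fin (n + 1)) →L[ℝ] ℝ := Φ.baseForm z.base with hβ
  set v : EuclideanSpace ℝ (Fin (n + 1)) := z.velocity with hv
  set b : EuclideanSpace ℝ (Fin (n + 1)) →L[ℝ] ℝ := (extLegendre ℓ z).2 with hb
  set c : EuclideanSpace ℝ (Fin (n + 1)) →L[ℝ] ℝ := p.2 with hc
  have hβv : β v = 1 := z.baseForm_eq_one
  have hbv : b v = ℓ z := extLegendre_snd_velocity z
  have hcv : ℓ z = c v := hconst
  have h1 : b (w - β w • v) = c (w - β w • v) := (hmem hzS).2 _ (by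
    change β (w - β w • v) = 0
    rw [map_sub, map_smul, hβv, smul_eq_mul, mul_one, sub_self])
  rw [map_sub, map_sub, map_smul, map_smul, hbv, hcv] at h1
  exact sub_left_injective h1

lemma injOn_mu (hℓ : ContMDiff 𝓘(ℝ, J1Model n) 𝓘(ℝ, ℝ) ∞ ℓ) (hreg : IsAlmostRegular ℓ) :
    InjOn Φ.mu (range (extLegendre ℓ)) := by
  rintro _ ⟨y, rfl⟩ _ ⟨z, rfl⟩ h
  exact extLegendre_eq_of_legendre_eq hℓ hreg h

end FiberedManifold

/-! ### Transfer of the general results to the two algorithms. -/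

namespace FiberedManifold

variable {n : ℕ} {E B : Type*}
    [TopologicalSpace E] [ChartedSpace (EuclideanSpace ℝ (Fin (n + 1))) E]
    [IsManifold (𝓡 (n + 1)) ∞ E]
    [TopologicalSpace B] [ChartedSpace ℝ B] [IsManifold 𝓘(ℝ, ℝ) ∞ B]
    {Φ : FiberedManifold n E B} {ℓ : Φ.J1 → ℝ}

lemma hamSetExt_subset_range (i : ℕ) : hamSetExt ℓ i ⊆ range (extLegendre ℓ) :=
  constraintSet_subset (cotModel n) i

lemma legendre_mem_hamSet_iff (hinj : InjOn Φ.mu (range (extLegendre ℓ))) (i : ℕ) (y : Φ.J1) :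
    legendre ℓ y ∈ hamSet ℓ i ↔ extLegendre ℓ y ∈ hamSetExt ℓ i := by
  constructor
  · rintro ⟨q, hq, hqy⟩
    rwa [← hinj (hamSetExt_subset_range i hq) (mem_range_self y) hqy]
  · exact fun h => ⟨_, h, rfl⟩

lemma lagSet_eq_preimage (hreg : IsAlmostRegular ℓ) (i : ℕ)
    (h : ∀ j < i, IsRegularSubmanifold (cotModel n) (hamSetExt ℓ j)) :
    lagSet ℓ i = extLegendre ℓ ⁻¹' hamSetExt ℓ i :=
  constraintSet_eq_preimage 𝓘(ℝ, J1Model n) (cotModel n) hreg.submersion hreg.regular_range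
    (etaL_eq (hreg.submersion.contMDiff)) (omegaL_eq (hreg.submersion.contMDiff)) i h

/-- Functions on `T^*E` descend to `J^{1*}E` along the image of the extended Legendre map. -/
lemma exists_eqOn_mu (hinj : InjOn Φ.mu (range (extLegendre ℓ))) {r : ℕ}
    (χ : Fin r → Φ.Cotangent → ℝ) :
    ∃ ξ : Fin r → Φ.J1Dual → ℝ, ∀ j, EqOn (fun q => ξ j (Φ.mu q)) (χ j) (range (extLegendre ℓ)) := by
  classical
  refine ⟨fun j m => if h : ∃ q ∈ range (extLegendre ℓ), Φ.mu q = m then χ j h.choose else 0,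
    fun j q hq => ?_⟩
  have h : ∃ q' ∈ range (extLegendre ℓ), Φ.mu q' = Φ.mu q := ⟨q, hq, rfl⟩
  beta_reduce
  rw [dif_pos h, hinj h.choose_spec.1 hq h.choose_spec.2]

/-- The functions are found on T^*E and then descended through μ, which is injective on 𝒫̃; only
their values on 𝒫̃ enter. -/
lemma exists_related_independentBasis [T2Space E] (hinj : InjOn Φ.mu (range (extLegendre ℓ)))
    (hreg : IsAlmostRegular ℓ) {i : ℕ}
    (h : ∀ j ≤ i + 1, IsRegularSubmanifold (cotModel n) (hamSetExt ℓ j)) {p : Φ.Cotangent}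
    (hp : p ∈ hamSetExt ℓ (i + 1)) :
    ∃ (U : Set Φ.Cotangent) (r : ℕ) (ξ : Fin r → Φ.J1Dual → ℝ), IsOpen U ∧ p ∈ U ∧
      IsIndependentBasis (cotModel n) (range (extLegendre ℓ))
        (hamSetExt ℓ i) (hamSetExt ℓ (i + 1)) U (fun j q => ξ j (Φ.mu q)) ∧
      IsIndependentBasis 𝓘(ℝ, J1Model n) univ
        (lagSet ℓ i) (lagSet ℓ (i + 1)) (extLegendre ℓ ⁻¹' U) (fun j z => ξ j (legendre ℓ z)) := by
  obtain ⟨U, r, χ, hU, hpU, h1, h2⟩ := exists_independentBasis 𝓘(ℝ, J1Model n) (cotModel n)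
    hreg.submersion hreg.regular_range (h i (by omega)) (hamSetExt_subset_range i)
    (h (i + 1) le_rfl) (fun q hq => hq.1) hp
  obtain ⟨ξ, hξ⟩ := exists_eqOn_mu hinj χ
  refine ⟨U, r, ξ, hU, hpU, h1.congr (cotModel n) (hamSetExt_subset_range i) hξ, ?_⟩
  rw [lagSet_eq_preimage hreg i fun j hj => h j (by omega),
    lagSet_eq_preimage hreg (i + 1) fun j hj => h j (by omega)]
  exact h2.congr 𝓘(ℝ, J1Model n) (subset_univ _) fun j z _ => hξ j (mem_range_self z)

lemma exists_related_constraintBasis [T2Space E] [SigmaCompactSpace E]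
    (hinj : InjOn Φ.mu (range (extLegendre ℓ))) (hreg : IsAlmostRegular ℓ) {i : ℕ}
    (h : ∀ j ≤ i + 1, IsRegularSubmanifold (cotModel n) (hamSetExt ℓ j))
    {Y : ∀ y : Φ.J1, TangentSpace 𝓘(ℝ, J1Model n) y}
    {Y' : ∀ p : Φ.Cotangent, TangentSpace (cotModel n) p}
    (hY' : IsConnectionField (cotModel n) (range (extLegendre ℓ)) Φ.etaH Y')
    (hYY : ∀ y, dExtLegendre ℓ y (Y y) = Y' (extLegendre ℓ y)) {s : ℕ}
    (hrk : ∀ y ∈ lagSet ℓ i, Module.finrank ℝ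
      (orthTo 𝓘(ℝ, J1Model n) univ Φ.etaL (omegaL ℓ) Y (lagSet ℓ i) y) = s)
    {p : Φ.Cotangent} (hp : p ∈ hamSetExt ℓ (i + 1)) :
    ∃ (U : Set Φ.Cotangent) (r : ℕ) (ξ : Fin r → Φ.J1Dual → ℝ), IsOpen U ∧ p ∈ U ∧
      IsConstraintBasis (cotModel n) (range (extLegendre ℓ)) Φ.etaH Φ.omegaH Y'
        (hamSetExt ℓ i) (hamSetExt ℓ (i + 1)) p U (fun j q => ξ j (Φ.mu q)) ∧
      ∀ y, extLegendre ℓ y = p →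
        IsConstraintBasis 𝓘(ℝ, J1Model n) univ Φ.etaL (omegaL ℓ) Y
          (lagSet ℓ i) (lagSet ℓ (i + 1)) y (extLegendre ℓ ⁻¹' U)
          (fun j z => ξ j (legendre ℓ z)) := by
  rw [lagSet_eq_preimage hreg i fun j hj => h j (by omega)] at hrk
  obtain ⟨U, r, χ, hU, hpU, h1, h2⟩ := exists_constraintBasis 𝓘(ℝ, J1Model n) (cotModel n)
    hreg.submersion subset_rfl hreg.regular_range Φ.isSmoothForm_etaH
    Φ.isSmoothForm_liouville.isSmoothTwoForm_neg_extDer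
    (etaL_eq (hreg.submersion.contMDiff)) (omegaL_eq (hreg.submersion.contMDiff))
    Φ.omegaH_swap hY' hYY (h i (by omega)) hrk hp.1
  obtain ⟨ξ, hξ⟩ := exists_eqOn_mu hinj χ
  refine ⟨U, r, ξ, hU, hpU, h1.congr (cotModel n) (hamSetExt_subset_range i) hξ, fun y hy => ?_⟩
  rw [lagSet_eq_preimage hreg i fun j hj => h j (by omega),
    lagSet_eq_preimage hreg (i + 1) fun j hj => h j (by omega)]
  exact (h2 y hy).congr 𝓘(ℝ, J1Model n) (subset_univ _) fun j z _ => hξ j (mem_range_self z)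

end FiberedManifold

end NonAutMech
end

/-! ### The equivalence of the two algorithms. -/

theorem mainTheorem4 {n : ℕ} {E B : Type*}
    [TopologicalSpace E] [ChartedSpace (EuclideanSpace ℝ (Fin (n + 1))) E]
    [IsManifold (𝓡 (n + 1)) ∞ E] [T2Space E] [SigmaCompactSpace E] [ConnectedSpace E]
    [TopologicalSpace B] [ChartedSpace ℝ B] [IsManifold 𝓘(ℝ, ℝ) ∞ B]
    [T2Space B] [SigmaCompactSpace B] [ConnectedSpace B]
    (Φ : FiberedManifold n E B) (ℓ : Φ.J1 → ℝ)
    (hℓ : ContMDiff 𝓘(ℝ, J1Model n) 𝓘(ℝ, ℝ) ∞ ℓ) (hreg : IsAlmostRegular ℓ) :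
    -- `μ₀ : 𝒫̃ → 𝒫` is bijective, so that it transports the manifold structure of `𝒫̃` to `𝒫`
    InjOn Φ.mu (range (extLegendre ℓ)) ∧
    ∀ i : ℕ,
      -- the sets produced by the two algorithms up to level `i + 1` are regular submanifolds
      (∀ j ≤ i + 1, IsRegularSubmanifold 𝓘(ℝ, J1Model n) (lagSet ℓ j) ∧
        IsRegularSubmanifold (cotModel n) (hamSetExt ℓ j)) →
      -- `FL_i⁻¹(P_{i+1}) = M_{i+1}` and `FL_i(M_{i+1}) = P_{i+1}`
      (lagSet ℓ i ∩ legendre ℓ ⁻¹' hamSet ℓ (i + 1) = lagSet ℓ (i + 1) ∧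
        legendre ℓ '' lagSet ℓ (i + 1) = hamSet ℓ (i + 1)) ∧
      -- `FL_{i+1} : M_{i+1} → P_{i+1}` is a submersion
      IsSubmersionBetween 𝓘(ℝ, J1Model n) (cotModel n) (extLegendre ℓ)
        (lagSet ℓ (i + 1)) (hamSetExt ℓ (i + 1)) ∧
      -- its fibres are those of `FL₀`, and the kernels of the tangent maps agree
      (∀ y ∈ lagSet ℓ (i + 1),
        lagSet ℓ (i + 1) ∩ legendre ℓ ⁻¹' {legendre ℓ y} = legendre ℓ ⁻¹' {legendre ℓ y} ∧
        (∀ X : TangentSpace 𝓘(ℝ, J1Model n) y, dExtLegendre ℓ y X = 0 →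
          X ∈ tangentTo 𝓘(ℝ, J1Model n) (lagSet ℓ (i + 1)) y) ∧
        (∀ X : TangentSpace 𝓘(ℝ, J1Model n) y, dExtLegendre ℓ y X = 0 ↔
          dBase y X = 0 ∧ omegaL ℓ y X = 0)) ∧
      -- for `FL₀`-related connections there are, around each fibre over `P_{i+1}`, bases of the
      -- constraints `i(Z)(η - γ)` of generation `i + 1` that are `FL₀`-related
      (∀ (Y : ∀ y : Φ.J1, TangentSpace 𝓘(ℝ, J1Model n) y)
          (Y' : ∀ p : Φ.Cotangent, TangentSpace (cotModel n) p),
        IsConnectionField 𝓘(ℝ, J1Model n) univ Φ.etaL Y →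
        IsConnectionField (cotModel n) (range (extLegendre ℓ)) Φ.etaH Y' →
        (∀ y, dExtLegendre ℓ y (Y y) = Y' (extLegendre ℓ y)) →
        (∃ s : ℕ, ∀ y ∈ lagSet ℓ i, Module.finrank ℝ
          (orthTo 𝓘(ℝ, J1Model n) univ Φ.etaL (omegaL ℓ) Y (lagSet ℓ i) y) = s) →
        ∀ p ∈ hamSetExt ℓ (i + 1), ∃ (U : Set Φ.Cotangent) (r : ℕ) (ξ : Fin r → Φ.J1Dual → ℝ),
          IsOpen U ∧ p ∈ U ∧
          IsConstraintBasis (cotModel n) (range (extLegendre ℓ)) Φ.etaH Φ.omegaH Y'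
            (hamSetExt ℓ i) (hamSetExt ℓ (i + 1)) p U (fun j q => ξ j (Φ.mu q)) ∧
          ∀ y, extLegendre ℓ y = p →
            IsConstraintBasis 𝓘(ℝ, J1Model n) univ Φ.etaL (omegaL ℓ) Y
              (lagSet ℓ i) (lagSet ℓ (i + 1)) y (extLegendre ℓ ⁻¹' U)
              (fun j z => ξ j (legendre ℓ z))) ∧
      -- likewise there are `FL₀`-related families of independent functions defining
      -- `P_{i+1}` in `P_i` and `M_{i+1}` in `M_i`
      (∀ p ∈ hamSetExt ℓ (i + 1), ∃ (U : Set Φ.Cotangent) (r : ℕ) (ξ : Fin r → Φ.J1Dual → ℝ),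
          IsOpen U ∧ p ∈ U ∧
          IsIndependentBasis (cotModel n) (range (extLegendre ℓ))
            (hamSetExt ℓ i) (hamSetExt ℓ (i + 1)) U (fun j q => ξ j (Φ.mu q)) ∧
          IsIndependentBasis 𝓘(ℝ, J1Model n) univ
            (lagSet ℓ i) (lagSet ℓ (i + 1)) (extLegendre ℓ ⁻¹' U)
            (fun j z => ξ j (legendre ℓ z))) ∧
      -- `M_{i+1}` in `J¹E` and `P_{i+1}` in `𝒫` have the same codimension
      (∀ y ∈ lagSet ℓ (i + 1),
        codimAt 𝓘(ℝ, J1Model n) univ (lagSet ℓ (i + 1)) y =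
          codimAt (cotModel n) (range (extLegendre ℓ)) (hamSetExt ℓ (i + 1)) (extLegendre ℓ y)) := by
  have hinj := injOn_mu hℓ hreg
  refine ⟨hinj, fun i hsub => ?_⟩
  have hham : ∀ j ≤ i + 1, IsRegularSubmanifold (cotModel n) (hamSetExt ℓ j) :=
    fun j hj => (hsub j hj).2
  have hf := hreg.submersion
  have hlag : lagSet ℓ i = extLegendre ℓ ⁻¹' hamSetExt ℓ i :=
    lagSet_eq_preimage hreg i fun j hj => hham j (by omega)
  have hlag' : lagSet ℓ (i + 1) = extLegendre ℓ ⁻¹' hamSetExt ℓ (i + 1) :=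
    lagSet_eq_preimage hreg (i + 1) fun j hj => hham j (by omega)
  have hQ := hham (i + 1) le_rfl
  have hQT : hamSetExt ℓ (i + 1) ⊆ range (extLegendre ℓ) := hamSetExt_subset_range (i + 1)
  refine ⟨⟨?_, ?_⟩, ⟨?_, ?_, ?_⟩, fun y hy => ⟨?_, ?_, ?_⟩, ?_, ?_, ?_⟩
  · ext y
    rw [hlag, hlag']
    change extLegendre ℓ y ∈ hamSetExt ℓ i ∧ legendre ℓ y ∈ hamSet ℓ (i + 1) ↔ _
    rw [legendre_mem_hamSet_iff hinj]
    exact ⟨fun h => h.2, fun h => ⟨h.1, h⟩⟩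
  · ext m
    rw [hlag']
    constructor
    · rintro ⟨y, hy, rfl⟩
      exact ⟨_, hy, rfl⟩
    · rintro ⟨q, hq, rfl⟩
      obtain ⟨y, rfl⟩ := hQT hq
      exact ⟨y, hq, rfl⟩
  · rw [hlag']
    exact fun y hy => hy
  · exact fun y _ => hf.2.1 y trivial
  · rw [hlag']
    exact fun y hy => map_tangentTo_preimage 𝓘(ℝ, J1Model n) (cotModel n) hf hreg.regular_range
      hQ hQT hy
  · refine inter_eq_right.2 fun z hz => ?_
    rw [hlag'] at hy ⊢
    rw [mem_preimage, extLegendre_eq_of_legendre_eq hℓ hreg hz]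
    exact hy
  · intro X hX
    rw [hlag'] at hy ⊢
    refine (mem_tangentTo_preimage_iff 𝓘(ℝ, J1Model n) (cotModel n) hf hreg.regular_range
      hQ hQT hy X).2 ?_
    have h0 : mfderiv 𝓘(ℝ, J1Model n) (cotModel n) (extLegendre ℓ) y X = 0 := hX
    rw [h0]
    exact zero_mem _
  · exact dExtLegendre_eq_zero_iff hf.contMDiff y
  · rintro Y Y' - hY' hYY ⟨s, hs⟩ p hp
    exact exists_related_constraintBasis hinj hreg hham hY' hYY hs hp
  · intro p hp
    exact exists_related_independentBasis hinj hreg hham hp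
  · rw [hlag']
    intro y hy
    exact codimAt_preimage 𝓘(ℝ, J1Model n) (cotModel n) hf hreg.regular_range hQ hQT hy
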